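/- A \emph{marked graph diagram} is a diagram in the plane with classical crossings and with $4$-valent vertices, each decorated by a marker (a \emph{marked vertex}). Splicing all marked vertices along their markers, respectively across their markers, gives two classical link diagrams, the positive and the negative resolution; the marked graph diagram is \emph{admissible} if both resolutions are diagrams of trivial links. An (unoriented) \emph{surface-link} is understood here as an equivalence class of admissible marked graph diagrams under plane isotopy and the Yoshikawa moves $\Gamma_1,\dots,\Gamma_8$. The \emph{ch-index} $\mathrm{ch}(K)$ of a surface-link $K$ is the minimum, over all marked graph diagrams $D$ presenting $K$, of the total number of crossings and marked vertices of $D$. A \emph{marked graph $n$-mosaic} is an $n\times n$ matrix whose entries are the eleven unoriented knot mosaic tiles (the empty tile, the four tiles with one corner arc, the two tiles with one straight segment, the two tiles with two disjoint corner arcs, the two crossing tiles) and the two tiles with one marked vertex, such that every connection point of every tile (the midpoint of a side of the tile at which one of its arcs ends) coincides with a connection point of a contiguous tile. Such a mosaic is a marked graph diagram. The \emph{mosaic number} $m(K)$ is the smallest $n$ such that $K$ is presented by a marked graph $n$-mosaic. \textbf{Theorem.} Let $K$ be a surface-link. If $\mathrm{ch}(K)\ge 7$, then $m(K)\ge 6$.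 -/

import Mathlib

/-!
# Surface-links, marked graph diagrams and marked graph mosaics

A plane diagram in general position with respect to the height function is read from top to
bottom. Every horizontal level meets it in finitely many strands, numbered `0, 1, 2, …` from left
to right, and from one regular level to the next exactly one elementary event happens: a local
maximum, a local minimum, a crossing or a marked vertex. A marked graph diagram is recorded as the
list of these events. Plane isotopy and the Yoshikawa moves become local moves on such lists.
-/

namespace MarkedGraph

/-! ### Marked graph diagrams -/

/-- The elementary events of a plane diagram which is read from top to bottom.
* `localMax`: two adjacent strands are born, joined by an arc above.
* `localMin`: two adjacent strands die, joined by an arc below.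
* `crossing b`: two adjacent strands cross. The strand from the upper left to the lower right is
  the over-strand if `b = true`, and it is the under-strand if `b = false`.
* `marked b`: a `4`-valent vertex with two edges going up and two edges going down. Its marker is
  vertical (it separates the two left edges from the two right edges) if `b = true`, and
  horizontal (it separates the two upper edges from the two lower edges) if `b = false`. -/
inductive Event
  | localMax
  | localMin
  | crossing (b : Bool)
  | marked (b : Bool)
  deriving DecidableEq

/-- The number of strands which enter an event from above. -/
def Event.inputs : Event → ℕ
  | .localMax => 0
  | .localMin => 2
  | .crossing _ => 2
  | .marked _ => 2

/-- The number of strands which leave an event below. -/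
def Event.outputs : Event → ℕ
  | .localMax => 2
  | .localMin => 0
  | .crossing _ => 2
  | .marked _ => 2

/-- An event with its position: `pos` is the number of strands to the left of the event. -/
structure Piece where
  pos : ℕ
  event : Event
  deriving DecidableEq

/-- Local maximum at position `i`. -/
abbrev cup (i : ℕ) : Piece := ⟨i, .localMax⟩
/-- Local minimum at position `i`. -/
abbrev cap (i : ℕ) : Piece := ⟨i, .localMin⟩
/-- Crossing of the strands `i` and `i + 1`. -/
abbrev cross (i : ℕ) (b : Bool) : Piece := ⟨i, .crossing b⟩
/-- Marked vertex on the strands `i` and `i + 1`. -/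
abbrev vert (i : ℕ) (b : Bool) : Piece := ⟨i, .marked b⟩

/-- The number of strands below a piece, if there are `n` strands above it; `none` if there are
not enough strands for the piece. -/
def Piece.strands (p : Piece) (n : ℕ) : Option ℕ :=
  if p.pos + p.event.inputs ≤ n then some (n - p.event.inputs + p.event.outputs) else none

/-- The number of strands below a list of pieces, if there are `n` strands above it; `none` if
some piece does not find enough strands. -/
def strands : List Piece → ℕ → Option ℕ
  | [], n => some n
  | p :: w, n => (p.strands n).bind (strands w)

/-- A marked graph diagram: a list of pieces without strands at the top and at the bottom. -/
@[ext] structure Diagram where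
  word : List Piece
  closed : strands word 0 = some 0

/-- Crossings and marked vertices are counted by the ch-index. -/
def Piece.isNode (p : Piece) : Bool :=
  match p.event with
  | .crossing _ => true
  | .marked _ => true
  | _ => false

/-- The ch-index of a diagram: the total number of its crossings and marked vertices. -/
def Diagram.chIndex (D : Diagram) : ℕ := D.word.countP Piece.isNode

/-! ### Moves -/

/-- Local moves which generate plane isotopy: changing the heights of two events which are apart
from each other, cancelling a local maximum against a local minimum, and turning a crossing or a
marked vertex by a quarter of a full turn. -/
inductive PlanarMove : List Piece → List Piece → Prop
  | interchange (i k : ℕ) (p q : Event) :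
      PlanarMove [⟨i, p⟩, ⟨i + p.outputs + k, q⟩] [⟨i + p.inputs + k, q⟩, ⟨i, p⟩]
  | zigzag (i : ℕ) : PlanarMove [cup i, cap (i + 1)] []
  | zigzag' (i : ℕ) : PlanarMove [cup (i + 1), cap i] []
  | turnCrossMax (i : ℕ) (b : Bool) :
      PlanarMove [cup i, cross (i + 1) b] [cup (i + 1), cross i (!b)]
  | turnCrossMin (i : ℕ) (b : Bool) :
      PlanarMove [cross (i + 1) b, cap i] [cross i (!b), cap (i + 1)]
  | turnVertMax (i : ℕ) (b : Bool) :
      PlanarMove [cup i, vert (i + 1) b] [cup (i + 1), vert i (!b)]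
  | turnVertMin (i : ℕ) (b : Bool) :
      PlanarMove [vert (i + 1) b, cap i] [vert i (!b), cap (i + 1)]

/-- The Reidemeister moves `Γ₁`, `Γ₂`, `Γ₃`. In `Γ₃` the crossings `b`, `c`, `d` are between the
first and the second, the first and the third, and the second and the third strand; the condition
says that the three strands lie at three different heights. -/
inductive ReidemeisterMove : List Piece → List Piece → Prop
  | gamma1 (i : ℕ) (b : Bool) : ReidemeisterMove [cup i, cross i b] [cup i]
  | gamma2 (i : ℕ) (b : Bool) : ReidemeisterMove [cross i b, cross i (!b)] []
  | gamma3 (i : ℕ) (b c d : Bool) (h : b = d → c = b) :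
      ReidemeisterMove [cross i b, cross (i + 1) c, cross i d]
        [cross (i + 1) d, cross i c, cross (i + 1) b]

/-- The strands `i` and `i + 1` cross the strands `i + 2` and `i + 3`; they run over them if
`b = true`, and under them if `b = false`. -/
def doubleCross (i : ℕ) (b : Bool) : List Piece :=
  [cross (i + 1) b, cross i b, cross (i + 2) b, cross (i + 1) b]

/-- The Yoshikawa moves which involve marked vertices: a strand passes over or under a marked
vertex (`Γ₄`, `Γ₄'`), a marked vertex is flipped (`Γ₅`), a kink at a marked vertex is removed
(`Γ₆`, `Γ₆'`), and the two moves `Γ₇` (sliding one saddle band over another one) and `Γ₈` (passing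
one saddle band through another one), which involve two marked vertices. -/
inductive MarkedVertexMove : List Piece → List Piece → Prop
  | gamma4 (i : ℕ) (b c : Bool) :
      MarkedVertexMove [cross i b, cross (i + 1) b, vert i c]
        [vert (i + 1) c, cross i b, cross (i + 1) b]
  | gamma5 (i : ℕ) (b c : Bool) : MarkedVertexMove [cross i b, vert i c] [vert i c, cross i b]
  | gamma6 (i : ℕ) (c : Bool) : MarkedVertexMove [cup i, vert i c] [cup i]
  | gamma7 (i : ℕ) (c : Bool) :
      MarkedVertexMove [vert i c, vert (i + 1) (!c)] [vert (i + 1) (!c), vert i c]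
  | gamma8 (i : ℕ) (b c : Bool) :
      MarkedVertexMove ([vert i c, vert (i + 2) (!c)] ++ doubleCross i (!b))
        (doubleCross i b ++ [vert i (!c), vert (i + 2) c])

/-- The moves of classical link diagrams. -/
def LinkMove (s t : List Piece) : Prop := PlanarMove s t ∨ ReidemeisterMove s t

/-- The moves of marked graph diagrams: plane isotopy and all Yoshikawa moves. -/
def YoshikawaMove (s t : List Piece) : Prop :=
  PlanarMove s t ∨ ReidemeisterMove s t ∨ MarkedVertexMove s t

/-- `D'` is obtained from `D` by one application of a move in a part of the diagram. -/
def LocalStep (R : List Piece → List Piece → Prop) (D D' : Diagram) : Prop :=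
  ∃ u v s t : List Piece, R s t ∧ D.word = u ++ s ++ v ∧ D'.word = u ++ t ++ v

/-- Equivalence of link diagrams: a finite sequence of plane isotopies and Reidemeister moves
(in both directions). -/
def LinkEquiv : Diagram → Diagram → Prop := Relation.EqvGen (LocalStep LinkMove)

/-- Equivalence of marked graph diagrams: a finite sequence of plane isotopies and Yoshikawa moves
(in both directions). -/
def YoshikawaEquiv : Diagram → Diagram → Prop := Relation.EqvGen (LocalStep YoshikawaMove)

/-! ### Resolutions and admissibility -/

/-- Splicing a marked vertex along its marker (`s = true`) or across its marker (`s = false`);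
all other pieces remain. -/
def Piece.splice (s : Bool) (p : Piece) : List Piece :=
  match p.event with
  | .marked b => if b = s then [] else [cap p.pos, cup p.pos]
  | _ => [p]

lemma strands_append (u v : List Piece) (n : ℕ) :
    strands (u ++ v) n = (strands u n).bind (strands v) := by
  induction u generalizing n with
  | nil => rfl
  | cons p u ih =>
    simp only [List.cons_append, strands]
    cases p.strands n with
    | none => rfl
    | some m => simpa using ih m

lemma strands_splice (s : Bool) (p : Piece) (n m : ℕ) (h : p.strands n = some m) :
    strands (p.splice s) n = some m := by
  obtain ⟨i, e⟩ := p
  cases e with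
  | marked b =>
    simp only [Piece.strands, Event.inputs, Event.outputs] at h
    have h1 : i + 2 ≤ n := by
      by_contra h1
      simp [h1] at h
    obtain rfl : n - 2 + 2 = m := by simpa [h1] using h
    by_cases hb : b = s
    · simp [Piece.splice, hb, strands]; omega
    · have h2 : i ≤ n - 2 := by omega
      simp [Piece.splice, hb, strands, Piece.strands, Event.inputs, Event.outputs, h1, h2]
  | _ => simp [Piece.splice, strands, h]

lemma strands_flatMap_splice (s : Bool) (w : List Piece) (n m : ℕ) (h : strands w n = some m) :
    strands (w.flatMap (Piece.splice s)) n = some m := by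
  induction w generalizing n with
  | nil => simpa using h
  | cons p w ih =>
    simp only [strands] at h
    obtain ⟨k, hk, hw⟩ := Option.bind_eq_some_iff.1 h
    rw [List.flatMap_cons, strands_append, strands_splice s p n k hk]
    exact ih k hw

/-- The positive resolution `L₊(D)` (`s = true`) and the negative resolution `L₋(D)`
(`s = false`) of a marked graph diagram. -/
def Diagram.resolution (s : Bool) (D : Diagram) : Diagram where
  word := D.word.flatMap (Piece.splice s)
  closed := strands_flatMap_splice s D.word 0 0 D.closed

/-- A link diagram is trivial if it is equivalent to a diagram without crossings. (It is only
applied to diagrams without marked vertices, and link moves do not create marked vertices.) -/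
def Diagram.IsTrivialLink (L : Diagram) : Prop := ∃ L' : Diagram, LinkEquiv L L' ∧ L'.chIndex = 0

/-- A marked graph diagram is admissible if both its resolutions are trivial links. -/
def Diagram.IsAdmissible (D : Diagram) : Prop :=
  (D.resolution true).IsTrivialLink ∧ (D.resolution false).IsTrivialLink

/-! ### Surface-links -/

/-- Admissible marked graph diagrams up to plane isotopy and Yoshikawa moves. -/
def surfaceLinkSetoid : Setoid {D : Diagram // D.IsAdmissible} where
  r D D' := YoshikawaEquiv D.1 D'.1
  iseqv :=
    { refl := fun D => Relation.EqvGen.refl D.1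
      symm := fun h => Relation.EqvGen.symm _ _ h
      trans := fun h h' => Relation.EqvGen.trans _ _ _ h h' }

/-- (Unoriented) surface-links up to equivalence, as classes of admissible marked graph diagrams
modulo plane isotopy and Yoshikawa moves. -/
def SurfaceLink : Type := Quotient surfaceLinkSetoid

/-- The diagram `D` presents the surface-link `K`. -/
def Diagram.Presents (D : Diagram) (K : SurfaceLink) : Prop :=
  ∃ h : D.IsAdmissible, Quotient.mk surfaceLinkSetoid ⟨D, h⟩ = K

/-- The ch-index of a surface-link: the least ch-index of all marked graph diagrams which present
it. (Every surface-link is presented by some diagram.) -/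
noncomputable def SurfaceLink.chIndex (K : SurfaceLink) : ℕ :=
  sInf {k : ℕ | ∃ D : Diagram, D.Presents K ∧ D.chIndex = k}

/-! ### Marked graph mosaics -/

/-- The sides of a tile. -/
inductive Side
  | north
  | east
  | south
  | west

/-- The mosaic tiles: the eleven tiles of knot mosaics and the two tiles with a marked vertex.
* `arc…`: a single arc which joins the midpoints of the two sides named.
* `twoArcs…`: two disjoint arcs.
* `crossing b`: the horizontal and the vertical segment cross; the horizontal one is the
  over-strand if `b = true`, and the vertical one is if `b = false`.
* `marked b`: a marked vertex with an edge to each side; its marker lies on the diagonal from the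
  north-west to the south-east corner if `b = true`, and on the other diagonal if `b = false`. -/
inductive Tile
  | blank
  | arcWS
  | arcSE
  | arcNE
  | arcNW
  | arcWE
  | arcNS
  | twoArcsWSNE
  | twoArcsNWSE
  | crossing (b : Bool)
  | marked (b : Bool)
  deriving DecidableEq

/-- The tile has a connection point on the given side. -/
def Tile.connects : Tile → Side → Bool
  | .blank, _ => false
  | .arcWS, .west => true
  | .arcWS, .south => true
  | .arcWS, _ => false
  | .arcSE, .south => true
  | .arcSE, .east => true
  | .arcSE, _ => false
  | .arcNE, .north => true
  | .arcNE, .east => true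
  | .arcNE, _ => false
  | .arcNW, .north => true
  | .arcNW, .west => true
  | .arcNW, _ => false
  | .arcWE, .west => true
  | .arcWE, .east => true
  | .arcWE, _ => false
  | .arcNS, .north => true
  | .arcNS, .south => true
  | .arcNS, _ => false
  | .twoArcsWSNE, _ => true
  | .twoArcsNWSE, _ => true
  | .crossing _, _ => true
  | .marked _, _ => true

/-- Every connection point of every tile meets a connection point of a contiguous tile. -/
def SuitablyConnected {n : ℕ} (M : Matrix (Fin n) (Fin n) Tile) : Prop :=
  ∀ i j : Fin n,
    ((M i j).connects .north = true →
      ∃ i' : Fin n, (i' : ℕ) + 1 = i ∧ (M i' j).connects .south = true) ∧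
    ((M i j).connects .south = true →
      ∃ i' : Fin n, (i' : ℕ) = i + 1 ∧ (M i' j).connects .north = true) ∧
    ((M i j).connects .west = true →
      ∃ j' : Fin n, (j' : ℕ) + 1 = j ∧ (M i j').connects .east = true) ∧
    ((M i j).connects .east = true →
      ∃ j' : Fin n, (j' : ℕ) = j + 1 ∧ (M i j').connects .west = true)

/-- A marked graph `n`-mosaic: an `n × n` matrix of suitably connected tiles. -/
structure Mosaic (n : ℕ) where
  tile : Matrix (Fin n) (Fin n) Tile
  connected : SuitablyConnected tile

/-! The marked graph diagram drawn by a mosaic. The tiles are read row by row, each row from left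
to right. The tiles already read are separated from the other ones by a staircase line; turning
the picture by 45 degrees makes this line descend over the diagram, the west and north sides of
the next tile becoming its upper left and upper right side, and its south and east sides becoming
its lower left and lower right side. -/

/-- The pieces drawn by one tile, if `i` strands lie to the left of the tile. -/
def Tile.pieces (i : ℕ) : Tile → List Piece
  | .blank => []
  | .arcWS => []
  | .arcSE => [cup i]
  | .arcNE => []
  | .arcNW => [cap i]
  | .arcWE => []
  | .arcNS => []
  | .twoArcsWSNE => []
  | .twoArcsNWSE => [cap i, cup i]
  | .crossing b => [cross i b]
  | .marked b => [vert i b]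

/-- The pieces drawn by a row of tiles, if `i` strands lie to the left of it. The strands to the
left of a tile are those which leave the previous tiles of the row through their south sides. -/
def rowWord : ℕ → List Tile → List Piece
  | _, [] => []
  | i, t :: ts => t.pieces i ++ rowWord (i + (t.connects .south).toNat) ts

/-- The list of the rows of a matrix of tiles. -/
def rows {n : ℕ} (M : Matrix (Fin n) (Fin n) Tile) : List (List Tile) :=
  List.ofFn fun i => List.ofFn (M i)

/-- The number of tiles in a list which have a connection point on the given side. -/
def sideCount (s : Side) (ts : List Tile) : ℕ := (ts.map fun t => (t.connects s).toNat).sum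

lemma strands_pieces (t : Tile) (i m : ℕ) :
    strands (t.pieces i)
        (i + (t.connects .west).toNat + ((t.connects .north).toNat + m)) =
      some (i + (t.connects .south).toNat + (t.connects .east).toNat + m) := by
  have h1 : i + 2 ≤ i + 1 + (1 + m) := by omega
  have h2 : i + 1 + (1 + m) - 2 = i + m := by omega
  cases t <;>
    simp [Tile.pieces, Tile.connects, strands, Piece.strands, Event.inputs, Event.outputs,
      h1, h2] <;>
    omega

/-- The connection points on the vertical sides inside a row match, `w` says whether a strand
enters from the left, and no strand leaves to the right. -/
def RowMatched : Bool → List Tile → Prop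
  | w, [] => w = false
  | w, t :: ts => t.connects .west = w ∧ RowMatched (t.connects .east) ts

lemma strands_rowWord (ts : List Tile) (w : Bool) (h : RowMatched w ts) (i : ℕ) :
    strands (rowWord i ts) (i + w.toNat + sideCount .north ts) =
      some (i + sideCount .south ts) := by
  induction ts generalizing w i with
  | nil =>
    simp only [RowMatched] at h
    simp [rowWord, strands, sideCount, h]
  | cons t ts ih =>
    obtain ⟨rfl, h2⟩ := h
    have e := ih _ h2 (i + (t.connects .south).toNat)
    simp only [sideCount, List.map_cons, List.sum_cons] at e ⊢
    rw [rowWord, strands_append, strands_pieces, Option.bind_some, e, add_assoc]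

lemma rowMatched_drop {n : ℕ} {M : Matrix (Fin n) (Fin n) Tile} (h : SuitablyConnected M)
    (i : Fin n) (k j : ℕ) (hj : j + k = n) :
    RowMatched (if hj : j < n then (M i ⟨j, hj⟩).connects .west else false)
      ((List.ofFn (M i)).drop j) := by
  induction k generalizing j with
  | zero =>
    have h1 : ¬ j < n := by omega
    rw [List.drop_eq_nil_of_le (by simp; omega)]
    simp [RowMatched, h1]
  | succ k ih =>
    have h1 : j < n := by omega
    rw [List.drop_eq_getElem_cons (by simpa using h1)]
    simp only [h1, dif_pos, List.getElem_ofFn]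
    refine ⟨rfl, ?_⟩
    have e : (M i ⟨j, h1⟩).connects .east =
        if hj : j + 1 < n then (M i ⟨j + 1, hj⟩).connects .west else false := by
      rw [Bool.eq_iff_iff]
      constructor
      · intro he
        obtain ⟨j', h2, h3⟩ := (h i ⟨j, h1⟩).2.2.2 he
        have h4 : j + 1 < n := by have := j'.2; simp at h2; omega
        obtain rfl : j' = ⟨j + 1, h4⟩ := Fin.ext h2
        simpa [h4] using h3
      · intro he
        split_ifs at he with h4
        obtain ⟨j', h2, h3⟩ := (h i ⟨j + 1, h4⟩).2.2.1 he
        obtain rfl : j' = ⟨j, h1⟩ := Fin.ext (by simpa using h2)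
        exact h3
    rw [e]
    exact ih (j + 1) (by omega)

lemma rowMatched_row {n : ℕ} {M : Matrix (Fin n) (Fin n) Tile} (h : SuitablyConnected M)
    (i : Fin n) : RowMatched false (List.ofFn (M i)) := by
  have e := rowMatched_drop h i n 0 (by omega)
  rw [List.drop_zero] at e
  convert e
  split_ifs with h0
  · rw [Bool.eq_iff_iff]
    refine ⟨fun hf => by simp at hf, fun he => ?_⟩
    obtain ⟨j', h2, -⟩ := (h i ⟨0, h0⟩).2.2.1 he
    simp at h2
  · rfl

lemma sideCount_ofFn_congr {n : ℕ} (f g : Fin n → Tile) (s s' : Side)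
    (h : ∀ j, (f j).connects s = (g j).connects s') :
    sideCount s (List.ofFn f) = sideCount s' (List.ofFn g) := by
  simp only [sideCount, List.map_ofFn]
  congr 2
  funext j
  simp [h j]

lemma sideCount_ofFn_eq_zero {n : ℕ} (f : Fin n → Tile) (s : Side)
    (h : ∀ j, (f j).connects s = false) : sideCount s (List.ofFn f) = 0 := by
  simp only [sideCount, List.map_ofFn]
  rw [List.sum_eq_zero]
  intro x hx
  obtain ⟨j, rfl⟩ := (List.mem_ofFn' _ _).1 hx
  simp [h j]

lemma strands_rows_drop {n : ℕ} {M : Matrix (Fin n) (Fin n) Tile} (h : SuitablyConnected M)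
    (k i : ℕ) (hi : i + k = n) :
    strands (((rows M).drop i).flatMap (rowWord 0))
      (if hi : i < n then sideCount .north (List.ofFn (M ⟨i, hi⟩)) else 0) = some 0 := by
  induction k generalizing i with
  | zero =>
    have h1 : ¬ i < n := by omega
    rw [List.drop_eq_nil_of_le (by simp [rows]; omega)]
    simp [strands, h1]
  | succ k ih =>
    have h1 : i < n := by omega
    rw [List.drop_eq_getElem_cons (by simpa [rows] using h1), List.flatMap_cons, strands_append]
    have e := strands_rowWord _ _ (rowMatched_row h ⟨i, h1⟩) 0
    simp only [Bool.toNat_false, zero_add] at e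
    simp only [h1, dif_pos, rows, List.getElem_ofFn, e, Option.bind_some]
    have e2 : sideCount .south (List.ofFn (M ⟨i, h1⟩)) =
        if hi : i + 1 < n then sideCount .north (List.ofFn (M ⟨i + 1, hi⟩)) else 0 := by
      split_ifs with h4
      · refine sideCount_ofFn_congr _ _ _ _ fun j => ?_
        rw [Bool.eq_iff_iff]
        constructor
        · intro he
          obtain ⟨i', h2, h3⟩ := (h ⟨i, h1⟩ j).2.1 he
          obtain rfl : i' = ⟨i + 1, h4⟩ := Fin.ext h2
          exact h3
        · intro he
          obtain ⟨i', h2, h3⟩ := (h ⟨i + 1, h4⟩ j).1 he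
          obtain rfl : i' = ⟨i, h1⟩ := Fin.ext (by simpa using h2)
          exact h3
      · refine sideCount_ofFn_eq_zero _ _ fun j => ?_
        rw [← Bool.not_eq_true]
        intro he
        obtain ⟨i', h2, -⟩ := (h ⟨i, h1⟩ j).2.1 he
        have := i'.2
        simp at h2
        omega
    rw [e2]
    exact ih (i + 1) (by omega)

/-- The marked graph diagram drawn by a marked graph mosaic. -/
def Mosaic.diagram {n : ℕ} (M : Mosaic n) : Diagram where
  word := (rows M.tile).flatMap (rowWord 0)
  closed := by
    have e := strands_rows_drop M.connected n 0 (by omega)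
    rw [List.drop_zero] at e
    convert e
    split_ifs with h0
    · refine (sideCount_ofFn_eq_zero _ _ fun j => ?_).symm
      rw [← Bool.not_eq_true]
      intro he
      obtain ⟨i', h2, -⟩ := (M.connected ⟨0, h0⟩ j).1 he
      simp at h2
    · rfl

/-- The mosaic number of a surface-link: the least `n` such that it is represented by a marked
graph `n`-mosaic. The value is taken in `ℕ∞`, so that no junk value can occur. -/
noncomputable def SurfaceLink.mosaicNumber (K : SurfaceLink) : ℕ∞ :=
  sInf {m : ℕ∞ | ∃ (n : ℕ) (M : Mosaic n), M.diagram.Presents K ∧ m = n}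

end MarkedGraph

/-! The contrapositive is proved: a surface-link presented by a mosaic of size at most five has
ch-index at most six. Tiles in the first and last columns and in the last row cannot carry a node (a
crossing or a marked vertex), so size at most four leaves at most `3 * 2` nodes.

For size five, the nodes are first treated as unknowns: the finitely many mosaics are enumerated
with one anonymous node tile. Pushing maxima down and pulling minima up, with removal of zigzags,
circles and kinks at nodes, brings each of them to at most six nodes or to one of five core words
with seven nodes (`checkRows_five`). All five are pretzel diagrams with columns of three, one and
three nodes (`coreWords_connects`).

Only now do the node types matter. Nodes of a column commute (`ColumnEquiv.of_perm`), opposite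
crossings cancel, equal marked vertices merge, and two marked vertices of different type let a
crossing of the column change its sign. Hence a column of three nodes becomes shorter or one of
seven irreducible columns. In each of the resulting 196 pretzels either one more node can be removed
(`small_flype_left`, `small_flype_right`, `small_delta`, and the slides `pretzel_slide_left`,
`pretzel_slide_right`) or a resolution has a number of dihedral 3- or 5-colourings that no trivial
link has (`irreducible_pretzel_cases`). The second alternative contradicts admissibility.

The last argument needs admissibility to be invariant under Yoshikawa moves (`isAdmissible_iff`).
The resolutions change by link moves, except that a kink removal at a marked vertex may remove a
circle; that this preserves triviality is shown by following the deletion of components through all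
link moves (`Del.linkEquiv_of_linkEquiv`).

Concrete isotopies are recorded as scripts of moves on symbolic words. A script is run by `decide`,
and `Connects.wordEquiv` turns a successful run into an equivalence for all node types and in all
surroundings. -/

namespace MarkedGraph

/-! ### Equivalence of words in a context -/

/-- The moves of link diagrams if `link = true`, and all moves of marked graph diagrams if
`link = false`. -/
def Move (link : Bool) (s t : List Piece) : Prop :=
  LinkMove s t ∨ (link = false ∧ MarkedVertexMove s t)

/-- Equivalence of diagrams under `Move link`. -/
def DiagramEquiv (link : Bool) : Diagram → Diagram → Prop :=
  Relation.EqvGen (LocalStep (Move link))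

lemma move_true : Move true = LinkMove := by
  funext s t
  simp [Move]

lemma move_false : Move false = YoshikawaMove := by
  funext s t
  simp [Move, YoshikawaMove, LinkMove, or_assoc]

lemma diagramEquiv_true : DiagramEquiv true = LinkEquiv := by
  unfold DiagramEquiv LinkEquiv
  rw [move_true]

lemma diagramEquiv_false : DiagramEquiv false = YoshikawaEquiv := by
  unfold DiagramEquiv YoshikawaEquiv
  rw [move_false]

lemma DiagramEquiv.mono {link : Bool} {D D' : Diagram} (h : DiagramEquiv true D D') :
    DiagramEquiv link D D' := by
  refine Relation.EqvGen.mono (fun D D' => ?_) _ _ h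
  rintro ⟨u, v, s, t, hst, h1, h2⟩
  rw [move_true] at hst
  exact ⟨u, v, s, t, Or.inl hst, h1, h2⟩

/-- Two words with `n` strands above them are interchangeable in every diagram. -/
def WordEquiv (link : Bool) (n : ℕ) (s t : List Piece) : Prop :=
  ∃ m, strands s n = some m ∧ strands t n = some m ∧
    ∀ (u v : List Piece) (hs : strands (u ++ s ++ v) 0 = some 0)
      (ht : strands (u ++ t ++ v) 0 = some 0), strands u 0 = some n →
      DiagramEquiv link ⟨u ++ s ++ v, hs⟩ ⟨u ++ t ++ v, ht⟩

namespace WordEquiv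

variable {link : Bool} {n m k : ℕ} {s t r a b : List Piece}

lemma of_move (h : Move link s t) (hs : strands s n = some m) (ht : strands t n = some m) :
    WordEquiv link n s t :=
  ⟨m, hs, ht, fun u v _ _ _ => Relation.EqvGen.rel _ _ ⟨u, v, s, t, h, rfl, rfl⟩⟩

lemma refl (hs : strands s n = some m) : WordEquiv link n s s :=
  ⟨m, hs, hs, fun _ _ _ _ _ => Relation.EqvGen.refl _⟩

lemma symm (h : WordEquiv link n s t) : WordEquiv link n t s := by
  obtain ⟨m, hs, ht, h⟩ := h
  exact ⟨m, ht, hs, fun u v h1 h2 h3 => Relation.EqvGen.symm _ _ (h u v h2 h1 h3)⟩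

lemma trans (h : WordEquiv link n s t) (h' : WordEquiv link n t r) : WordEquiv link n s r := by
  obtain ⟨m, hs, ht, h⟩ := h
  obtain ⟨m', ht', hr, h'⟩ := h'
  obtain rfl : m = m' := by simpa [ht] using ht'
  refine ⟨m, hs, hr, fun u v h1 h2 h3 => ?_⟩
  have h4 : strands (u ++ t ++ v) 0 = some 0 := by
    rw [← h1]
    simp [strands_append, h3, hs, ht]
  exact Relation.EqvGen.trans _ _ _ (h u v h1 h4 h3) (h' u v h4 h2 h3)

lemma strands_eq (h : WordEquiv link n s t) : strands s n = strands t n := by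
  obtain ⟨m, hs, ht, -⟩ := h
  rw [hs, ht]

lemma mono (h : WordEquiv true n s t) : WordEquiv link n s t := by
  obtain ⟨m, hs, ht, h⟩ := h
  exact ⟨m, hs, ht, fun u v h1 h2 h3 => (h u v h1 h2 h3).mono⟩

/-- Equivalent words may be exchanged inside a longer word. -/
lemma context (h : WordEquiv link m s t) (ha : strands a n = some m)
    (hd : (strands (a ++ s ++ b) n).isSome) : WordEquiv link n (a ++ s ++ b) (a ++ t ++ b) := by
  obtain ⟨l, hs, ht, h⟩ := h
  obtain ⟨k, hk⟩ := Option.isSome_iff_exists.1 hd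
  have hb : strands b l = some k := by simpa [strands_append, ha, hs] using hk
  refine ⟨k, hk, by simp [strands_append, ha, ht, hb], fun u v h1 h2 h3 => ?_⟩
  have e : ∀ x : List Piece, u ++ (a ++ x ++ b) ++ v = (u ++ a) ++ x ++ (b ++ v) := by simp
  have := h (u ++ a) (b ++ v) (by rw [← e]; exact h1) (by rw [← e]; exact h2)
    (by simp [strands_append, h3, ha])
  convert this using 2 <;> exact e _

lemma append_left (h : WordEquiv link m s t) (ha : strands a n = some m) :
    WordEquiv link n (a ++ s) (a ++ t) := by
  obtain ⟨l, hs, -, -⟩ := id h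
  simpa using h.context (b := []) ha (by simp [strands_append, ha, hs])

lemma append_right (h : WordEquiv link n s t) (hd : (strands (s ++ b) n).isSome) :
    WordEquiv link n (s ++ b) (t ++ b) := by
  simpa using h.context (a := []) rfl (by simpa using hd)

/-- Equivalence of words without strands at the top and at the bottom. -/
lemma diagramEquiv {D D' : Diagram} (h : WordEquiv link 0 D.word D'.word) :
    DiagramEquiv link D D' := by
  obtain ⟨m, -, -, h⟩ := h
  simpa using h [] [] (by simpa using D.closed) (by simpa using D'.closed) rfl

end WordEquiv

/-! ### Symbolic words and scripts -/

/-- Events of symbolic words: crossings and marked vertices with a boolean variable, and nodes of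
unknown type. The flag says that the variable is negated, or that the node is turned. -/
inductive SymEvent
  | mx
  | mn
  | cr (v : ℕ) (f : Bool)
  | vt (v : ℕ) (f : Bool)
  | nd (v : ℕ) (f : Bool)
  deriving DecidableEq

namespace SymEvent

def inputs : SymEvent → ℕ
  | mx => 0
  | _ => 2

def outputs : SymEvent → ℕ
  | mn => 0
  | _ => 2

def isNode : SymEvent → Bool
  | mx => false
  | mn => false
  | _ => true

def isCr : SymEvent → Bool
  | cr _ _ => true
  | _ => false

def flip : SymEvent → SymEvent
  | cr v f => cr v (!f)
  | vt v f => vt v (!f)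
  | nd v f => nd v (!f)
  | e => e

/-- The event for given values of the variables; a node is a marked vertex if the first component
of its value is `true`, and a crossing otherwise. -/
def eval (β : ℕ → Bool) (ν : ℕ → Bool × Bool) : SymEvent → Event
  | mx => .localMax
  | mn => .localMin
  | cr v f => .crossing (β v ^^ f)
  | vt v f => .marked (β v ^^ f)
  | nd v f => if (ν v).1 then .marked ((ν v).2 ^^ f) else .crossing ((ν v).2 ^^ f)

lemma inputs_eval (β ν) (e : SymEvent) : (e.eval β ν).inputs = e.inputs := by
  cases e with
  | nd v f => rcases h : (ν v).1 <;> simp [eval, inputs, Event.inputs, h]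
  | _ => rfl

lemma outputs_eval (β ν) (e : SymEvent) : (e.eval β ν).outputs = e.outputs := by
  cases e with
  | nd v f => rcases h : (ν v).1 <;> simp [eval, outputs, Event.outputs, h]
  | _ => rfl

end SymEvent

/-- A symbolic event with its position. -/
structure SymPiece where
  pos : ℕ
  event : SymEvent
  deriving DecidableEq

/-- The number of strands below a symbolic word. -/
def symStrands : List SymPiece → ℕ → Option ℕ
  | [], n => some n
  | p :: w, n =>
    if p.pos + p.event.inputs ≤ n then symStrands w (n - p.event.inputs + p.event.outputs)
    else none

/-- The word for given values of the variables, with `i` more strands on the left. -/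
def evalWord (i : ℕ) (β : ℕ → Bool) (ν : ℕ → Bool × Bool) (w : List SymPiece) : List Piece :=
  w.map fun p => ⟨i + p.pos, p.event.eval β ν⟩

lemma evalWord_append (i β ν) (w w' : List SymPiece) :
    evalWord i β ν (w ++ w') = evalWord i β ν w ++ evalWord i β ν w' := by
  simp [evalWord]

/-- The `i` strands on the left and the `r` strands on the right pass by untouched, so one run of a
script serves for every place in a diagram. -/
lemma strands_evalWord (i β ν) (w : List SymPiece) (n m r : ℕ) (h : symStrands w n = some m) :
    strands (evalWord i β ν w) (i + n + r) = some (i + m + r) := by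
  induction w generalizing n with
  | nil => simp_all [symStrands, evalWord, strands]
  | cons p w ih =>
    simp only [symStrands] at h
    split at h
    · rename_i h1
      have := ih _ h
      simp only [evalWord, List.map_cons, strands, Piece.strands, SymEvent.inputs_eval,
        SymEvent.outputs_eval] at this ⊢
      rw [if_pos (by omega), Option.bind_some, ← this]
      congr 1
      omega
    · simp at h

lemma symStrands_append (u v : List SymPiece) (n : ℕ) :
    symStrands (u ++ v) n = (symStrands u n).bind (symStrands v) := by
  induction u generalizing n with
  | nil => rfl
  | cons p u ih =>
    simp only [List.cons_append, symStrands]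
    split <;> simp [ih]

/-- The steps of a script. Steps which are given by the first pieces of the word carry no data. -/
inductive Rule
  | swapR
  | swapL
  | zig
  | zigIns (i : ℕ) (d : Bool)
  | turn
  | r1
  | r1Ins (v : ℕ) (f : Bool)
  | r2
  | r2Ins (i v : ℕ) (f : Bool)
  | slide
  | comm
  | g7

open SymEvent in
/-- Apply a step to the beginning of a word: the number of pieces which are replaced, and the new
pieces. -/
def Rule.apply (link : Bool) : Rule → List SymPiece → Option (ℕ × List SymPiece)
  | .swapR, ⟨i, p⟩ :: ⟨j, q⟩ :: _ =>
    if i + p.outputs ≤ j then some (2, [⟨j - p.outputs + p.inputs, q⟩, ⟨i, p⟩]) else none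
  | .swapL, ⟨i, p⟩ :: ⟨j, q⟩ :: _ =>
    if j + q.inputs ≤ i then some (2, [⟨j, q⟩, ⟨i - q.inputs + q.outputs, p⟩]) else none
  | .zig, ⟨i, p⟩ :: ⟨j, q⟩ :: _ =>
    if p = mx ∧ q = mn ∧ (j = i + 1 ∨ i = j + 1) then some (2, []) else none
  | .zigIns i d, _ => some (0, if d then [⟨i, mx⟩, ⟨i + 1, mn⟩] else [⟨i + 1, mx⟩, ⟨i, mn⟩])
  | .turn, ⟨i, p⟩ :: ⟨j, q⟩ :: _ =>
    if j = i + 1 ∨ i = j + 1 then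
      if p = mx ∧ q.isNode then some (2, [⟨j, mx⟩, ⟨i, q.flip⟩])
      else if p.isNode ∧ q = mn then some (2, [⟨j, p.flip⟩, ⟨i, mn⟩])
      else none
    else none
  | .r1, ⟨i, p⟩ :: ⟨j, q⟩ :: _ =>
    if p = mx ∧ i = j ∧ q.isNode ∧ (link → q.isCr) then some (2, [⟨i, mx⟩]) else none
  | .r1Ins v f, ⟨i, p⟩ :: _ => if p = mx then some (1, [⟨i, mx⟩, ⟨i, cr v f⟩]) else none
  | .r2, ⟨i, p⟩ :: ⟨j, q⟩ :: _ =>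
    if i = j ∧ p.isCr ∧ q = p.flip then some (2, []) else none
  | .r2Ins i v f, _ => some (0, [⟨i, cr v f⟩, ⟨i, cr v (!f)⟩])
  | .slide, ⟨i, p⟩ :: ⟨j, q⟩ :: ⟨k, r⟩ :: _ =>
    if k = i ∧ (j = i + 1 ∨ i = j + 1) ∧ q.isCr ∧
        ((p.isCr ∧ r.isCr ∧ (p = q ∨ q = r ∨ p = r.flip)) ∨
          (link = false ∧ ((p = q ∧ r.isNode) ∨ (q = r ∧ p.isNode)))) then
      some (3, [⟨j, r⟩, ⟨i, q⟩, ⟨j, p⟩])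
    else none
  | .comm, ⟨i, p⟩ :: ⟨j, q⟩ :: _ =>
    if i = j ∧ link = false ∧ ((p.isCr ∧ q.isNode) ∨ (p.isNode ∧ q.isCr)) then
      some (2, [⟨i, q⟩, ⟨i, p⟩])
    else none
  | .g7, ⟨i, vt v f⟩ :: ⟨j, q⟩ :: _ =>
    if (j = i + 1 ∨ i = j + 1) ∧ link = false ∧ q = vt v (!f) then
      some (2, [⟨j, q⟩, ⟨i, vt v f⟩])
    else none
  | _, _ => none

/-- Apply a step after the first `k` pieces of a word. -/
def Rule.applyAt (link : Bool) (n : ℕ) (w : List SymPiece) (k : ℕ) (r : Rule) :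
    Option (List SymPiece) :=
  match r.apply link (w.drop k) with
  | none => none
  | some (l, t) =>
    match symStrands (w.take k) n with
    | none => none
    | some n₁ =>
      match symStrands ((w.drop k).take l) n₁ with
      | none => none
      | some n₂ =>
        if symStrands t n₁ = some n₂ then some (w.take k ++ t ++ (w.drop k).drop l) else none

/-- Apply the steps of a script one after another. -/
def runScript (link : Bool) (n : ℕ) : List (ℕ × Rule) → List SymPiece → Option (List SymPiece)
  | [], w => some w
  | (k, r) :: l, w => (r.applyAt link n w k).bind (runScript link n l)

/-- The two scripts lead from the two words to a common word. -/
def Connects (link : Bool) (n : ℕ) (s t : List SymPiece) (l l' : List (ℕ × Rule)) : Bool :=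
  (symStrands s n).isSome && (symStrands t n).isSome &&
    match runScript link n l s, runScript link n l' t with
    | some w, some w' => w = w'
    | _, _ => false

end MarkedGraph

/-! ### Soundness of scripts -/

namespace MarkedGraph

lemma strands_node_cons {i n : ℕ} {e : Event} (hi : e.inputs = 2) (ho : e.outputs = 2)
    (h : i + 2 ≤ n) (w : List Piece) : strands (⟨i, e⟩ :: w) n = strands w n := by
  have : n - 2 + 2 = n := by omega
  simp [strands, Piece.strands, hi, ho, h, this]

lemma strands_node_cons_isSome {i n : ℕ} {e : Event} (hi : e.inputs = 2) (w : List Piece)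
    (h : (strands (⟨i, e⟩ :: w) n).isSome) : i + 2 ≤ n := by
  by_contra h'
  simp [strands, Piece.strands, hi, h'] at h

lemma Move.swap {link : Bool} {i j : ℕ} (p q : Event) (h : i + p.outputs ≤ j) :
    Move link [⟨i, p⟩, ⟨j, q⟩] [⟨j - p.outputs + p.inputs, q⟩, ⟨i, p⟩] := by
  obtain ⟨k, rfl⟩ := Nat.exists_eq_add_of_le h
  refine Or.inl (Or.inl ?_)
  convert PlanarMove.interchange i k p q using 3
  omega

namespace WordEquiv

variable {link : Bool} {n m i j : ℕ}

lemma gamma2 (b : Bool) (h : i + 2 ≤ n) : WordEquiv link n [cross i b, cross i (!b)] [] :=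
  of_move (m := n) (Or.inl (Or.inr (.gamma2 i b)))
    (by rw [strands_node_cons rfl rfl h, strands_node_cons rfl rfl h]; rfl) rfl

lemma gamma2' (b : Bool) (h : i + 2 ≤ n) : WordEquiv link n [cross i (!b), cross i b] [] := by
  simpa using gamma2 (link := link) (!b) h

lemma cross_comm_cross (b c : Bool) (h : i + 2 ≤ n) :
    WordEquiv link n [cross i b, cross i c] [cross i c, cross i b] := by
  rcases eq_or_ne c b with rfl | hc
  · exact refl (m := n) (by
      rw [strands_node_cons rfl rfl h, strands_node_cons rfl rfl h]; rfl)
  · obtain rfl : c = !b := by cases b <;> cases c <;> simp_all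
    exact (gamma2 b h).trans (gamma2' b h).symm

/-- The hypothesis on the signs is the height condition of `Γ₃` in a form symmetric under exchanging
`a` and `c`; therefore the case `i = j + 1` is the same move read backwards. -/
lemma slide_cross {a b c : Bool} (hij : j = i + 1 ∨ i = j + 1) (h : a = b ∨ b = c ∨ a = !c)
    (hs : strands [cross i a, cross j b, cross i c] n = some m)
    (ht : strands [cross j c, cross i b, cross j a] n = some m) :
    WordEquiv link n [cross i a, cross j b, cross i c] [cross j c, cross i b, cross j a] := by
  rcases hij with rfl | rfl
  · exact of_move (Or.inl (Or.inr (.gamma3 i a b c (by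
      cases a <;> cases b <;> cases c <;> simp_all)))) hs ht
  · exact (of_move (Or.inl (Or.inr (.gamma3 j c b a (by
      cases a <;> cases b <;> cases c <;> simp_all)))) ht hs).symm

lemma gamma4 (b c : Bool) (h : i + 3 ≤ n) :
    WordEquiv false n [cross i b, cross (i + 1) b, vert i c]
      [vert (i + 1) c, cross i b, cross (i + 1) b] := by
  have h1 : i + 2 ≤ n := by omega
  have h2 : i + 1 + 2 ≤ n := by omega
  refine of_move (m := n) (Or.inr ⟨rfl, .gamma4 i b c⟩) ?_ ?_ <;>
  · repeat first | rw [strands_node_cons rfl rfl h1] | rw [strands_node_cons rfl rfl h2]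
    rfl

/-- The other direction of passing a strand across a vertex is the conjugate of `Γ₄`: the strand is
cancelled on both sides by a strand with opposite crossings, created and removed by `Γ₂`. -/
lemma gamma4' (b c : Bool) (h : i + 3 ≤ n) :
    WordEquiv false n [vert i c, cross (i + 1) b, cross i b]
      [cross (i + 1) b, cross i b, vert (i + 1) c] := by
  have h1 : i + 2 ≤ n := by omega
  have h2 : i + 1 + 2 ≤ n := by omega
  have key : ∀ w : List Piece, (∀ p ∈ w, (p.pos = i ∨ p.pos = i + 1) ∧ p.event.inputs = 2 ∧
      p.event.outputs = 2) → strands w n = some n := by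
    intro w hw
    induction w with
    | nil => rfl
    | cons p w ih =>
      obtain ⟨⟨hp, hp1, hp2⟩, hw⟩ := List.forall_mem_cons.1 hw
      rw [strands_node_cons hp1 hp2 (by omega)]
      exact ih hw
  have e : ∀ w : List Piece, (∀ p ∈ w, (p.pos = i ∨ p.pos = i + 1) ∧ p.event.inputs = 2 ∧
      p.event.outputs = 2) → (strands w n).isSome := fun w hw => by rw [key w hw]; rfl
  -- The words in `a1` and `a2` are nested pairs of opposite crossings; the inner pair cancels
  -- first, then the outer one.
  have a1 : WordEquiv false n [] [cross i (!b), cross (i + 1) (!b), cross (i + 1) b, cross i b] :=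
    (((gamma2' b h2).context (a := [cross i (!b)]) (b := [cross i b]) (key _ (by simp [Event.inputs, Event.outputs]))
      (e _ (by simp [Event.inputs, Event.outputs]))).trans (gamma2' b h1)).symm
  have a2 : WordEquiv false n [cross (i + 1) b, cross i b, cross i (!b), cross (i + 1) (!b)] [] :=
    ((gamma2 b h1).context (a := [cross (i + 1) b]) (b := [cross (i + 1) (!b)])
      (key _ (by simp [Event.inputs, Event.outputs]))
      (e _ (by simp [Event.inputs, Event.outputs]))).trans (gamma2 b h2)
  have b1 := a1.append_left (a := [cross (i + 1) b, cross i b, vert (i + 1) c])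
    (key _ (by simp [Event.inputs, Event.outputs]))
  have b2 := (gamma4 (!b) c h).symm.context (a := [cross (i + 1) b, cross i b])
    (b := [cross (i + 1) b, cross i b]) (key _ (by simp [Event.inputs, Event.outputs]))
    (e _ (by simp [Event.inputs, Event.outputs]))
  have b3 := a2.append_right (b := [vert i c, cross (i + 1) b, cross i b])
    (e _ (by simp [Event.inputs, Event.outputs]))
  exact ((b1.trans b2).trans b3).symm

/-- Strand counts come from the left word alone: its first two pieces already force three strands at
the place in question. -/
lemma slide_vert {b c : Bool} (hij : j = i + 1 ∨ i = j + 1)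
    (h : (strands [cross i b, cross j b, vert i c] n).isSome) :
    WordEquiv false n [cross i b, cross j b, vert i c] [vert j c, cross i b, cross j b] := by
  have h1 := strands_node_cons_isSome rfl _ h
  rw [strands_node_cons rfl rfl h1] at h
  have h2 := strands_node_cons_isSome rfl _ h
  rcases hij with rfl | rfl
  · exact gamma4 b c (by omega)
  · exact (gamma4' b c (by omega)).symm

end WordEquiv

namespace SymEvent

variable {e : SymEvent} (β : ℕ → Bool) (ν : ℕ → Bool × Bool)

lemma eval_of_isCr (h : e.isCr) :
    ∃ b, e.eval β ν = .crossing b ∧ e.flip.eval β ν = .crossing (!b) := by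
  cases e with
  | cr v f => exact ⟨_, rfl, by simp [flip, eval]⟩
  | _ => simp [isCr] at h

lemma eval_of_isNode (h : e.isNode) :
    (∃ b, e.eval β ν = .crossing b ∧ e.flip.eval β ν = .crossing (!b)) ∨
      (∃ b, e.eval β ν = .marked b ∧ e.flip.eval β ν = .marked (!b)) := by
  cases e with
  | cr v f => exact Or.inl (eval_of_isCr β ν rfl)
  | vt v f => exact Or.inr ⟨_, rfl, by simp [flip, eval]⟩
  | nd v f =>
    rcases hv : (ν v).1
    · exact Or.inl ⟨_, by simp [eval, hv]; rfl, by simp [flip, eval, hv]⟩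
    · exact Or.inr ⟨_, by simp [eval, hv]; rfl, by simp [flip, eval, hv]⟩
  | _ => simp [isNode] at h

end SymEvent

-- Each rule is a single move or its inverse once the variables have values. A node of unknown type
-- is split into the cases crossing and marked vertex, so a rule for nodes stands for a Reidemeister
-- move and a Yoshikawa move at once, for instance `Γ₁` and `Γ₆`.
open SymEvent in
lemma Rule.apply_sound {link : Bool} {r : Rule} {w t : List SymPiece} {l : ℕ}
    (h : r.apply link w = some (l, t)) (i₀ : ℕ) (β : ℕ → Bool) (ν : ℕ → Bool × Bool) {n m : ℕ}
    (hs : strands (evalWord i₀ β ν (w.take l)) n = some m)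
    (ht : strands (evalWord i₀ β ν t) n = some m) :
    WordEquiv link n (evalWord i₀ β ν (w.take l)) (evalWord i₀ β ν t) := by
  cases r with
  | zigIns i d =>
    simp only [Rule.apply, Option.some.injEq, Prod.mk.injEq] at h
    obtain ⟨rfl, rfl⟩ := h
    cases d
    · exact (WordEquiv.of_move (Or.inl (Or.inl (.zigzag' (i₀ + i)))) ht hs).symm
    · exact (WordEquiv.of_move (Or.inl (Or.inl (.zigzag (i₀ + i)))) ht hs).symm
  | r2Ins i v f =>
    simp only [Rule.apply, Option.some.injEq, Prod.mk.injEq] at h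
    obtain ⟨rfl, rfl⟩ := h
    refine (WordEquiv.of_move (Or.inl (Or.inr ?_)) ht hs).symm
    simpa [evalWord, eval] using ReidemeisterMove.gamma2 (i₀ + i) (β v ^^ f)
  | r1Ins v f =>
    rcases w with _ | ⟨⟨i, p⟩, w⟩
    · simp [Rule.apply] at h
    simp only [Rule.apply] at h
    split_ifs at h with h1
    simp only [Option.some.injEq, Prod.mk.injEq] at h
    obtain ⟨rfl, rfl⟩ := h
    subst h1
    exact (WordEquiv.of_move (Or.inl (Or.inr (.gamma1 (i₀ + i) (β v ^^ f)))) ht hs).symm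
  | slide =>
    rcases w with _ | ⟨⟨i, p⟩, _ | ⟨⟨j, q⟩, _ | ⟨⟨k, r⟩, w⟩⟩⟩
    any_goals simp [Rule.apply] at h; done
    simp only [Rule.apply] at h
    split_ifs at h with h1
    simp only [Option.some.injEq, Prod.mk.injEq] at h
    obtain ⟨rfl, rfl⟩ := h
    obtain ⟨rfl, hij, hq, h1⟩ := h1
    have hij' : i₀ + j = i₀ + k + 1 ∨ i₀ + k = i₀ + j + 1 := by omega
    obtain ⟨b, hb, hb'⟩ := eval_of_isCr β ν hq
    simp only [evalWord, List.take, List.map_cons, List.map_nil, hb] at hs ht ⊢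
    have main : ∀ a c, p.eval β ν = .crossing a → r.eval β ν = .crossing c →
        (a = b ∨ b = c ∨ a = !c) → WordEquiv link n
          [⟨i₀ + k, p.eval β ν⟩, ⟨i₀ + j, .crossing b⟩, ⟨i₀ + k, r.eval β ν⟩]
          [⟨i₀ + j, r.eval β ν⟩, ⟨i₀ + k, .crossing b⟩, ⟨i₀ + j, p.eval β ν⟩] := by
      intro a c ha hc h3
      rw [ha, hc] at hs ht ⊢
      exact WordEquiv.slide_cross hij' h3 hs ht
    rcases h1 with ⟨hp, hr, h1⟩ | ⟨rfl, ⟨rfl, hr⟩ | ⟨rfl, hp⟩⟩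
    · obtain ⟨a, ha, ha'⟩ := eval_of_isCr β ν hp
      obtain ⟨c, hc, hc'⟩ := eval_of_isCr β ν hr
      refine main a c ha hc ?_
      rcases h1 with rfl | rfl | rfl
      · rw [ha] at hb; simp_all
      · rw [hc] at hb; simp_all
      · rw [hc'] at ha; simp_all
    · rcases eval_of_isNode β ν hr with ⟨c, hc, -⟩ | ⟨c, hc, -⟩
      · exact main b c hb hc (Or.inl rfl)
      · rw [hc, hb] at hs ⊢
        exact WordEquiv.slide_vert hij' (by rw [hs]; rfl)
    · rcases eval_of_isNode β ν hp with ⟨c, hc, -⟩ | ⟨c, hc, -⟩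
      · exact main c b hc hb (Or.inr (Or.inl rfl))
      · rw [hc, hb] at ht ⊢
        exact (WordEquiv.slide_vert hij'.symm (by rw [ht]; rfl)).symm
  | swapR =>
    rcases w with _ | ⟨⟨i, p⟩, _ | ⟨⟨j, q⟩, w⟩⟩
    any_goals simp [Rule.apply] at h; done
    simp only [Rule.apply] at h
    split_ifs at h with h1
    simp only [Option.some.injEq, Prod.mk.injEq] at h
    obtain ⟨rfl, rfl⟩ := h
    have e := Move.swap (link := link) (i := i₀ + i) (j := i₀ + j) (p.eval β ν) (q.eval β ν)
      (by rw [outputs_eval]; omega)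
    rw [inputs_eval, outputs_eval, show i₀ + j - p.outputs + p.inputs =
      i₀ + (j - p.outputs + p.inputs) by omega] at e
    exact WordEquiv.of_move e hs ht
  | swapL =>
    rcases w with _ | ⟨⟨i, p⟩, _ | ⟨⟨j, q⟩, w⟩⟩
    any_goals simp [Rule.apply] at h; done
    simp only [Rule.apply] at h
    split_ifs at h with h1
    simp only [Option.some.injEq, Prod.mk.injEq] at h
    obtain ⟨rfl, rfl⟩ := h
    have e := Move.swap (link := link) (i := i₀ + j) (j := i₀ + (i - q.inputs + q.outputs))
      (q.eval β ν) (p.eval β ν) (by rw [outputs_eval]; omega)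
    rw [inputs_eval, outputs_eval, show i₀ + (i - q.inputs + q.outputs) - q.outputs + q.inputs =
      i₀ + i by omega] at e
    exact (WordEquiv.of_move e ht hs).symm
  | zig =>
    rcases w with _ | ⟨⟨i, p⟩, _ | ⟨⟨j, q⟩, w⟩⟩
    any_goals simp [Rule.apply] at h; done
    simp only [Rule.apply] at h
    split_ifs at h with h1
    simp only [Option.some.injEq, Prod.mk.injEq] at h
    obtain ⟨rfl, rfl⟩ := h
    obtain ⟨rfl, rfl, rfl | rfl⟩ := h1
    · exact WordEquiv.of_move (Or.inl (Or.inl (.zigzag (i₀ + i)))) hs ht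
    · exact WordEquiv.of_move (Or.inl (Or.inl (.zigzag' (i₀ + j)))) hs ht
  | turn =>
    rcases w with _ | ⟨⟨i, p⟩, _ | ⟨⟨j, q⟩, w⟩⟩
    any_goals simp [Rule.apply] at h; done
    simp only [Rule.apply] at h
    split_ifs at h with h1 h2 h2
    · simp only [Option.some.injEq, Prod.mk.injEq] at h
      obtain ⟨rfl, rfl⟩ := h
      obtain ⟨rfl, hq⟩ := h2
      simp only [evalWord, List.take, List.map_cons, List.map_nil] at hs ht ⊢
      rcases eval_of_isNode β ν hq with ⟨b, hb, hb'⟩ | ⟨b, hb, hb'⟩ <;>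
        rw [hb] at hs ⊢ <;> rw [hb'] at ht ⊢ <;> rcases h1 with rfl | rfl
      · exact WordEquiv.of_move (Or.inl (Or.inl (.turnCrossMax (i₀ + i) b))) hs ht
      · refine (WordEquiv.of_move (Or.inl (Or.inl ?_)) ht hs).symm
        have := PlanarMove.turnCrossMax (i₀ + j) (!b)
        rwa [Bool.not_not] at this
      · exact WordEquiv.of_move (Or.inl (Or.inl (.turnVertMax (i₀ + i) b))) hs ht
      · refine (WordEquiv.of_move (Or.inl (Or.inl ?_)) ht hs).symm
        have := PlanarMove.turnVertMax (i₀ + j) (!b)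
        rwa [Bool.not_not] at this
    · simp only [Option.some.injEq, Prod.mk.injEq] at h
      obtain ⟨rfl, rfl⟩ := h
      obtain ⟨hp, rfl⟩ := h2
      simp only [evalWord, List.take, List.map_cons, List.map_nil] at hs ht ⊢
      rcases eval_of_isNode β ν hp with ⟨b, hb, hb'⟩ | ⟨b, hb, hb'⟩ <;>
        rw [hb] at hs ⊢ <;> rw [hb'] at ht ⊢ <;> rcases h1 with rfl | rfl
      · refine (WordEquiv.of_move (Or.inl (Or.inl ?_)) ht hs).symm
        have := PlanarMove.turnCrossMin (i₀ + i) (!b)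
        rwa [Bool.not_not] at this
      · exact WordEquiv.of_move (Or.inl (Or.inl (.turnCrossMin (i₀ + j) b))) hs ht
      · refine (WordEquiv.of_move (Or.inl (Or.inl ?_)) ht hs).symm
        have := PlanarMove.turnVertMin (i₀ + i) (!b)
        rwa [Bool.not_not] at this
      · exact WordEquiv.of_move (Or.inl (Or.inl (.turnVertMin (i₀ + j) b))) hs ht
  | r1 =>
    rcases w with _ | ⟨⟨i, p⟩, _ | ⟨⟨j, q⟩, w⟩⟩
    any_goals simp [Rule.apply] at h; done
    simp only [Rule.apply] at h
    split_ifs at h with h1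
    simp only [Option.some.injEq, Prod.mk.injEq] at h
    obtain ⟨rfl, rfl⟩ := h
    obtain ⟨rfl, rfl, hq, h1⟩ := h1
    simp only [evalWord, List.take, List.map_cons, List.map_nil] at hs ht ⊢
    cases link with
    | true =>
      obtain ⟨b, hb, -⟩ := eval_of_isCr β ν (h1 rfl)
      rw [hb] at hs ⊢
      exact WordEquiv.of_move (Or.inl (Or.inr (.gamma1 (i₀ + i) b))) hs ht
    | false =>
      rcases eval_of_isNode β ν hq with ⟨b, hb, -⟩ | ⟨b, hb, -⟩ <;> rw [hb] at hs ⊢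
      · exact WordEquiv.of_move (Or.inl (Or.inr (.gamma1 (i₀ + i) b))) hs ht
      · exact WordEquiv.of_move (Or.inr ⟨rfl, .gamma6 (i₀ + i) b⟩) hs ht
  | r2 =>
    rcases w with _ | ⟨⟨i, p⟩, _ | ⟨⟨j, q⟩, w⟩⟩
    any_goals simp [Rule.apply] at h; done
    simp only [Rule.apply] at h
    split_ifs at h with h1
    simp only [Option.some.injEq, Prod.mk.injEq] at h
    obtain ⟨rfl, rfl⟩ := h
    obtain ⟨rfl, hp, rfl⟩ := h1
    simp only [evalWord, List.take, List.map_cons, List.map_nil] at hs ht ⊢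
    obtain ⟨b, hb, hb'⟩ := eval_of_isCr β ν hp
    rw [hb, hb'] at hs ⊢
    exact WordEquiv.of_move (Or.inl (Or.inr (.gamma2 (i₀ + i) b))) hs ht
  | comm =>
    rcases w with _ | ⟨⟨i, p⟩, _ | ⟨⟨j, q⟩, w⟩⟩
    any_goals simp [Rule.apply] at h; done
    simp only [Rule.apply] at h
    split_ifs at h with h1
    simp only [Option.some.injEq, Prod.mk.injEq] at h
    obtain ⟨rfl, rfl⟩ := h
    obtain ⟨rfl, rfl, h1⟩ := h1
    simp only [evalWord, List.take, List.map_cons, List.map_nil] at hs ht ⊢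
    have h2 : i₀ + i + 2 ≤ n := by
      have := strands_node_cons_isSome (i := i₀ + i) (e := p.eval β ν)
        (by rcases h1 with ⟨h1, -⟩ | ⟨h1, -⟩ <;> cases p <;>
          simp_all [isCr, isNode, inputs_eval, inputs]) _ (by rw [hs]; rfl)
      exact this
    rcases h1 with ⟨hp, hq⟩ | ⟨hp, hq⟩
    · obtain ⟨b, hb, -⟩ := eval_of_isCr β ν hp
      rw [hb] at hs ht ⊢
      rcases eval_of_isNode β ν hq with ⟨c, hc, -⟩ | ⟨c, hc, -⟩ <;> rw [hc] at hs ht ⊢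
      · exact WordEquiv.cross_comm_cross b c h2
      · exact WordEquiv.of_move (Or.inr ⟨rfl, .gamma5 _ b c⟩) hs ht
    · obtain ⟨b, hb, -⟩ := eval_of_isCr β ν hq
      rw [hb] at hs ht ⊢
      rcases eval_of_isNode β ν hp with ⟨c, hc, -⟩ | ⟨c, hc, -⟩ <;> rw [hc] at hs ht ⊢
      · exact WordEquiv.cross_comm_cross c b h2
      · exact (WordEquiv.of_move (Or.inr ⟨rfl, .gamma5 _ b c⟩) ht hs).symm
  | g7 =>
    rcases w with _ | ⟨⟨i, p⟩, _ | ⟨⟨j, q⟩, w⟩⟩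
    any_goals first | (simp [Rule.apply] at h; done) | (cases p <;> simp [Rule.apply] at h; done)
    cases p with
    | vt v f =>
      simp only [Rule.apply] at h
      split_ifs at h with h1
      simp only [Option.some.injEq, Prod.mk.injEq] at h
      obtain ⟨rfl, rfl⟩ := h
      obtain ⟨hij, rfl, rfl⟩ := h1
      have e : (β v ^^ !f) = !(β v ^^ f) := by simp
      simp only [evalWord, List.take, List.map_cons, List.map_nil, eval, e] at hs ht ⊢
      rcases hij with rfl | rfl
      · exact WordEquiv.of_move (Or.inr ⟨rfl, .gamma7 _ _⟩) hs ht
      · refine (WordEquiv.of_move (Or.inr ⟨rfl, ?_⟩) ht hs).symm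
        have := MarkedVertexMove.gamma7 (i₀ + j) (!(β v ^^ f))
        rwa [Bool.not_not] at this
    | _ => simp [Rule.apply] at h

/-- `Rule.applyAt` has itself compared the strand counts of the old and the new pieces, so no side
condition on positions is left to prove. -/
lemma Rule.applyAt_sound {link : Bool} {r : Rule} {w w' : List SymPiece} {k n : ℕ}
    (h : r.applyAt link n w k = some w') (hw : (symStrands w n).isSome) (i j : ℕ) (β : ℕ → Bool)
    (ν : ℕ → Bool × Bool) :
    symStrands w' n = symStrands w n ∧
      WordEquiv link (i + n + j) (evalWord i β ν w) (evalWord i β ν w') := by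
  unfold Rule.applyAt at h
  rcases h1 : r.apply link (w.drop k) with _ | ⟨l, t⟩
  · simp [h1] at h
  rcases h2 : symStrands (w.take k) n with _ | n₁
  · simp [h1, h2] at h
  rcases h3 : symStrands ((w.drop k).take l) n₁ with _ | n₂
  · simp [h1, h2, h3] at h
  simp only [h1, h2, h3] at h
  split_ifs at h with h4
  simp only [Option.some.injEq] at h
  subst h
  have ew : w = w.take k ++ (w.drop k).take l ++ (w.drop k).drop l := by
    rw [List.append_assoc, List.take_append_drop, List.take_append_drop]
  obtain ⟨m, hm⟩ := Option.isSome_iff_exists.1 hw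
  have h5 : symStrands ((w.drop k).drop l) n₂ = some m := by
    rw [ew, symStrands_append, symStrands_append, h2, Option.bind_some, h3, Option.bind_some] at hm
    exact hm
  refine ⟨by rw [symStrands_append, symStrands_append, h2, Option.bind_some, h4,
    Option.bind_some, h5, hm], ?_⟩
  have key := Rule.apply_sound h1 i β ν (strands_evalWord i β ν _ n₁ n₂ j h3)
    (strands_evalWord i β ν _ n₁ n₂ j h4)
  have := key.context (b := evalWord i β ν ((w.drop k).drop l))
    (strands_evalWord i β ν _ n n₁ j h2) (by
      rw [← evalWord_append, ← evalWord_append, ← ew, strands_evalWord i β ν _ n m j hm]; rfl)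
  simp only [← evalWord_append, ← ew] at this
  exact this

lemma runScript_sound {link : Bool} {n : ℕ} {l : List (ℕ × Rule)} {w w' : List SymPiece}
    (h : runScript link n l w = some w') (hw : (symStrands w n).isSome) (i j : ℕ) (β : ℕ → Bool)
    (ν : ℕ → Bool × Bool) : WordEquiv link (i + n + j) (evalWord i β ν w) (evalWord i β ν w') := by
  induction l generalizing w with
  | nil =>
    obtain rfl : w = w' := by simpa [runScript] using h
    obtain ⟨m, hm⟩ := Option.isSome_iff_exists.1 hw
    exact WordEquiv.refl (strands_evalWord i β ν _ n m j hm)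
  | cons r l ih =>
    obtain ⟨k, r⟩ := r
    obtain ⟨w₁, h1, h2⟩ := Option.bind_eq_some_iff.1 h
    obtain ⟨h3, h4⟩ := Rule.applyAt_sound h1 hw i j β ν
    exact h4.trans (ih h2 (h3 ▸ hw))

/-- The reflection principle behind all explicit isotopies: a Boolean computation on symbolic words
yields an equivalence for every value of the variables and any number of further strands on both
sides. -/
lemma Connects.wordEquiv {link : Bool} {n : ℕ} {s t : List SymPiece} {l l' : List (ℕ × Rule)}
    (h : Connects link n s t l l' = true) (i j : ℕ) (β : ℕ → Bool) (ν : ℕ → Bool × Bool) :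
    WordEquiv link (i + n + j) (evalWord i β ν s) (evalWord i β ν t) := by
  unfold Connects at h
  simp only [Bool.and_eq_true] at h
  obtain ⟨⟨hs, ht⟩, h⟩ := h
  split at h
  · rename_i w w' h1 h2
    obtain rfl : w = w' := by simpa using h
    exact (runScript_sound h1 hs i j β ν).trans (runScript_sound h2 ht i j β ν).symm
  · simp at h

end MarkedGraph

namespace MarkedGraph

namespace SymPiece

abbrev mx (i : ℕ) : SymPiece := ⟨i, .mx⟩
abbrev mn (i : ℕ) : SymPiece := ⟨i, .mn⟩
abbrev cr (i v : ℕ) (f : Bool) : SymPiece := ⟨i, .cr v f⟩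
abbrev vt (i v : ℕ) (f : Bool) : SymPiece := ⟨i, .vt v f⟩
abbrev nd (i v : ℕ) (f : Bool) : SymPiece := ⟨i, .nd v f⟩

end SymPiece

open SymPiece

/-! ### Twist columns -/

/-- A crossing (first component `false`) or a marked vertex (first component `true`). -/
abbrev Node : Type := Bool × Bool

/-- The event of a node. -/
def Node.event (x : Node) : Event := if x.1 then .marked x.2 else .crossing x.2

/-- The node turned by a quarter of a full turn. -/
def Node.flip (x : Node) : Node := (x.1, !x.2)

lemma Node.inputs_event (x : Node) : x.event.inputs = 2 := by
  rcases x with ⟨_ | _, b⟩ <;> rfl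

lemma Node.outputs_event (x : Node) : x.event.outputs = 2 := by
  rcases x with ⟨_ | _, b⟩ <;> rfl

lemma SymEvent.eval_nd (β ν v f) : SymEvent.eval β ν (.nd v f) =
    Node.event (if f then Node.flip (ν v) else ν v) := by
  rcases h : ν v with ⟨_ | _, _ | _⟩ <;> cases f <;> simp [SymEvent.eval, Node.event, Node.flip, h]

lemma SymEvent.eval_cr (β ν v f) : SymEvent.eval β ν (.cr v f) =
    Node.event (false, if f then !β v else β v) := by
  cases f <;> simp [SymEvent.eval, Node.event]

lemma SymEvent.eval_vt (β ν v f) : SymEvent.eval β ν (.vt v f) =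
    Node.event (true, if f then !β v else β v) := by
  cases f <;> simp [SymEvent.eval, Node.event]

lemma SymEvent.eval_mx (β ν) : SymEvent.eval β ν .mx = .localMax := rfl

lemma SymEvent.eval_mn (β ν) : SymEvent.eval β ν .mn = .localMin := rfl

/-- Nodes below each other at position `i`. -/
def column (i : ℕ) (l : List Node) : List Piece := l.map fun x => ⟨i, x.event⟩

lemma column_append (i : ℕ) (l l' : List Node) : column i (l ++ l') = column i l ++ column i l' :=
  List.map_append

lemma strands_column {i n : ℕ} (h : i + 2 ≤ n) (l : List Node) : strands (column i l) n = some n := by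
  induction l with
  | nil => rfl
  | cons x l ih =>
    rw [column, List.map_cons, strands_node_cons x.inputs_event x.outputs_event h]
    exact ih

/-- Columns of nodes which may be exchanged in every diagram. -/
def ColumnEquiv (l l' : List Node) : Prop :=
  ∀ i n : ℕ, i + 2 ≤ n → WordEquiv false n (column i l) (column i l')

lemma Connects.columnEquiv {s t : List SymPiece} {a b : List (ℕ × Rule)}
    (h : Connects false 2 s t a b = true) (β : ℕ → Bool) (ν : ℕ → Node) {l l' : List Node}
    (hs : ∀ i, evalWord i β ν s = column i l) (ht : ∀ i, evalWord i β ν t = column i l') :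
    ColumnEquiv l l' := by
  intro i n hn
  have := Connects.wordEquiv h i (n - i - 2) β ν
  rwa [hs, ht, show i + 2 + (n - i - 2) = n by omega] at this

namespace ColumnEquiv

variable {l l' r : List Node}

lemma refl (l : List Node) : ColumnEquiv l l := fun _ _ h => WordEquiv.refl (strands_column h l)

lemma symm (h : ColumnEquiv l l') : ColumnEquiv l' l := fun i n hn => (h i n hn).symm

lemma trans (h : ColumnEquiv l l') (h' : ColumnEquiv l' r) : ColumnEquiv l r :=
  fun i n hn => (h i n hn).trans (h' i n hn)

lemma append (h : ColumnEquiv l l') (a b : List Node) : ColumnEquiv (a ++ l ++ b) (a ++ l' ++ b) := by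
  intro i n hn
  simp only [column_append]
  refine (h i n hn).context (strands_column hn a) ?_
  rw [← column_append, ← column_append, strands_column hn]
  rfl

lemma append_right (h : ColumnEquiv l l') (b : List Node) : ColumnEquiv (l ++ b) (l' ++ b) := by
  simpa using h.append [] b

lemma cons (h : ColumnEquiv l l') (x : Node) : ColumnEquiv (x :: l) (x :: l') := by
  simpa using h.append [x] []

lemma cross_comm (b : Bool) (x : Node) : ColumnEquiv [(false, b), x] [x, (false, b)] :=
  Connects.columnEquiv (s := [.cr 0 0 false, .nd 0 0 false]) (t := [.nd 0 0 false, .cr 0 0 false])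
    (a := [(0, .comm)]) (b := []) (by decide) (fun _ => b) (fun _ => x)
    (fun i => by simp [evalWord, column, SymEvent.eval_cr, SymEvent.eval_nd])
    (fun i => by simp [evalWord, column, SymEvent.eval_cr, SymEvent.eval_nd])

lemma cross_cancel (b : Bool) : ColumnEquiv [(false, b), (false, !b)] [] :=
  fun _ _ h => WordEquiv.gamma2 b h

/-- A zigzag turns the first vertex, after which the markers are opposite and `Γ₇` exchanges the two
vertices. The second one now sits at a local maximum, where `Γ₆` removes it. -/
lemma vert_vert (c : Bool) : ColumnEquiv [(true, c), (true, c)] [(true, c)] :=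
  Connects.columnEquiv
    (show Connects false 2 [.vt 0 0 false, .vt 0 0 false] [.vt 0 0 false] [(0,.zigIns 0
      false),(1,.swapR),(0,.turn),(2,.swapR),(1,.g7),(0,.r1)] [(0,.zigIns 0
      false),(1,.swapR),(0,.turn)] = true by decide)
    (fun _ => c) (fun _ => (false, false))
    (fun i => by simp [evalWord, column, SymEvent.eval_vt])
    (fun i => by simp [evalWord, column, SymEvent.eval_vt])

/-- Moving a crossing past a marked vertex of the same column that it does not meet changes the
sign of the crossing. -/
lemma vert_cross_vert (b c : Bool) :
    ColumnEquiv [(true, b), (false, c), (true, !b)] [(true, b), (true, !b), (false, !c)] := by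
  -- Both columns are compared with an auxiliary word that has two vertices and two parallel
  -- crossings. One comparison passes a vertex through the crossings by `Γ₄` and removes a kink; the
  -- other one uses `Γ₇` in addition.
  have h1 : Connects false 2 [.vt 0 0 false, .mx 1, .vt 0 0 false, .cr 2 1 false, .cr 1 1 false, .mn 0]
      [.vt 0 0 false, .cr 0 1 false, .vt 0 0 true]
      [(1,.turn),(2,.slide),(1,.swapR),(2,.turn),(3,.swapR),(4,.zigIns 0
      false),(5,.swapR),(4,.turn),(6,.swapR),(5,.turn),(4,.r1),(4,.zig),(3,.swapL),(2,.zig)] [] = true := by decide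
  have h2 : Connects false 2 [.vt 0 0 false, .mx 1, .vt 0 0 false, .cr 2 1 false, .cr 1 1 false, .mn 0]
      [.vt 0 0 false, .vt 0 0 true, .cr 0 1 true]
      [(1,.turn),(0,.swapL),(1,.g7),(0,.turn),(1,.swapR),(0,.turn),(1,.g7),(0,.swapL),(1,.turn),(1,.turn),(2,.slide),(1,.r1),(1,.turn),(2,.comm),(3,.swapL),(2,.swapL),(1,.zig)]
      [] = true := by decide
  intro i n hn
  have e : ∀ {s t l l'}, Connects false 2 s t l l' = true → WordEquiv false n
      (evalWord i (fun v => if v = 0 then b else c) (fun _ => (false, false)) s)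
      (evalWord i (fun v => if v = 0 then b else c) (fun _ => (false, false)) t) := by
    intro s t l l' h
    have := Connects.wordEquiv h i (n - i - 2) (fun v => if v = 0 then b else c)
      fun _ => (false, false)
    rwa [show i + 2 + (n - i - 2) = n by omega] at this
  have := (e h1).symm.trans (e h2)
  simpa [evalWord, column, SymEvent.eval_cr, SymEvent.eval_vt] using this

/-- The auxiliary word of `vert_cross_vert` is deformed further: `Γ₇` carries the first vertex past
the remaining nodes to the bottom, and the mirrored computation then gives the column with the
vertices exchanged. -/
lemma vert_cross_vert' (b c : Bool) :
    ColumnEquiv [(true, b), (false, c), (true, !b)] [(true, !b), (false, !c), (true, b)] := by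
  have h1 : Connects false 2 [.vt 0 0 false, .mx 1, .vt 0 0 false, .cr 2 1 false, .cr 1 1 false, .mn 0]
      [.vt 0 0 false, .cr 0 1 false, .vt 0 0 true]
      [(1,.turn),(2,.slide),(1,.swapR),(2,.turn),(3,.swapR),(4,.zigIns 0
      false),(5,.swapR),(4,.turn),(6,.swapR),(5,.turn),(4,.r1),(4,.zig),(3,.swapL),(2,.zig)] [] = true := by decide
  have h2 : Connects false 2 [.vt 0 0 false, .mx 1, .vt 0 0 false, .cr 2 1 false, .cr 1 1 false, .mn 0]
      [.mx 1, .vt 0 0 false, .cr 2 1 false, .cr 0 1 true, .vt 2 0 false, .mn 1]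
      [(1,.turn),(0,.swapL),(1,.g7),(0,.turn)] [(3,.swapR),(2,.comm),(4,.turn)] = true := by decide
  have h3 : Connects false 2 [.mx 1, .vt 0 0 false, .cr 2 1 false, .cr 0 1 true, .vt 2 0 false, .mn 1]
      [.mx 1, .cr 2 1 false, .cr 0 1 true, .vt 2 0 false, .mn 1, .vt 0 0 false]
      [(1,.swapR),(2,.comm),(4,.turn)] [(3,.turn),(4,.swapL),(3,.g7)] = true := by decide
  have h4 : Connects false 2 [.mx 1, .cr 2 1 false, .cr 0 1 true, .vt 2 0 false, .mn 1, .vt 0 0 false]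
      [.vt 0 0 true, .cr 0 1 true, .vt 0 0 false]
      [(0,.turn),(3,.turn),(1,.slide),(0,.swapL),(1,.turn),(3,.swapR),(2,.zigIns 2
      false),(3,.swapR),(2,.turn),(4,.swapR),(3,.turn),(2,.r1),(2,.zig),(1,.zig)] [] = true := by decide
  intro i n hn
  have e : ∀ {s t l l'}, Connects false 2 s t l l' = true → WordEquiv false n
      (evalWord i (fun v => if v = 0 then b else c) (fun _ => (false, false)) s)
      (evalWord i (fun v => if v = 0 then b else c) (fun _ => (false, false)) t) := by
    intro s t l l' h
    have := Connects.wordEquiv h i (n - i - 2) (fun v => if v = 0 then b else c) fun _ => (false, false)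
    rwa [show i + 2 + (n - i - 2) = n by omega] at this
  have := (((e h1).symm.trans (e h2)).trans (e h3)).trans (e h4)
  simpa [evalWord, column, SymEvent.eval_cr, SymEvent.eval_vt] using this

/-- An auxiliary pair of cancelling crossings is the catalyst. One crossing is moved between the two
vertices by `vert_cross_vert`, where `vert_cross_vert'` exchanges them; afterwards the pair cancels
again. -/
lemma vert_comm (b : Bool) : ColumnEquiv [(true, b), (true, !b)] [(true, !b), (true, b)] := by
  have h1 := (cross_cancel false).symm.append [(true, b), (true, !b)] []
  have h2 := (vert_cross_vert b true).symm.append_right [(false, true)]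
  have h3 := (vert_cross_vert' b true).append_right [(false, true)]
  have h4 := (cross_comm true (true, b)).symm.append [(true, !b), (false, false)] []
  have h5 := (cross_cancel false).append [(true, !b)] [(true, b)]
  exact (((h1.trans h2).trans h3).trans h4).trans h5

lemma comm (x y : Node) : ColumnEquiv [x, y] [y, x] := by
  obtain ⟨_ | _, b⟩ := x
  · exact cross_comm b y
  obtain ⟨_ | _, c⟩ := y
  · exact (cross_comm c _).symm
  rcases eq_or_ne c b with rfl | h
  · exact refl _
  · obtain rfl : c = !b := by cases b <;> cases c <;> simp_all
    exact vert_comm b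

/-- Any two nodes of a column commute, so a column is determined by its multiset of nodes and all
further arguments are about multisets. -/
lemma of_perm (h : l.Perm l') : ColumnEquiv l l' := by
  induction h with
  | nil => exact refl _
  | cons x _ ih => exact ih.cons x
  | swap x y l => exact (comm y x).append_right l
  | trans _ _ ih ih' => exact ih.trans ih'

end ColumnEquiv

end MarkedGraph

namespace MarkedGraph

open SymPiece

/-! ### Irreducible columns -/

/-- The columns of three nodes which are not equivalent to a shorter column. -/
def irreducibleColumns : List (List Node) :=
  [[(false, false), (false, false), (false, false)], [(false, true), (false, true), (false, true)],
    [(false, false), (false, false), (true, false)], [(false, false), (false, false), (true, true)],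
    [(false, true), (false, true), (true, false)], [(false, true), (false, true), (true, true)],
    [(false, false), (true, false), (true, true)]]

namespace ColumnEquiv

/-- In the presence of both types of marked vertices the sign of a crossing carries no information:
by commutation the crossing may be put between the vertices, and leaving it there changes its sign.
-/
lemma cross_vert_vert (b c : Bool) (l : List Node) :
    ColumnEquiv ((false, c) :: (true, b) :: (true, !b) :: l)
      ((false, !c) :: (true, b) :: (true, !b) :: l) := by
  have p1 : ∀ b c : Bool, [(false, c), (true, b), (true, !b)].Perm
    [(true, b), (false, c), (true, !b)] := by decide
  have p2 : ∀ b c : Bool, [(true, b), (true, !b), (false, !c)].Perm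
    [(false, !c), (true, b), (true, !b)] := by decide
  exact (((of_perm (p1 b c)).trans (vert_cross_vert b c)).trans (of_perm (p2 b c))).append_right l

/-- A column without a cancelling pair of crossings and without a repeated marked vertex is
irreducible up to order, except for one crossing with both marked vertices, where the sign is
normalized to `false`. -/
lemma exists_irreducible {l : List Node} (hl : l.length = 3) :
    ∃ l', ColumnEquiv l l' ∧ (l'.length ≤ 2 ∨ l' ∈ irreducibleColumns) := by
  obtain ⟨a, b, c, rfl⟩ := List.length_eq_three.1 hl
  have key : ∀ a b c : Node,
      (∃ (e : Bool) (x : Node), [a, b, c].Perm [(false, e), (false, !e), x]) ∨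
      (∃ (e : Bool) (x : Node), [a, b, c].Perm [(true, e), (true, e), x]) ∨
      (∃ l' ∈ irreducibleColumns, [a, b, c].Perm l') ∨
      [a, b, c].Perm [(false, true), (true, false), (true, !false)] := by decide +kernel
  rcases key a b c with ⟨e, x, h⟩ | ⟨e, x, h⟩ | ⟨l', h, h'⟩ | h
  · exact ⟨[x], (of_perm h).trans ((cross_cancel e).append_right [x]), by simp⟩
  · exact ⟨[(true, e), x], (of_perm h).trans ((vert_vert e).append_right [x]), by simp⟩
  · exact ⟨l', of_perm h', Or.inr h⟩
  · exact ⟨_, (of_perm h).trans (cross_vert_vert false true []), by decide⟩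

end ColumnEquiv

/-! ### Diagrams with three columns -/

/-- The diagram with columns `A` and `B` joined by a column which has the single node `x`. -/
def pretzel (A : List Node) (x : Node) (B : List Node) : List Piece :=
  [cup 0, cup 1, cup 3] ++ column 0 A ++ column 2 [x] ++ column 4 B ++ [cap 3, cap 1, cap 0]

lemma strands_pretzel (A : List Node) (x : Node) (B : List Node) :
    strands (pretzel A x B) 0 = some 0 := by
  simp only [pretzel, strands_append]
  simp [strands, Piece.strands, Event.inputs, Event.outputs, strands_column]

lemma pretzel_congr {A A' B B' : List Node} (x : Node) (hA : ColumnEquiv A A')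
    (hB : ColumnEquiv B B') : WordEquiv false 0 (pretzel A x B) (pretzel A' x B') := by
  have h1 : WordEquiv false 0 (pretzel A x B) (pretzel A' x B) := by
    have := (hA 0 6 (by norm_num)).context (n := 0) (a := [cup 0, cup 1, cup 3])
      (b := column 2 [x] ++ column 4 B ++ [cap 3, cap 1, cap 0]) rfl (by
        have := strands_pretzel A x B
        simp only [pretzel, List.append_assoc] at this ⊢
        rw [this]; rfl)
    simpa [pretzel] using this
  have h2 : WordEquiv false 0 (pretzel A' x B) (pretzel A' x B') := by
    have := (hB 4 6 (by norm_num)).context (n := 0)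
      (a := [cup 0, cup 1, cup 3] ++ column 0 A' ++ column 2 [x])
      (b := [cap 3, cap 1, cap 0])
      (by
        simp only [strands_append]
        simp [strands, Piece.strands, Event.inputs, Event.outputs, strands_column]) (by
        have := strands_pretzel A' x B
        simp only [pretzel, List.append_assoc] at this ⊢
        rw [this]; rfl)
    simpa [pretzel] using this
  exact h1.trans h2

/-- The word is equivalent to a word with at most six nodes. -/
def Small (w : List Piece) : Prop :=
  ∃ w', WordEquiv false 0 w w' ∧ w'.countP Piece.isNode ≤ 6

lemma Small.of_equiv {w w' : List Piece} (h : WordEquiv false 0 w w') (h' : Small w') : Small w := by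
  obtain ⟨v, h1, h2⟩ := h'
  exact ⟨v, h.trans h1, h2⟩

lemma countP_column (i : ℕ) (l : List Node) : (column i l).countP Piece.isNode = l.length := by
  unfold column
  rw [List.countP_map, List.countP_eq_length]
  rintro ⟨_ | _, b⟩ - <;> rfl

lemma countP_pretzel (A : List Node) (x : Node) (B : List Node) :
    (pretzel A x B).countP Piece.isNode = A.length + 1 + B.length := by
  simp only [pretzel, List.countP_append, countP_column]
  simp [Piece.isNode]

lemma small_pretzel_of_equiv {A A' B B' : List Node} (x : Node) (hA : ColumnEquiv A A')
    (hB : ColumnEquiv B B') (h : A'.length + B'.length ≤ 5) : Small (pretzel A x B) :=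
  ⟨_, pretzel_congr x hA hB, by rw [countP_pretzel]; omega⟩

lemma Connects.equiv {s t : List SymPiece} {a b : List (ℕ × Rule)}
    (h : Connects false 0 s t a b = true) (β : ℕ → Bool) (ν : ℕ → Node) :
    WordEquiv false 0 (evalWord 0 β ν s) (evalWord 0 β ν t) :=
  Connects.wordEquiv h 0 0 β ν

lemma countP_evalWord (i β ν) (w : List SymPiece) :
    (evalWord i β ν w).countP Piece.isNode = w.countP fun p => p.event.isNode := by
  unfold evalWord
  rw [List.countP_map]
  congr 1
  funext ⟨j, e⟩
  cases e with
  | nd v f => rcases h : (ν v).1 <;> simp [Piece.isNode, SymEvent.eval, SymEvent.isNode, h]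
  | _ => rfl

lemma Small.of_evalWord {v : List Piece} {w : List SymPiece} {β : ℕ → Bool} {ν : ℕ → Node}
    (h : WordEquiv false 0 v (evalWord 0 β ν w)) (hw : (w.countP fun p => p.event.isNode) ≤ 6) :
    Small v :=
  ⟨_, h, (countP_evalWord 0 β ν w).trans_le hw⟩

/-! ### Isotopies that remove a node of a pretzel diagram or move it to another column -/

/-- The crossing of the left column and the opposite middle crossing can be turned into two parallel
crossings, that is, into one strand passing over or under two others. By `Γ₃` and `Γ₄` this strand
runs along the whole right column; at its lower end one of the two crossings is a kink and
disappears. -/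
lemma small_flype_left (b : Bool) (n₀ n₁ n₂ n₃ n₄ : Node) :
    Small (pretzel [(false, b), n₀, n₁] (false, !b) [n₂, n₃, n₄]) := by
  have h0 : Connects false 0 [.mx 0, .mx 1, .mx 3, .cr 0 0 false, .nd 0 0 false, .nd 0 1 false, .cr 2 0
      true, .nd 4 2 false, .nd 4 3 false, .nd 4 4 false, .mn 3, .mn 1, .mn 0] [.mx 0, .mx 0, .cr
      1 0 true, .mx 3, .cr 2 0 true, .nd 0 0 false, .nd 0 1 false, .nd 4 2 false, .nd 4 3 false,
      .nd 4 4 false, .mn 3, .mn 1, .mn 0] [(5,.swapR),(4,.swapR)] [(1,.turn),(2,.swapR)] = true := by decide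
  have h1 : Connects false 0 [.mx 0, .mx 0, .cr 1 0 true, .mx 3, .cr 2 0 true, .nd 0 0 false, .nd 0 1
      false, .nd 4 2 false, .nd 4 3 false, .nd 4 4 false, .mn 3, .mn 1, .mn 0] [.mx 0, .mx 1, .mx
      2, .cr 4 0 false, .cr 3 0 false, .nd 0 0 false, .nd 0 1 false, .nd 4 2 false, .nd 4 3
      false, .nd 4 4 false, .mn 3, .mn 1, .mn 0] [(0,.swapL),(1,.turn)] [(2,.swapR),(3,.turn)] = true := by decide
  have h2 : Connects false 0 [.mx 0, .mx 1, .mx 2, .cr 4 0 false, .cr 3 0 false, .nd 0 0 false, .nd 0 1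
      false, .nd 4 2 false, .nd 4 3 false, .nd 4 4 false, .mn 3, .mn 1, .mn 0] [.mx 0, .mx 1, .mx
      2, .nd 0 0 false, .nd 0 1 false, .nd 3 2 false, .nd 3 3 false, .nd 3 4 false, .cr 4 0
      false, .cr 3 0 false, .mn 3, .mn 1, .mn 0] [(4,.swapL),(3,.swapL),(5,.swapL),(4,.swapL)]
      [(7,.slide),(6,.slide),(5,.slide)] = true := by decide
  have h3 : Connects false 0 [.mx 0, .mx 1, .mx 2, .nd 0 0 false, .nd 0 1 false, .nd 3 2 false, .nd 3 3
      false, .nd 3 4 false, .cr 4 0 false, .cr 3 0 false, .mn 3, .mn 1, .mn 0] [.mx 0, .mx 1, .mx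
      2, .nd 0 0 false, .nd 0 1 false, .nd 3 2 false, .nd 3 3 false, .nd 3 4 false, .cr 4 0
      false, .mn 3, .mn 1, .mn 0] [(9,.zigIns 3
      false),(10,.swapR),(9,.turn),(11,.swapR),(10,.turn),(9,.r1),(9,.zig)] [] = true := by decide
  let β : ℕ → Bool := fun _ => b
  let ν : ℕ → Node := fun v => if v = 0 then n₀ else if v = 1 then n₁ else if v = 2 then n₂ else if v = 3 then n₃ else n₄
  have := Small.of_evalWord ((((Connects.equiv h0 β ν).trans (Connects.equiv h1 β ν)).trans (Connects.equiv h2 β ν)).trans (Connects.equiv h3 β ν))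
    (by decide)
  simpa [β, ν, evalWord, pretzel, column, SymEvent.eval_nd, SymEvent.eval_cr,
    SymEvent.eval_vt, SymEvent.eval_mx, SymEvent.eval_mn] using this

/-- The same isotopy with the strand running along the left column. -/
lemma small_flype_right (b : Bool) (n₀ n₁ n₂ n₃ n₄ : Node) :
    Small (pretzel [n₂, n₃, n₄] (false, !b) [(false, b), n₀, n₁]) := by
  have h0 : Connects false 0 [.mx 0, .mx 1, .mx 3, .nd 0 2 false, .nd 0 3 false, .nd 0 4 false, .cr 2 0
      true, .cr 4 0 false, .nd 4 0 false, .nd 4 1 false, .mn 3, .mn 1, .mn 0] [.mx 0, .mx 1, .mx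
      2, .cr 0 0 false, .cr 1 0 false, .nd 0 2 false, .nd 0 3 false, .nd 0 4 false, .nd 4 0
      false, .nd 4 1 false, .mn 1, .mn 1, .mn 0]
      [(1,.swapR),(5,.swapR),(4,.swapR),(3,.swapR),(2,.turn),(6,.swapR),(5,.swapR)]
      [(2,.swapL),(1,.turn),(0,.swapL),(1,.turn),(2,.swapL),(3,.swapL),(4,.swapL),(10,.swapR)] = true := by decide
  have h1 : Connects false 0 [.mx 0, .mx 1, .mx 2, .cr 0 0 false, .cr 1 0 false, .nd 0 2 false, .nd 0 3
      false, .nd 0 4 false, .nd 4 0 false, .nd 4 1 false, .mn 1, .mn 1, .mn 0] [.mx 0, .mx 1, .mx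
      2, .nd 1 2 false, .nd 1 3 false, .nd 1 4 false, .cr 0 0 false, .cr 1 0 false, .nd 4 0
      false, .nd 4 1 false, .mn 1, .mn 1, .mn 0] [(3,.slide),(4,.slide)] [(5,.slide)] = true := by decide
  have h2 : Connects false 0 [.mx 0, .mx 1, .mx 2, .nd 1 2 false, .nd 1 3 false, .nd 1 4 false, .cr 0 0
      false, .cr 1 0 false, .nd 4 0 false, .nd 4 1 false, .mn 1, .mn 1, .mn 0] [.mx 0, .mx 1, .mx
      2, .nd 1 2 false, .nd 1 3 false, .nd 1 4 false, .cr 0 0 false, .nd 4 0 false, .nd 4 1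
      false, .mn 1, .mn 1, .mn 0] [(7,.swapR),(8,.swapR),(9,.zigIns 1
      false),(10,.swapR),(9,.turn),(11,.swapR),(10,.turn),(9,.r1),(9,.zig)] [] = true := by decide
  let β : ℕ → Bool := fun _ => b
  let ν : ℕ → Node := fun v => if v = 0 then n₀ else if v = 1 then n₁ else if v = 2 then n₂ else if v = 3 then n₃ else n₄
  have := Small.of_evalWord (((Connects.equiv h0 β ν).trans (Connects.equiv h1 β ν)).trans (Connects.equiv h2 β ν))
    (by decide)
  simpa [β, ν, evalWord, pretzel, column, SymEvent.eval_nd, SymEvent.eval_cr,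
    SymEvent.eval_vt, SymEvent.eval_mx, SymEvent.eval_mn] using this

/-- The first crossings of the outer columns combine to a strand which passes the middle vertex by
`Γ₄`. Then `Γ₇` exchanges the middle vertex with the vertex of the left column, and passing the
strand across a vertex once more leaves one of its crossings as a kink. -/
lemma small_delta (b c : Bool) :
    Small (pretzel [(false, b), (true, c), (false, b)] (true, !c) [(false, !b), (true, c), (false, !b)]) := by
  have h0 : Connects false 0 [.mx 0, .mx 1, .mx 3, .cr 0 0 false, .vt 0 1 false, .cr 0 0 false, .vt 2 1
      true, .cr 4 0 true, .vt 4 1 false, .cr 4 0 true, .mn 3, .mn 1, .mn 0] [.mx 0, .mx 2, .vt 1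
      1 true, .mx 1, .cr 2 0 false, .cr 3 0 false, .vt 0 1 false, .cr 0 0 false, .vt 4 1 false,
      .cr 4 0 true, .mn 3, .mn 1, .mn 0]
      [(2,.swapL),(5,.swapR),(4,.swapR),(6,.swapR),(5,.swapR),(4,.swapR),(3,.turn)]
      [(2,.swapL),(1,.swapL),(3,.slide),(2,.swapL),(1,.turn),(0,.swapR),(1,.turn)] = true := by decide
  have h1 : Connects false 0 [.mx 0, .mx 2, .vt 1 1 true, .mx 1, .cr 2 0 false, .cr 3 0 false, .vt 0 1
      false, .cr 0 0 false, .vt 4 1 false, .cr 4 0 true, .mn 3, .mn 1, .mn 0] [.mx 0, .mx 0, .vt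
      1 1 true, .mx 2, .cr 3 0 false, .vt 2 1 true, .cr 0 0 false, .vt 4 1 false, .cr 4 0 true,
      .mn 3, .mn 1, .mn 0]
      [(0,.swapR),(1,.turn),(5,.swapL),(4,.swapL),(3,.turn),(2,.swapL),(1,.swapL),(3,.g7),(2,.swapL),(3,.turn),(4,.slide),(3,.r1)]
      [] = true := by decide
  let β : ℕ → Bool := fun v => if v = 0 then b else c
  let ν : ℕ → Node := fun _ => (false, false)
  have := Small.of_evalWord ((Connects.equiv h0 β ν).trans (Connects.equiv h1 β ν))
    (by decide)
  simpa [β, ν, evalWord, pretzel, column, SymEvent.eval_nd, SymEvent.eval_cr,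
    SymEvent.eval_vt, SymEvent.eval_mx, SymEvent.eval_mn] using this

/-- After a turn at the minima, the last vertex of the right column and the middle vertex have
opposite markers at neighbouring positions. `Γ₇` exchanges them and thereby carries a vertex over to
the left column. The total number of nodes is unchanged; the gain is that the longer column may then
become reducible. -/
lemma pretzel_slide_left (b : Bool) (n₀ n₁ n₂ n₃ n₄ : Node) :
    WordEquiv false 0 (pretzel [n₀, n₁, n₂] (true, b) [n₃, n₄, (true, b)])
      (pretzel [n₀, n₁, n₂, (true, b)] (true, b) [n₃, n₄]) := by
  have h0 : Connects false 0 [.mx 0, .mx 1, .mx 3, .nd 0 0 false, .nd 0 1 false, .nd 0 2 false, .vt 2 0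
      false, .nd 4 3 false, .nd 4 4 false, .vt 4 0 false, .mn 3, .mn 1, .mn 0] [.mx 0, .mx 1, .mx
      3, .nd 0 0 false, .nd 0 1 false, .nd 0 2 false, .vt 0 0 false, .vt 2 0 false, .nd 4 3
      false, .nd 4 4 false, .mn 3, .mn 1, .mn 0]
      [(6,.swapR),(7,.swapR),(8,.swapR),(9,.turn),(8,.g7),(9,.swapL),(8,.turn),(7,.swapL)]
      [(6,.swapR),(7,.swapR),(6,.swapR),(8,.swapR),(9,.swapR),(10,.turn),(11,.swapR),(10,.turn)] = true := by decide
  let β : ℕ → Bool := fun _ => b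
  let ν : ℕ → Node := fun v => if v = 0 then n₀ else if v = 1 then n₁ else if v = 2 then n₂ else if v = 3 then n₃ else n₄
  have := Connects.equiv h0 β ν
  simpa [β, ν, evalWord, pretzel, column, SymEvent.eval_nd, SymEvent.eval_cr,
    SymEvent.eval_vt, SymEvent.eval_mx, SymEvent.eval_mn] using this

/-- The same use of `Γ₇`, carrying a vertex from the left column to the right one. -/
lemma pretzel_slide_right (b : Bool) (n₀ n₁ n₂ n₃ n₄ : Node) :
    WordEquiv false 0 (pretzel [n₀, n₁, (true, b)] (true, b) [n₂, n₃, n₄])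
      (pretzel [n₀, n₁] (true, b) [n₂, n₃, n₄, (true, b)]) := by
  have h0 : Connects false 0 [.mx 0, .mx 1, .mx 3, .nd 0 0 false, .nd 0 1 false, .vt 0 0 false, .vt 2 0
      false, .nd 4 2 false, .nd 4 3 false, .nd 4 4 false, .mn 3, .mn 1, .mn 0] [.mx 0, .mx 1, .mx
      3, .nd 0 0 false, .nd 0 1 false, .vt 2 0 false, .nd 4 2 false, .nd 4 3 false, .nd 4 4
      false, .vt 4 0 false, .mn 3, .mn 1, .mn 0]
      [(5,.swapR),(6,.swapR),(5,.swapR),(7,.swapR),(8,.swapR),(9,.swapR),(10,.turn),(11,.swapR),(10,.turn)]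
      [(5,.swapR),(6,.swapR),(7,.swapR),(8,.swapR),(9,.turn),(8,.g7),(9,.swapL),(8,.turn),(7,.swapL),(6,.swapL)] = true := by decide
  let β : ℕ → Bool := fun _ => b
  let ν : ℕ → Node := fun v => if v = 0 then n₀ else if v = 1 then n₁ else if v = 2 then n₂ else if v = 3 then n₃ else n₄
  have := Connects.equiv h0 β ν
  simpa [β, ν, evalWord, pretzel, column, SymEvent.eval_nd, SymEvent.eval_cr,
    SymEvent.eval_vt, SymEvent.eval_mx, SymEvent.eval_mn] using this

end MarkedGraph

namespace MarkedGraph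

/-! ### Colourings -/

lemma le_of_strands_cons {i n : ℕ} {e : Event} {w : List Piece}
    (h : (strands (⟨i, e⟩ :: w) n).isSome) : i + e.inputs ≤ n := by
  by_contra h'
  simp [strands, Piece.strands, h'] at h

lemma le_of_strands_cons_cons {i j n : ℕ} {e e' : Event} {w : List Piece}
    (h : (strands (⟨i, e⟩ :: ⟨j, e'⟩ :: w) n).isSome) :
    i + e.inputs ≤ n ∧ j + e'.inputs ≤ n - e.inputs + e.outputs := by
  obtain ⟨m, hm⟩ := Option.isSome_iff_exists.1 h
  obtain ⟨k, h1, h2⟩ := Option.bind_eq_some_iff.1 hm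
  have h3 := le_of_strands_cons (Option.isSome_iff_exists.2 ⟨m, h2⟩)
  simp only [Piece.strands] at h1
  split_ifs at h1 with h5
  simp only [Option.some.injEq] at h1
  omega

lemma strands_balance {w : List Piece} {n m : ℕ} (h : strands w n = some m) :
    m + (w.map fun p => p.event.inputs).sum = n + (w.map fun p => p.event.outputs).sum := by
  induction w generalizing n with
  | nil => simpa [strands] using h.symm
  | cons p w ih =>
    obtain ⟨k, h1, h2⟩ := Option.bind_eq_some_iff.1 h
    have := ih h2
    simp only [Piece.strands] at h1
    split_ifs at h1
    simp only [Option.some.injEq] at h1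
    simp only [List.map_cons, List.sum_cons]
    omega

/-- Outputs minus inputs, summed over the pieces, agree on both sides of every move, and by
`strands_balance` this sum fixes the number of strands at the bottom. -/
lemma strands_eq_of_move {link : Bool} {s t : List Piece} (h : Move link s t) {n m m' : ℕ}
    (hs : strands s n = some m) (ht : strands t n = some m') : m = m' := by
  have h1 := strands_balance hs
  have h2 := strands_balance ht
  rcases h with (h | h) | ⟨-, h⟩ <;> cases h <;>
    simp only [List.map_cons, List.map_nil, List.sum_cons, List.sum_nil, List.cons_append,
      List.nil_append, Event.inputs, Event.outputs, doubleCross] at h1 h2 <;> omega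

/-- A kei (involutory quandle). -/
structure Kei (X : Type) where
  op : X → X → X
  idem : ∀ x, op x x = x
  invol : ∀ x y, op (op x y) y = x
  distrib : ∀ x y z, op (op x y) z = op (op x z) (op y z)

section Colourings

variable {X : Type} [Fintype X] [DecidableEq X] (op : X → X → X)

/-- The sum of `f` over all colourings below an event, for a given colouring above it. -/
def colourAt : ℕ → Event → (List X → ℕ) → List X → ℕ
  | 0, .localMax, f, l => ∑ a, f (a :: a :: l)
  | 0, .localMin, f, a :: b :: l => if a = b then f l else 0
  | 0, .crossing true, f, a :: b :: l => f (op b a :: a :: l)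
  | 0, .crossing false, f, a :: b :: l => f (b :: op a b :: l)
  | i + 1, e, f, a :: l => colourAt i e (fun l' => f (a :: l')) l
  | _, _, _, _ => 0

/-- The sum of `f` over all colourings below a word, for a given colouring above it. -/
def colour : List Piece → (List X → ℕ) → List X → ℕ
  | [], f => f
  | p :: w, f => colourAt op p.pos p.event (colour w f)

lemma colour_append (u v : List Piece) (f : List X → ℕ) :
    colour op (u ++ v) f = colour op u (colour op v f) := by
  induction u with
  | nil => rfl
  | cons p u ih => simp [colour, ih]

/-- Colouring numbers are computed as a linear state sum. Linearity is what allows the sum over the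
colours of a new strand to be exchanged with a distant event. -/
lemma colourAt_sum {ι : Type} (s : Finset ι) (i : ℕ) (e : Event) (f : ι → List X → ℕ) (l : List X) :
    colourAt op i e (fun l' => ∑ a ∈ s, f a l') l = ∑ a ∈ s, colourAt op i e (f a) l := by
  induction i generalizing f l with
  | zero =>
    rcases e with _ | _ | (_ | _) | _
    · simp only [colourAt]
      exact Finset.sum_comm
    · rcases l with _ | ⟨a, _ | ⟨b, l⟩⟩ <;> simp only [colourAt, Finset.sum_const_zero]
      split_ifs <;> simp
    · rcases l with _ | ⟨a, _ | ⟨b, l⟩⟩ <;> simp [colourAt]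
    · rcases l with _ | ⟨a, _ | ⟨b, l⟩⟩ <;> simp [colourAt]
    · simp [colourAt]
  | succ i ih =>
    rcases l with _ | ⟨a, l⟩
    · simp [colourAt]
    · simpa only [colourAt] using ih (fun b l' => f b (a :: l')) l

lemma colourAt_zero_fun (i : ℕ) (e : Event) (l : List X) :
    colourAt op i e (fun _ => 0) l = 0 := by
  simpa using colourAt_sum op (∅ : Finset ℕ) i e (fun _ _ => 0) l

lemma colourAt_congr {i : ℕ} {e : Event} {f g : List X → ℕ} {n m : ℕ} {l : List X}
    (hs : (Piece.mk i e).strands n = some m) (hl : l.length = n)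
    (h : ∀ l', l'.length = m → f l' = g l') : colourAt op i e f l = colourAt op i e g l := by
  induction i generalizing f g n m l with
  | zero =>
    simp only [Piece.strands] at hs
    split_ifs at hs with h1
    simp only [Option.some.injEq] at hs
    subst hl hs
    rcases e with _ | _ | (_ | _) | _
    · simp only [colourAt]
      exact Finset.sum_congr rfl fun a _ => h _ (by simp [Event.inputs, Event.outputs])
    all_goals
      rcases l with _ | ⟨a, _ | ⟨b, l⟩⟩
      any_goals simp [Event.inputs] at h1; done
      simp only [colourAt]
      try
        simp only [Event.inputs, Event.outputs, List.length_cons] at h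
        rw [h _ (by simp)]
  | succ i ih =>
    simp only [Piece.strands] at hs
    split_ifs at hs with h1
    simp only [Option.some.injEq] at hs
    subst hl hs
    rcases l with _ | ⟨a, l⟩
    · simp at h1
    · simp only [List.length_cons] at h1 h
      refine ih (n := l.length) (m := l.length - e.inputs + e.outputs) ?_ rfl fun l' hl' => h _ ?_
      · simp only [Piece.strands]
        rw [if_pos (by omega)]
      · simp only [List.length_cons, hl']
        omega

lemma colour_congr {w : List Piece} {f g : List X → ℕ} {n m : ℕ} {l : List X}
    (hs : strands w n = some m) (hl : l.length = n)
    (h : ∀ l', l'.length = m → f l' = g l') : colour op w f l = colour op w g l := by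
  induction w generalizing n l with
  | nil => exact h _ (by simpa [strands, hl] using hs)
  | cons p w ih =>
    obtain ⟨k, h1, h2⟩ := Option.bind_eq_some_iff.1 hs
    exact colourAt_congr op h1 hl fun l' hl' => ih h2 hl'

/-- The word with all positions increased by `i`. -/
def shift (i : ℕ) (w : List Piece) : List Piece := w.map fun p => ⟨i + p.pos, p.event⟩

lemma colour_shift_succ (i : ℕ) (w : List Piece) (f : List X → ℕ) (a : X) (l : List X) :
    colour op (shift (i + 1) w) f (a :: l) = colour op (shift i w) (fun l' => f (a :: l')) l := by
  induction w generalizing l with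
  | nil => rfl
  | cons p w ih =>
    simp only [shift, List.map_cons, colour] at ih ⊢
    rw [show i + 1 + p.pos = i + p.pos + 1 by omega, colourAt]
    simp_rw [ih]

/-- Strands on the left keep their colours, so invariance has to be checked only for moves at
position `0`. -/
lemma colour_shift {s t : List Piece} {k : ℕ}
    (h : ∀ (f : List X → ℕ) (l : List X), k ≤ l.length → colour op s f l = colour op t f l) (i : ℕ)
    (f : List X → ℕ) (l : List X) (hl : i + k ≤ l.length) :
    colour op (shift i s) f l = colour op (shift i t) f l := by
  induction i generalizing f l with
  | zero => simpa [shift] using h f l (by omega)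
  | succ i ih =>
    rcases l with _ | ⟨a, l⟩
    · simp at hl
    · rw [colour_shift_succ, colour_shift_succ]
      exact ih _ _ (by simp only [List.length_cons] at hl; omega)

end Colourings

/-! ### Invariance of colouring numbers under link moves -/

namespace Kei

lemma sum_op {X : Type} [Fintype X] (K : Kei X) (y : X) (f : X → ℕ) : ∑ a, f (K.op a y) = ∑ a, f a :=
  Equiv.sum_comp ⟨fun a => K.op a y, fun a => K.op a y, fun a => K.invol a y, fun a => K.invol a y⟩ f

variable {X : Type} [Fintype X] [DecidableEq X] (K : Kei X)

/-- The events act on disjoint parts of the list of colours; a maximum contributes a sum, which is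
moved past the other event by linearity. -/
lemma colour_interchange (p q : Event) (k : ℕ) (f : List X → ℕ) (l : List X)
    (hl : p.inputs ≤ l.length) :
    colour K.op [⟨0, p⟩, ⟨p.outputs + k, q⟩] f l = colour K.op [⟨p.inputs + k, q⟩, ⟨0, p⟩] f l := by
  rcases p with _ | _ | (_ | _) | _
  · simp only [colour, Event.outputs, Event.inputs, show 2 + k = k + 1 + 1 by omega, colourAt,
      zero_add]
    exact (colourAt_sum K.op Finset.univ k q (fun a l' => f (a :: a :: l')) l).symm
  all_goals
    rcases l with _ | ⟨a, _ | ⟨b, l⟩⟩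
    any_goals simp [Event.inputs] at hl; done
    simp only [colour, Event.outputs, Event.inputs, show 2 + k = k + 1 + 1 by omega, colourAt,
      zero_add]
    try (first | (split_ifs <;> simp [colourAt_zero_fun]) | simp [colourAt_zero_fun])

/-- The three axioms of a kei are what `Γ₁`, `Γ₂` and `Γ₃` need. Marked vertices are given colouring
number zero, so the moves turning a vertex hold trivially. -/
lemma colour_move {s t : List Piece} (h : LinkMove s t) {n m : ℕ} (hs : strands s n = some m)
    (ht : strands t n = some m) (f : List X → ℕ) (l : List X) (hl : l.length = n) :
    colour K.op s f l = colour K.op t f l := by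
  have key : ∀ (i k : ℕ) (s' t' : List Piece), s = shift i s' → t = shift i t' → i + k ≤ n →
      (∀ (f : List X → ℕ) (l : List X), k ≤ l.length → colour K.op s' f l = colour K.op t' f l) →
      colour K.op s f l = colour K.op t f l := by
    rintro i k s' t' rfl rfl hn h
    exact colour_shift K.op h i f l (by omega)
  rcases h with (⟨i, k, p, q⟩ | ⟨i⟩ | ⟨i⟩ | ⟨i, b⟩ | ⟨i, b⟩ | ⟨i, b⟩ | ⟨i, b⟩) |
    (⟨i, b⟩ | ⟨i, b⟩ | ⟨i, b, c, d, h⟩)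
  · refine key i p.inputs [⟨0, p⟩, ⟨p.outputs + k, q⟩] [⟨p.inputs + k, q⟩, ⟨0, p⟩]
      (by simp [shift, add_assoc]) (by simp [shift, add_assoc]) (le_of_strands_cons (Option.isSome_iff_exists.2 ⟨m, hs⟩)) fun f l hl =>
      K.colour_interchange p q k f l hl
  · refine key i 1 [cup 0, cap 1] [] (by simp [shift]) (by simp [shift]) ?_ ?_
    · have := le_of_strands_cons_cons (Option.isSome_iff_exists.2 ⟨m, hs⟩)
      simp only [Event.inputs, Event.outputs] at this
      omega
    · rintro f (_ | ⟨x, l⟩) hl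
      · simp at hl
      · simp [colour, colourAt]
  · refine key i 1 [cup 1, cap 0] [] (by simp [shift]) (by simp [shift]) ?_ ?_
    · have := le_of_strands_cons_cons (Option.isSome_iff_exists.2 ⟨m, hs⟩)
      simp only [Event.inputs, Event.outputs] at this
      omega
    · rintro f (_ | ⟨x, l⟩) hl
      · simp at hl
      · simp [colour, colourAt]
  · refine key i 1 [cup 0, cross 1 b] [cup 1, cross 0 (!b)] (by simp [shift]) (by simp [shift]) ?_ ?_
    · have := le_of_strands_cons_cons (Option.isSome_iff_exists.2 ⟨m, hs⟩)
      simp only [Event.inputs, Event.outputs] at this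
      omega
    · rintro f (_ | ⟨x, l⟩) hl
      · simp at hl
      · cases b
        · simp only [colour, colourAt, Bool.not_false]
          -- Acting by `x` is an involution of the colours, so the sum over the colour of the new
          -- arc may be reindexed by it.
          rw [← K.sum_op x]
          simp only [K.invol]
        · simp [colour, colourAt]
  · refine key i 3 [cross 1 b, cap 0] [cross 0 (!b), cap 1] (by simp [shift]) (by simp [shift]) ?_ ?_
    · have := le_of_strands_cons_cons (Option.isSome_iff_exists.2 ⟨m, hs⟩)
      simp only [Event.inputs, Event.outputs] at this
      omega
    · rintro f (_ | ⟨x, _ | ⟨y, _ | ⟨z, l⟩⟩⟩) hl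
      any_goals simp at hl; done
      cases b
      · simp only [colour, colourAt, Bool.not_false]
        by_cases h : x = z <;> simp [h]
      · simp only [colour, colourAt, Bool.not_true]
        have : x = K.op z y ↔ K.op x y = z :=
          ⟨fun h => by rw [h, K.invol], fun h => by rw [← h, K.invol]⟩
        simp [this]
  · refine key i 1 [cup 0, vert 1 b] [cup 1, vert 0 (!b)] (by simp [shift]) (by simp [shift]) ?_ ?_
    · have := le_of_strands_cons_cons (Option.isSome_iff_exists.2 ⟨m, hs⟩)
      simp only [Event.inputs, Event.outputs] at this
      omega
    · rintro f (_ | ⟨x, l⟩) hl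
      · simp at hl
      · simp [colour, colourAt]
  · refine key i 3 [vert 1 b, cap 0] [vert 0 (!b), cap 1] (by simp [shift]) (by simp [shift]) ?_ ?_
    · have := le_of_strands_cons_cons (Option.isSome_iff_exists.2 ⟨m, hs⟩)
      simp only [Event.inputs, Event.outputs] at this
      omega
    · rintro f (_ | ⟨x, _ | ⟨y, _ | ⟨z, l⟩⟩⟩) hl
      any_goals simp at hl; done
      simp [colour, colourAt]
  · refine key i 0 [cup 0, cross 0 b] [cup 0] (by simp [shift]) (by simp [shift])
      (le_of_strands_cons (Option.isSome_iff_exists.2 ⟨m, hs⟩)) ?_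
    intro f l hl
    cases b <;> simp [colour, colourAt, K.idem]
  · refine key i 2 [cross 0 b, cross 0 (!b)] [] (by simp [shift]) (by simp [shift])
      (le_of_strands_cons (Option.isSome_iff_exists.2 ⟨m, hs⟩)) ?_
    rintro f (_ | ⟨x, _ | ⟨y, l⟩⟩) hl
    any_goals simp at hl; done
    cases b <;> simp [colour, colourAt, K.invol]
  · refine key i 3 [cross 0 b, cross 1 c, cross 0 d] [cross 1 d, cross 0 c, cross 1 b]
      (by simp [shift]) (by simp [shift]) ?_ ?_
    · have := le_of_strands_cons_cons (Option.isSome_iff_exists.2 ⟨m, hs⟩)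
      simp only [Event.inputs, Event.outputs] at this
      omega
    · rintro f (_ | ⟨x, _ | ⟨y, _ | ⟨z, l⟩⟩⟩) hl
      any_goals simp at hl; done
      -- Six sign patterns satisfy the height condition. Each one is self-distributivity, combined
      -- with the involution property where the strand acted on is met in the opposite order.
      cases b <;> cases c <;> cases d <;> simp at h <;> simp [colour, colourAt]
      · rw [K.distrib x y z]
      · rw [K.distrib x (K.op z y) y, K.invol]
      · rw [K.distrib z (K.op x y) y, K.invol]
      · rw [K.distrib y x z]
      · rw [K.distrib y z x]
      · rw [K.distrib z y x]

/-- The number of colourings of a diagram. -/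
def count (w : List Piece) : ℕ := colour K.op w (fun _ => 1) []

lemma count_eq_of_linkEquiv {D D' : Diagram} (h : LinkEquiv D D') :
    K.count D.word = K.count D'.word := by
  induction h with
  | rel D D' h =>
    obtain ⟨u, v, s, t, hst, h1, h2⟩ := h
    have c1 := D.closed
    have c2 := D'.closed
    rw [h1, List.append_assoc, strands_append] at c1
    rw [h2, List.append_assoc, strands_append] at c2
    obtain ⟨n, hn, c1⟩ := Option.bind_eq_some_iff.1 c1
    obtain ⟨n', hn', c2⟩ := Option.bind_eq_some_iff.1 c2
    obtain rfl : n = n' := by simpa [hn] using hn'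
    rw [strands_append] at c1 c2
    obtain ⟨m, hm, -⟩ := Option.bind_eq_some_iff.1 c1
    obtain ⟨m', hm', -⟩ := Option.bind_eq_some_iff.1 c2
    obtain rfl : m = m' := by
      exact strands_eq_of_move (link := false) (Or.inl hst) hm hm'
    rw [count, count, h1, h2]
    simp only [List.append_assoc]
    rw [colour_append, colour_append K.op u, colour_append, colour_append K.op t]
    exact colour_congr K.op hn rfl fun l hl => K.colour_move hst hm hm' _ l hl
  | refl D => rfl
  | symm D D' _ ih => exact ih.symm
  | trans D D' D'' _ _ ih ih' => exact ih.trans ih'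

/-- Without crossings the operation of the kei is never evaluated, so the number depends only on the
underlying set. Comparing with the trivial kei thus tests triviality without counting components. -/
lemma count_eq_of_no_nodes (K' : Kei X) {w : List Piece} (h : w.countP Piece.isNode = 0) :
    K.count w = K'.count w := by
  unfold count
  generalize (fun _ : List X => 1) = f
  generalize ([] : List X) = l
  induction w generalizing l with
  | nil => rfl
  | cons p w ih =>
    rw [List.countP_eq_zero] at h ih
    have e : colour K.op w f = colour K'.op w f :=
      funext fun l => ih (fun q hq => h q (List.mem_cons_of_mem _ hq)) l
    simp only [colour, e]
    have hp := h p List.mem_cons_self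
    generalize colour K'.op w f = g
    clear h ih
    obtain ⟨i, q⟩ := p
    dsimp only
    induction i generalizing g l with
    | zero =>
      rcases q with _ | _ | _ | _
      · rfl
      · rcases l with _ | ⟨a, _ | ⟨b, l⟩⟩ <;> rfl
      all_goals simp [Piece.isNode] at hp
    | succ i ihi =>
      rcases l with _ | ⟨a, l⟩
      · rfl
      · simp only [colourAt]
        exact ihi _ _ hp

lemma count_eq_of_isTrivialLink (K' : Kei X) {D : Diagram} (h : D.IsTrivialLink) :
    K.count D.word = K'.count D.word := by
  obtain ⟨D', h1, h2⟩ := h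
  rw [K.count_eq_of_linkEquiv h1, K'.count_eq_of_linkEquiv h1]
  exact K.count_eq_of_no_nodes K' h2

lemma count_circle (w : List Piece) :
    K.count (cup 0 :: cap 0 :: w) = Fintype.card X * K.count w := by
  simp [count, colour, colourAt]

/-- The kei of all `x : Fin n` with the trivial operation. -/
def trivial (n : ℕ) : Kei (Fin n) := ⟨fun x _ => x, fun _ => rfl, fun _ _ => rfl, fun _ _ _ => rfl⟩

/-- The dihedral kei of order three. -/
def dihedral₃ : Kei (Fin 3) :=
  ⟨fun x y => y + y - x, by decide, by decide, by decide⟩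

/-- The dihedral kei of order five. -/
def dihedral₅ : Kei (Fin 5) :=
  ⟨fun x y => y + y - x, by decide, by decide, by decide⟩

end Kei

/-- A resolution of the word has a number of colourings which a trivial link does not have. -/
def Obstructed (w : List Piece) : Prop :=
  ∃ s : Bool,
    Kei.dihedral₃.count (w.flatMap (Piece.splice s)) ≠
      (Kei.trivial 3).count (w.flatMap (Piece.splice s)) ∨
    Kei.dihedral₅.count (w.flatMap (Piece.splice s)) ≠
      (Kei.trivial 5).count (w.flatMap (Piece.splice s))

instance (w : List Piece) : Decidable (Obstructed w) := by
  unfold Obstructed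
  infer_instance

-- The complete list of 196 irreducible pretzels. The first two alternatives lead to a flype (a
-- crossing opposite to the middle one is available, possibly after changing its sign), the next two
-- to a slide, the fifth to `small_delta`; in all others one of the two resolutions is told apart
-- from trivial links by colourings.
set_option synthInstance.maxHeartbeats 400000 in
set_option synthInstance.maxSize 1000 in
lemma irreducible_pretzel_cases : ∀ A ∈ irreducibleColumns, ∀ x : Node, ∀ B ∈ irreducibleColumns,
    (x.1 = false ∧ (Node.flip x ∈ A ∨ (true, false) ∈ A ∧ (true, true) ∈ A)) ∨
    (x.1 = false ∧ (Node.flip x ∈ B ∨ (true, false) ∈ B ∧ (true, true) ∈ B)) ∨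
    (x.1 = true ∧ x ∈ B ∧ Node.flip x ∈ A) ∨ (x.1 = true ∧ x ∈ A ∧ Node.flip x ∈ B) ∨
    (∃ e : Bool, x.1 = true ∧ A = [(false, e), (false, e), Node.flip x] ∧
      B = [(false, !e), (false, !e), Node.flip x]) ∨ Obstructed (pretzel A x B) := by
  decide +kernel

end MarkedGraph

/-! ### Pretzel diagrams are small or obstructed -/

namespace MarkedGraph

open ColumnEquiv

lemma exists_perm_cons {l : List Node} (hl : l.length = 3) {x : Node} (hx : x ∈ l) :
    ∃ a b, l.Perm [x, a, b] := by
  have h := List.perm_cons_erase hx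
  have h2 : (l.erase x).length = 2 := by
    have := h.length_eq
    simp only [List.length_cons] at this
    omega
  obtain ⟨a, b, e⟩ := List.length_eq_two.1 h2
  exact ⟨a, b, e ▸ h⟩

lemma length_of_mem_irreducibleColumns {l : List Node} (hl : l ∈ irreducibleColumns) :
    l.length = 3 := by
  revert l
  decide

/-- In an irreducible column with both types of marked vertices the sign of the crossing may be
chosen. -/
lemma exists_columnEquiv_cross {l : List Node} (hl : l ∈ irreducibleColumns) (b : Bool)
    (h : (false, b) ∈ l ∨ (true, false) ∈ l ∧ (true, true) ∈ l) :
    ∃ n₀ n₁, ColumnEquiv l [(false, b), n₀, n₁] := by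
  by_cases hb : (false, b) ∈ l
  · obtain ⟨a, c, h⟩ := exists_perm_cons (length_of_mem_irreducibleColumns hl) hb
    exact ⟨a, c, of_perm h⟩
  · have key : ∀ l ∈ irreducibleColumns, ∀ b : Bool, (true, false) ∈ l → (true, true) ∈ l →
        (false, b) ∉ l → l = (false, !b) :: (true, false) :: (true, !false) :: [] := by decide
    obtain ⟨h1, h2⟩ := h.resolve_left hb
    rw [key l hl b h1 h2 hb]
    have := cross_vert_vert false (!b) []
    rw [Bool.not_not] at this
    exact ⟨_, _, this⟩

/-- A column with a marked vertex becomes shorter if a vertex of the other type is added. -/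
lemma exists_columnEquiv_append {l : List Node} (hl : l ∈ irreducibleColumns) (c : Bool)
    (h : (true, !c) ∈ l) : ∃ l', ColumnEquiv (l ++ [(true, c)]) l' ∧ l'.length ≤ 3 := by
  have key : ∀ l ∈ irreducibleColumns, ∀ c : Bool, (true, !c) ∈ l →
      (∃ e : Bool, (l ++ [(true, c)]).Perm ((false, e) :: (true, c) :: (true, !c) :: [(false, e)])) ∨
      (l ++ [(true, c)]).Perm [(true, c), (true, c), (false, false), (true, !c)] := by decide
  rcases key l hl c h with ⟨e, h⟩ | h
  · have h1 : ∀ c e : Bool, ((false, !e) :: (true, c) :: (true, !c) :: [(false, e)]).Perm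
        ([(false, e), (false, !e)] ++ [(true, c), (true, !c)]) := by decide
    exact ⟨_, (((of_perm h).trans (cross_vert_vert c e _)).trans (of_perm (h1 c e))).trans
      ((cross_cancel e).append_right _), by simp⟩
  · exact ⟨_, (of_perm h).trans ((vert_vert c).append_right [(false, false), (true, !c)]), by simp⟩

/-- The slide brings the vertex `(true, c)` to a column containing the other type of vertex. There
the four nodes reduce to three, while the right column keeps two, which makes six with the middle
node. -/
lemma small_of_slide_left {A B : List Node} (c : Bool) (hA : A ∈ irreducibleColumns)
    (hB : B ∈ irreducibleColumns) (h1 : (true, c) ∈ B) (h2 : (true, !c) ∈ A) :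
    Small (pretzel A (true, c) B) := by
  obtain ⟨a, b, h⟩ := exists_perm_cons (length_of_mem_irreducibleColumns hB) h1
  have h' : B.Perm [a, b, (true, c)] := h.trans (List.perm_append_singleton (true, c) [a, b]).symm
  obtain ⟨n₀, n₁, n₂, rfl⟩ := List.length_eq_three.1 (length_of_mem_irreducibleColumns hA)
  obtain ⟨l', h3, h4⟩ := exists_columnEquiv_append hA c h2
  exact ((small_pretzel_of_equiv (true, c) h3 (refl [a, b]) (by simpa using h4)).of_equiv
    (pretzel_slide_left c n₀ n₁ n₂ a b)).of_equiv (pretzel_congr _ (refl _) (of_perm h'))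

lemma small_of_slide_right {A B : List Node} (c : Bool) (hA : A ∈ irreducibleColumns)
    (hB : B ∈ irreducibleColumns) (h1 : (true, c) ∈ A) (h2 : (true, !c) ∈ B) :
    Small (pretzel A (true, c) B) := by
  obtain ⟨a, b, h⟩ := exists_perm_cons (length_of_mem_irreducibleColumns hA) h1
  have h' : A.Perm [a, b, (true, c)] := h.trans (List.perm_append_singleton (true, c) [a, b]).symm
  obtain ⟨n₀, n₁, n₂, rfl⟩ := List.length_eq_three.1 (length_of_mem_irreducibleColumns hB)
  obtain ⟨l', h3, h4⟩ := exists_columnEquiv_append hB c h2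
  exact ((small_pretzel_of_equiv (true, c) (refl [a, b]) h3 (by
    simp only [List.length_cons, List.length_nil]; omega)).of_equiv
    (pretzel_slide_right c a b n₀ n₁ n₂)).of_equiv (pretzel_congr _ (of_perm h') (refl _))

/-- Obstruction is asserted only for an equivalent pretzel with irreducible columns. This is enough,
because admissibility is carried along the equivalence later. -/
lemma small_or_obstructed {A B : List Node} (hA : A.length = 3) (x : Node) (hB : B.length = 3) :
    Small (pretzel A x B) ∨
      ∃ A' B', WordEquiv false 0 (pretzel A x B) (pretzel A' x B') ∧
        Obstructed (pretzel A' x B') := by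
  obtain ⟨A', hA', hA1⟩ := exists_irreducible hA
  obtain ⟨B', hB', hB1⟩ := exists_irreducible hB
  have e := pretzel_congr x hA' hB'
  have hA3 : A'.length ≤ 3 := by
    rcases hA1 with h | h
    · omega
    · exact (length_of_mem_irreducibleColumns h).le
  have hB3 : B'.length ≤ 3 := by
    rcases hB1 with h | h
    · omega
    · exact (length_of_mem_irreducibleColumns h).le
  by_cases hs : A'.length + B'.length ≤ 5
  · exact Or.inl (small_pretzel_of_equiv x hA' hB' hs)
  replace hA1 := hA1.resolve_left (by omega)
  replace hB1 := hB1.resolve_left (by omega)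
  rcases irreducible_pretzel_cases A' hA1 x B' hB1 with ⟨hx, h⟩ | ⟨hx, h⟩ | ⟨hx, h, h'⟩ |
    ⟨hx, h, h'⟩ | ⟨b, hx, rfl, rfl⟩ | h
  · obtain ⟨_, b⟩ := x
    obtain rfl : _ = false := hx
    obtain ⟨n₀, n₁, h⟩ := exists_columnEquiv_cross hA1 (!b) h
    obtain ⟨n₂, n₃, n₄, rfl⟩ := List.length_eq_three.1 (length_of_mem_irreducibleColumns hB1)
    have := small_flype_left (!b) n₀ n₁ n₂ n₃ n₄
    rw [Bool.not_not] at this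
    exact Or.inl ((this.of_equiv (pretzel_congr _ h (refl _))).of_equiv e)
  · obtain ⟨_, b⟩ := x
    obtain rfl : _ = false := hx
    obtain ⟨n₀, n₁, h⟩ := exists_columnEquiv_cross hB1 (!b) h
    obtain ⟨n₂, n₃, n₄, rfl⟩ := List.length_eq_three.1 (length_of_mem_irreducibleColumns hA1)
    have := small_flype_right (!b) n₀ n₁ n₂ n₃ n₄
    rw [Bool.not_not] at this
    exact Or.inl ((this.of_equiv (pretzel_congr _ (refl _) h)).of_equiv e)
  · obtain ⟨_, b⟩ := x
    obtain rfl : _ = true := hx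
    exact Or.inl ((small_of_slide_left b hA1 hB1 h h').of_equiv e)
  · obtain ⟨_, b⟩ := x
    obtain rfl : _ = true := hx
    exact Or.inl ((small_of_slide_right b hA1 hB1 h h').of_equiv e)
  · obtain ⟨_, c⟩ := x
    obtain rfl : _ = true := hx
    have h1 : ∀ b c : Bool, [(false, b), (false, b), (true, c)].Perm
      [(false, b), (true, c), (false, b)] := by decide
    have := small_delta b (!c)
    rw [Bool.not_not] at this
    exact Or.inl ((this.of_equiv (pretzel_congr _ (of_perm (h1 b (!c)))
      (of_perm (h1 (!b) (!c))))).of_equiv e)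
  · exact Or.inr ⟨A', B', e, h⟩

end MarkedGraph

namespace MarkedGraph

/-! ### Deleting components of a link diagram -/

/-- Deleting strands in an event: `l` and `l'` say which strands above and below the event are
kept, `r` is what remains of the event if `c` further strands on the left are kept. -/
inductive DelStep : ℕ → List Bool → ℕ → Event → List Bool → List Piece → Prop
  | localMax (c : ℕ) (x : Bool) (l : List Bool) :
      DelStep c l 0 .localMax (x :: x :: l) (if x then [cup c] else [])
  | localMin (c : ℕ) (x : Bool) (l : List Bool) :
      DelStep c (x :: x :: l) 0 .localMin l (if x then [cap c] else [])
  | crossing (c : ℕ) (b x y : Bool) (l : List Bool) :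
      DelStep c (x :: y :: l) 0 (.crossing b) (y :: x :: l) (if x && y then [cross c b] else [])
  | succ {c : ℕ} (a : Bool) {l : List Bool} {i : ℕ} {e : Event} {l' : List Bool} {r : List Piece} :
      DelStep (c + a.toNat) l i e l' r → DelStep c (a :: l) (i + 1) e (a :: l') r

/-- Deleting strands in a word. -/
inductive Del : ℕ → List Bool → List Piece → List Bool → List Piece → Prop
  | nil (c : ℕ) (l : List Bool) : Del c l [] l []
  | cons {c : ℕ} {l : List Bool} {i : ℕ} {e : Event} {w : List Piece} {l' l'' : List Bool}
      {r r' : List Piece} :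
      DelStep c l i e l' r → Del c l' w l'' r' → Del c l (⟨i, e⟩ :: w) l'' (r ++ r')

/-- An event either vanishes or survives as one event of the same kind, and whether it does is
independent of what lies on its left; only the offset `c` enters its new position. This is used to
move events past each other. -/
lemma DelStep.shape {c : ℕ} {l l' : List Bool} {i : ℕ} {e : Event} {r : List Piece}
    (h : DelStep c l i e l' r) :
    (r = [] ∧ (∀ d, DelStep d l i e l' []) ∧ l.count true = l'.count true) ∨
      ∃ k, r = [⟨c + k, e⟩] ∧ (∀ d, DelStep d l i e l' [⟨d + k, e⟩]) ∧
        k + e.inputs ≤ l.count true ∧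
        l'.count true = l.count true - e.inputs + e.outputs := by
  induction h with
  | localMax c x l =>
    cases x
    · exact Or.inl ⟨rfl, fun d => .localMax d false l, by simp⟩
    · exact Or.inr ⟨0, rfl, fun d => .localMax d true l, by simp [Event.inputs, Event.outputs]⟩
  | localMin c x l =>
    cases x
    · exact Or.inl ⟨rfl, fun d => .localMin d false l, by simp⟩
    · exact Or.inr ⟨0, rfl, fun d => .localMin d true l, by simp [Event.inputs, Event.outputs]⟩
  | crossing c b x y l =>
    by_cases h : x = true ∧ y = true
    · obtain ⟨rfl, rfl⟩ := h
      exact Or.inr ⟨0, rfl, fun d => .crossing d b true true l,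
        by simp [Event.inputs, Event.outputs]⟩
    · have h' : (x && y) = false := by cases x <;> cases y <;> simp_all
      refine Or.inl ⟨by simp [h'], fun d => ?_, ?_⟩
      · have := DelStep.crossing d b x y l
        rwa [h'] at this
      · cases x <;> cases y <;> simp
  | @succ c a l i e l' r _ ih =>
    rcases ih with ⟨rfl, h1, h2⟩ | ⟨k, rfl, h1, h2, h3⟩
    · exact Or.inl ⟨rfl, fun d => .succ a (h1 _), by cases a <;> simp [h2]⟩
    · refine Or.inr ⟨a.toNat + k, by rw [add_assoc], fun d => ?_, ?_⟩
      · rw [← add_assoc]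
        exact .succ a (h1 _)
      · cases a
        · simpa using ⟨h2, h3⟩
        · simp only [Bool.toNat_true, List.count_cons_self]
          omega

lemma DelStep.length {c : ℕ} {l l' : List Bool} {i : ℕ} {e : Event} {r : List Piece}
    (h : DelStep c l i e l' r) : (Piece.mk i e).strands l.length = some l'.length := by
  induction h with
  | localMax c x l => simp [Piece.strands, Event.inputs, Event.outputs]
  | localMin c x l => simp [Piece.strands, Event.inputs, Event.outputs]
  | crossing c b x y l => simp [Piece.strands, Event.inputs, Event.outputs]
  | @succ c a l i e l' r _ ih =>
    simp only [Piece.strands] at ih ⊢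
    split_ifs at ih with h
    simp only [Option.some.injEq] at ih
    rw [if_pos (by simp only [List.length_cons]; omega)]
    simp only [List.length_cons, Option.some.injEq]
    omega

namespace Del

lemma length {c : ℕ} {l l' : List Bool} {w r : List Piece} (h : Del c l w l' r) :
    strands w l.length = some l'.length := by
  induction h with
  | nil => rfl
  | cons h1 _ ih => rw [strands, h1.length, Option.bind_some, ih]

/-- The summand `c` accounts for kept strands on the left which are not recorded in the list of
flags. -/
lemma strands_eq {l l' : List Bool} {c : ℕ} {w r : List Piece} (h : Del c l w l' r) :
    strands r (c + l.count true) = some (c + l'.count true) := by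
  induction h with
  | nil => rfl
  | cons h1 _ ih =>
    rcases h1.shape with ⟨rfl, -, h2⟩ | ⟨k, rfl, -, h2, h3⟩
    · simpa [h2] using ih
    · rw [List.singleton_append, strands, Piece.strands, if_pos (by simp only; omega),
        Option.bind_some, ← ih, h3]
      congr 1
      simp only
      omega

lemma append {c : ℕ} {l l' l'' : List Bool} {u v r r' : List Piece} (h : Del c l u l' r)
    (h' : Del c l' v l'' r') : Del c l (u ++ v) l'' (r ++ r') := by
  induction h with
  | nil => exact h'
  | cons h1 _ ih =>
    rw [List.append_assoc]
    exact .cons h1 (ih h')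

lemma exists_of_append {c : ℕ} {l l'' : List Bool} {u v r : List Piece}
    (h : Del c l (u ++ v) l'' r) :
    ∃ l' r₁ r₂, Del c l u l' r₁ ∧ Del c l' v l'' r₂ ∧ r = r₁ ++ r₂ := by
  induction u generalizing l r with
  | nil => exact ⟨l, [], r, .nil c l, h, rfl⟩
  | cons p u ih =>
    cases h with
    | cons h1 h2 =>
      obtain ⟨l', r₁, r₂, h3, h4, rfl⟩ := ih h2
      exact ⟨l', _, r₂, .cons h1 h3, h4, by simp⟩

lemma shift_succ {c : ℕ} {a : Bool} {l : List Bool} {i : ℕ} {w r : List Piece} {l' : List Bool}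
    (h : Del (c + a.toNat) l (shift i w) l' r) : Del c (a :: l) (shift (i + 1) w) (a :: l') r := by
  induction w generalizing l r with
  | nil =>
    cases h
    exact .nil _ _
  | cons p w ih =>
    cases h with
    | cons h1 h2 =>
      simp only [shift, List.map_cons]
      rw [show i + 1 + p.pos = i + p.pos + 1 by omega]
      exact .cons (.succ a h1) (ih h2)

lemma of_shift_succ {c : ℕ} {l : List Bool} {i : ℕ} {p : Piece} {w r : List Piece} {l' : List Bool}
    (h : Del c l (shift (i + 1) (p :: w)) l' r) :
    ∃ a l₁ l₂, l = a :: l₁ ∧ l' = a :: l₂ ∧ Del (c + a.toNat) l₁ (shift i (p :: w)) l₂ r := by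
  have key : ∀ (w r : List Piece) (a : Bool) (l l' : List Bool),
      Del c (a :: l) (shift (i + 1) w) l' r → ∃ l₂, l' = a :: l₂ ∧
        Del (c + a.toNat) l (shift i w) l₂ r := by
    intro w
    induction w with
    | nil =>
      intro r a l l' h
      cases h
      exact ⟨l, rfl, .nil _ _⟩
    | cons p w ih =>
      intro r a l l' h
      simp only [shift, List.map_cons] at h
      rw [show i + 1 + p.pos = i + p.pos + 1 by omega] at h
      cases h with
      | cons h1 h2 =>
        cases h1 with
        | succ _ h1 =>
          obtain ⟨l₂, rfl, h3⟩ := ih _ _ _ _ h2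
          exact ⟨l₂, rfl, .cons h1 h3⟩
  rcases l with _ | ⟨a, l⟩
  · simp only [shift, List.map_cons] at h
    rw [show i + 1 + p.pos = i + p.pos + 1 by omega] at h
    cases h with
    | cons h1 h2 => cases h1
  · obtain ⟨l₂, rfl, h1⟩ := key _ _ _ _ _ h
    exact ⟨a, l, l₂, rfl, rfl, h1⟩

/-- If strands are deleted in `s`, the same strands may be deleted in `t`, and the results are
equal or differ by a link move. -/
def Transfers (k : ℕ) (s t : List Piece) : Prop :=
  ∀ (c : ℕ) (l l' : List Bool) (r : List Piece), k ≤ l.length → Del c l s l' r →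
    ∃ r', Del c l t l' r' ∧ (r = r' ∨ LinkMove r r' ∨ LinkMove r' r)

lemma Transfers.shift {k : ℕ} {s t : List Piece} (h : Transfers k s t) (i : ℕ) :
    Transfers (i + k) (shift i s) (shift i t) := by
  induction i with
  | zero => simpa [MarkedGraph.shift] using h
  | succ i ih =>
    intro c l l' r hl h
    rcases l with _ | ⟨a, l⟩
    · simp at hl
    simp only [List.length_cons] at hl
    have : ∃ l₂, l' = a :: l₂ ∧ Del (c + a.toNat) l (MarkedGraph.shift i s) l₂ r := by
      rcases s with _ | ⟨p, s⟩
      · cases h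
        exact ⟨l, rfl, .nil _ _⟩
      · obtain ⟨a', l₁, l₂, h1, rfl, h2⟩ := of_shift_succ h
        simp only [List.cons.injEq] at h1
        obtain ⟨rfl, rfl⟩ := h1
        exact ⟨l₂, rfl, h2⟩
    obtain ⟨l₂, rfl, h1⟩ := this
    obtain ⟨r', h2, h3⟩ := ih _ _ _ _ (by omega) h1
    exact ⟨r', h2.shift_succ, h3⟩

end Del

end MarkedGraph

/-! ### Link moves survive the deletion of components -/

namespace MarkedGraph

namespace Del

lemma transfers_zigzag : Transfers 1 [cup 0, cap 1] [] := by
  intro c l l' r hl h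
  rcases h with _ | ⟨h1, _ | ⟨h2, _ | _⟩⟩
  rcases h1 with ⟨_, x, _⟩
  rcases h2 with _ | _ | _ | ⟨_, h2⟩
  rcases h2 with _ | ⟨_, _, _⟩
  refine ⟨_, .nil _ _, ?_⟩
  cases x
  · simp
  · exact Or.inr (Or.inl (Or.inl (by simpa using PlanarMove.zigzag c)))

lemma transfers_zigzag_symm : Transfers 1 [] [cup 0, cap 1] := by
  intro c l l' r hl h
  cases h
  rcases l with _ | ⟨x, l⟩
  · simp at hl
  refine ⟨_, .cons (.localMax c x _) (.cons (.succ x (.localMin _ x l)) (.nil _ _)), ?_⟩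
  cases x
  · simp
  · exact Or.inr (Or.inr (Or.inl (by simpa using PlanarMove.zigzag c)))

lemma transfers_zigzag' : Transfers 1 [cup 1, cap 0] [] := by
  intro c l l' r hl h
  rcases h with _ | ⟨h1, _ | ⟨h2, _ | _⟩⟩
  rcases h1 with _ | _ | _ | ⟨_, h1⟩
  rcases h1 with ⟨_, x, _⟩
  rcases h2 with _ | ⟨_, _, _⟩
  rename_i x l
  refine ⟨_, .nil _ _, ?_⟩
  cases x
  · simp
  · exact Or.inr (Or.inl (Or.inl (by simpa using PlanarMove.zigzag' c)))

lemma transfers_zigzag'_symm : Transfers 1 [] [cup 1, cap 0] := by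
  intro c l l' r hl h
  cases h
  rcases l with _ | ⟨x, l⟩
  · simp at hl
  refine ⟨_, .cons (.succ x (.localMax _ x _)) (.cons (.localMin _ x _) (.nil _ _)), ?_⟩
  cases x
  · simp
  · exact Or.inr (Or.inr (Or.inl (by simpa using PlanarMove.zigzag' c)))

lemma transfers_turnMax (b : Bool) : Transfers 1 [cup 0, cross 1 b] [cup 1, cross 0 (!b)] := by
  intro c l l' r hl h
  rcases h with _ | ⟨h1, _ | ⟨h2, _ | _⟩⟩
  rcases h1 with ⟨_, x, _⟩
  rcases h2 with _ | _ | _ | ⟨_, h2⟩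
  rcases h2 with _ | _ | ⟨_, _, _, y, l⟩
  refine ⟨_, .cons (.succ y (.localMax _ x _)) (.cons (.crossing _ _ _ _ _) (.nil _ _)), ?_⟩
  cases x <;> cases y <;> simp
  exact Or.inl (Or.inl (PlanarMove.turnCrossMax c b))

lemma transfers_turnMax_symm (b : Bool) :
    Transfers 1 [cup 1, cross 0 (!b)] [cup 0, cross 1 b] := by
  intro c l l' r hl h
  rcases h with _ | ⟨h1, _ | ⟨h2, _ | _⟩⟩
  rcases h1 with _ | _ | _ | ⟨y, h1⟩
  rcases h1 with ⟨_, x, _⟩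
  rcases h2 with _ | _ | ⟨_, _, _, _, l⟩
  refine ⟨_, .cons (.localMax _ x _) (.cons (.succ _ (.crossing _ _ _ _ _)) (.nil _ _)), ?_⟩
  cases x <;> cases y <;> simp
  exact Or.inr (Or.inl (PlanarMove.turnCrossMax c b))

lemma transfers_turnMin (b : Bool) : Transfers 3 [cross 1 b, cap 0] [cross 0 (!b), cap 1] := by
  intro c l l' r hl h
  rcases h with _ | ⟨h1, _ | ⟨h2, _ | _⟩⟩
  rcases h1 with _ | _ | _ | ⟨x, h1⟩
  rcases h1 with _ | _ | ⟨_, _, y, z, l⟩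
  rcases h2 with _ | ⟨_, _, _⟩
  refine ⟨_, .cons (.crossing _ _ _ _ _) (.cons (.succ _ (.localMin _ x _)) (.nil _ _)), ?_⟩
  cases x <;> cases y <;> simp
  exact Or.inl (Or.inl (PlanarMove.turnCrossMin c b))

lemma transfers_turnMin_symm (b : Bool) :
    Transfers 3 [cross 0 (!b), cap 1] [cross 1 b, cap 0] := by
  intro c l l' r hl h
  rcases h with _ | ⟨h1, _ | ⟨h2, _ | _⟩⟩
  rcases h1 with _ | _ | ⟨_, _, x, y, l⟩
  rcases h2 with _ | _ | _ | ⟨_, h2⟩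
  rcases h2 with _ | ⟨_, _, _⟩
  refine ⟨_, .cons (.succ _ (.crossing _ _ _ _ _)) (.cons (.localMin _ x _) (.nil _ _)), ?_⟩
  cases x <;> cases y <;> simp
  exact Or.inr (Or.inl (PlanarMove.turnCrossMin c b))

lemma transfers_gamma1 (b : Bool) : Transfers 0 [cup 0, cross 0 b] [cup 0] := by
  intro c l l' r hl h
  rcases h with _ | ⟨h1, _ | ⟨h2, _ | _⟩⟩
  rcases h1 with ⟨_, x, _⟩
  rcases h2 with _ | _ | ⟨_, _, _, _, _⟩
  refine ⟨_, .cons (.localMax _ x _) (.nil _ _), ?_⟩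
  cases x <;> simp
  exact Or.inl (Or.inr (ReidemeisterMove.gamma1 c b))

lemma transfers_gamma1_symm (b : Bool) : Transfers 0 [cup 0] [cup 0, cross 0 b] := by
  intro c l l' r hl h
  rcases h with _ | ⟨h1, _ | _⟩
  rcases h1 with ⟨_, x, _⟩
  refine ⟨_, .cons (.localMax _ x _) (.cons (.crossing _ _ _ _ _) (.nil _ _)), ?_⟩
  cases x <;> simp
  exact Or.inr (Or.inr (ReidemeisterMove.gamma1 c b))

lemma transfers_gamma2 (b : Bool) : Transfers 2 [cross 0 b, cross 0 (!b)] [] := by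
  intro c l l' r hl h
  rcases h with _ | ⟨h1, _ | ⟨h2, _ | _⟩⟩
  rcases h1 with _ | _ | ⟨_, _, x, y, l⟩
  rcases h2 with _ | _ | ⟨_, _, _, _, _⟩
  refine ⟨_, .nil _ _, ?_⟩
  cases x <;> cases y <;> simp
  exact Or.inl (Or.inr (ReidemeisterMove.gamma2 c b))

lemma transfers_gamma2_symm (b : Bool) : Transfers 2 [] [cross 0 b, cross 0 (!b)] := by
  intro c l l' r hl h
  cases h
  rcases l with _ | ⟨x, _ | ⟨y, l⟩⟩
  any_goals simp at hl; done
  refine ⟨_, .cons (.crossing _ _ _ _ _) (.cons (.crossing _ _ _ _ _) (.nil _ _)), ?_⟩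
  cases x <;> cases y <;> simp
  exact Or.inr (Or.inr (ReidemeisterMove.gamma2 c b))

lemma transfers_gamma3 (b c d : Bool) (hb : b = d → c = b) :
    Transfers 3 [cross 0 b, cross 1 c, cross 0 d] [cross 1 d, cross 0 c, cross 1 b] := by
  intro k l l' r hl h
  rcases h with _ | ⟨h1, _ | ⟨h2, _ | ⟨h3, _ | _⟩⟩⟩
  rcases h1 with _ | _ | ⟨_, _, x, y, l⟩
  rcases h2 with _ | _ | _ | ⟨_, h2⟩
  rcases h2 with _ | _ | ⟨_, _, _, z, l⟩
  rcases h3 with _ | _ | ⟨_, _, _, _, _⟩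
  refine ⟨_, .cons (.succ _ (.crossing _ _ _ _ _)) (.cons (.crossing _ _ _ _ _)
    (.cons (.succ _ (.crossing _ _ _ _ _)) (.nil _ _))), ?_⟩
  cases x <;> cases y <;> cases z <;> simp
  exact Or.inl (Or.inr (ReidemeisterMove.gamma3 k b c d hb))

lemma transfers_gamma3_symm (b c d : Bool) (hb : b = d → c = b) :
    Transfers 3 [cross 1 d, cross 0 c, cross 1 b] [cross 0 b, cross 1 c, cross 0 d] := by
  intro k l l' r hl h
  rcases h with _ | ⟨h1, _ | ⟨h2, _ | ⟨h3, _ | _⟩⟩⟩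
  rcases h1 with _ | _ | _ | ⟨x, h1⟩
  rcases h1 with _ | _ | ⟨_, _, y, z, l⟩
  rcases h2 with _ | _ | ⟨_, _, _, _, _⟩
  rcases h3 with _ | _ | _ | ⟨_, h3⟩
  rcases h3 with _ | _ | ⟨_, _, _, _, _⟩
  refine ⟨_, .cons (.crossing _ _ _ _ _) (.cons (.succ _ (.crossing _ _ _ _ _))
    (.cons (.crossing _ _ _ _ _) (.nil _ _))), ?_⟩
  cases x <;> cases y <;> cases z <;> simp
  exact Or.inr (Or.inr (ReidemeisterMove.gamma3 k b c d hb))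

/-- The right event is deleted or kept in the same way at both heights. If both events survive, the
remaining words again differ by an interchange, with `j` kept strands between the events instead of
`k`; otherwise they coincide. -/
lemma transfers_interchange (p q : Event) (k : ℕ) :
    Transfers 0 [⟨0, p⟩, ⟨p.outputs + k, q⟩] [⟨p.inputs + k, q⟩, ⟨0, p⟩] := by
  intro c l l' r hl h
  rcases h with _ | ⟨h1, _ | ⟨h2, _ | _⟩⟩
  rcases h1 with ⟨_, x, _⟩ | ⟨_, x, _⟩ | ⟨_, b, x, y, _⟩
  · simp only [Event.outputs, Event.inputs, show 2 + k = k + 1 + 1 by omega, zero_add] at h2 ⊢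
    rcases h2 with _ | _ | _ | ⟨_, h2⟩
    rcases h2 with _ | _ | _ | ⟨_, h2⟩
    rcases h2.shape with ⟨rfl, h3, -⟩ | ⟨j, rfl, h3, -⟩
    · exact ⟨_, .cons (h3 c) (.cons (.localMax _ x _) (.nil _ _)), by simp⟩
    · refine ⟨_, .cons (h3 c) (.cons (.localMax _ x _) (.nil _ _)), ?_⟩
      cases x
      · simp
      · exact Or.inr (Or.inl (Or.inl (PlanarMove.interchange c j .localMax q)))
  · simp only [Event.outputs, Event.inputs, show 2 + k = k + 1 + 1 by omega, zero_add] at h2 ⊢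
    rcases h2.shape with ⟨rfl, h3, -⟩ | ⟨j, rfl, h3, -⟩
    · exact ⟨_, .cons (.succ _ (.succ _ (h3 _))) (.cons (.localMin _ x _) (.nil _ _)), by simp⟩
    · refine ⟨_, .cons (.succ _ (.succ _ (h3 _))) (.cons (.localMin _ x _) (.nil _ _)), ?_⟩
      cases x
      · simp
      · exact Or.inr (Or.inl (Or.inl (PlanarMove.interchange c j .localMin q)))
  · simp only [Event.outputs, Event.inputs, show 2 + k = k + 1 + 1 by omega] at h2 ⊢
    rcases h2 with _ | _ | _ | ⟨_, h2⟩
    rcases h2 with _ | _ | _ | ⟨_, h2⟩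
    rcases h2.shape with ⟨rfl, h3, -⟩ | ⟨j, rfl, h3, -⟩
    · exact ⟨_, .cons (.succ _ (.succ _ (h3 _))) (.cons (.crossing _ _ _ _ _) (.nil _ _)), by simp⟩
    · refine ⟨_, .cons (.succ _ (.succ _ (h3 _))) (.cons (.crossing _ _ _ _ _) (.nil _ _)), ?_⟩
      cases x <;> cases y <;> simp
      exact Or.inr (Or.inl (Or.inl (PlanarMove.interchange c j (.crossing b) q)))

lemma transfers_interchange_symm (p q : Event) (k : ℕ) :
    Transfers 0 [⟨p.inputs + k, q⟩, ⟨0, p⟩] [⟨0, p⟩, ⟨p.outputs + k, q⟩] := by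
  intro c l l' r hl h
  rcases h with _ | ⟨h2, _ | ⟨h1, _ | _⟩⟩
  rcases p with _ | _ | b | _
  · rcases h1 with ⟨_, x, _⟩
    simp only [Event.outputs, Event.inputs, show 2 + k = k + 1 + 1 by omega, zero_add] at h2 ⊢
    rcases h2.shape with ⟨rfl, h3, -⟩ | ⟨j, rfl, h3, -⟩
    · exact ⟨_, .cons (.localMax _ x _) (.cons (.succ _ (.succ _ (h3 _))) (.nil _ _)), by simp⟩
    · refine ⟨_, .cons (.localMax _ x _) (.cons (.succ _ (.succ _ (h3 _))) (.nil _ _)), ?_⟩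
      cases x
      · simp
      · exact Or.inr (Or.inr (Or.inl (PlanarMove.interchange c j .localMax q)))
  · simp only [Event.outputs, Event.inputs, show 2 + k = k + 1 + 1 by omega, zero_add] at h2 ⊢
    rcases h2 with _ | _ | _ | ⟨_, h2⟩
    rcases h2 with _ | _ | _ | ⟨_, h2⟩
    rcases h1 with _ | ⟨_, x, _⟩
    rcases h2.shape with ⟨rfl, h3, -⟩ | ⟨j, rfl, h3, -⟩
    · exact ⟨_, .cons (.localMin _ _ _) (.cons (h3 c) (.nil _ _)), by simp⟩
    · refine ⟨_, .cons (.localMin _ _ _) (.cons (h3 c) (.nil _ _)), ?_⟩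
      rename_i x _
      cases x
      · simp
      · exact Or.inr (Or.inr (Or.inl (PlanarMove.interchange c j .localMin q)))
  · simp only [Event.outputs, Event.inputs, show 2 + k = k + 1 + 1 by omega] at h2 ⊢
    rcases h2 with _ | _ | _ | ⟨x, h2⟩
    rcases h2 with _ | _ | _ | ⟨y, h2⟩
    rcases h1 with _ | _ | ⟨_, _, _, _, _⟩
    rcases h2.shape with ⟨rfl, h3, -⟩ | ⟨j, rfl, h3, -⟩
    · exact ⟨_, .cons (.crossing _ _ _ _ _) (.cons (.succ _ (.succ _ (h3 _))) (.nil _ _)), by simp⟩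
    · refine ⟨_, .cons (.crossing _ _ _ _ _) (.cons (.succ _ (.succ _ (h3 _))) (.nil _ _)), ?_⟩
      cases x <;> cases y <;> simp
      exact Or.inr (Or.inr (Or.inl (PlanarMove.interchange c j (.crossing b) q)))
  · rcases h1

lemma transfers_of_eq {s t : List Piece} (i k : ℕ) {s' t' : List Piece} (hs : s = shift i s')
    (ht : t = shift i t') (h : Transfers k s' t') (h' : Transfers k t' s') :
    Transfers (i + k) s t ∧ Transfers (i + k) t s := by
  subst hs ht
  exact ⟨h.shift i, h'.shift i⟩

lemma transfers_of_not {k : ℕ} {s t : List Piece} (h : ∀ c l l' r, ¬ Del c l s l' r) :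
    Transfers k s t := fun c l l' r _ h' => absurd h' (h c l l' r)

/-- Deletion is not defined at marked vertices, so the moves that turn a vertex transfer vacuously.
-/
lemma not_marked {w : List Piece} (hw : ∃ p ∈ w, ∃ b, p.event = .marked b) (c l l' r) :
    ¬ Del c l w l' r := by
  intro h
  obtain ⟨p, hp, b, hb⟩ := hw
  have key : ∀ {c l i e l' r}, DelStep c l i e l' r → ∀ b, e ≠ .marked b := by
    intro c l i e l' r h
    induction h <;> simp_all
  induction h with
  | nil => simp at hp
  | cons h1 _ ih =>
    rcases List.mem_cons.1 hp with rfl | hp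
    · exact key h1 b hb
    · exact ih hp

/-- All moves are shifted to position `0`, where the flags of the at most three strands involved are
run through. The move survives if all the strands it needs are kept, and otherwise the two
remainders agree. -/
lemma transfers_of_linkMove {s t : List Piece} (h : LinkMove s t) {n m : ℕ}
    (hs : strands s n = some m) (ht : strands t n = some m) : Transfers n s t ∧ Transfers n t s := by
  have key : ∀ (i k : ℕ) (s' t' : List Piece), s = shift i s' → t = shift i t' → i + k ≤ n →
      Transfers k s' t' → Transfers k t' s' → Transfers n s t ∧ Transfers n t s := by
    intro i k s' t' h1 h2 h3 h4 h5
    obtain ⟨h6, h7⟩ := transfers_of_eq i k h1 h2 h4 h5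
    exact ⟨fun c l l' r hl => h6 c l l' r (h3.trans hl), fun c l l' r hl => h7 c l l' r (h3.trans hl)⟩
  rcases h with (⟨i, k, p, q⟩ | ⟨i⟩ | ⟨i⟩ | ⟨i, b⟩ | ⟨i, b⟩ | ⟨i, b⟩ | ⟨i, b⟩) |
    (⟨i, b⟩ | ⟨i, b⟩ | ⟨i, b, c, d, h⟩)
  · have := le_of_strands_cons (Option.isSome_iff_exists.2 ⟨m, hs⟩)
    exact key i 0 [⟨0, p⟩, ⟨p.outputs + k, q⟩] [⟨p.inputs + k, q⟩, ⟨0, p⟩]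
      (by simp [shift, add_assoc]) (by simp [shift, add_assoc]) (by omega)
      (transfers_interchange p q k) (transfers_interchange_symm p q k)
  · have := le_of_strands_cons_cons (Option.isSome_iff_exists.2 ⟨m, hs⟩)
    simp only [Event.inputs, Event.outputs] at this
    exact key i 1 [cup 0, cap 1] [] (by simp [shift]) (by simp [shift]) (by omega)
      transfers_zigzag transfers_zigzag_symm
  · have := le_of_strands_cons_cons (Option.isSome_iff_exists.2 ⟨m, hs⟩)
    simp only [Event.inputs, Event.outputs] at this
    exact key i 1 [cup 1, cap 0] [] (by simp [shift]) (by simp [shift]) (by omega)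
      transfers_zigzag' transfers_zigzag'_symm
  · have := le_of_strands_cons_cons (Option.isSome_iff_exists.2 ⟨m, hs⟩)
    simp only [Event.inputs, Event.outputs] at this
    exact key i 1 [cup 0, cross 1 b] [cup 1, cross 0 (!b)] (by simp [shift]) (by simp [shift])
      (by omega) (transfers_turnMax b) (transfers_turnMax_symm b)
  · have := le_of_strands_cons_cons (Option.isSome_iff_exists.2 ⟨m, hs⟩)
    simp only [Event.inputs, Event.outputs] at this
    exact key i 3 [cross 1 b, cap 0] [cross 0 (!b), cap 1] (by simp [shift]) (by simp [shift])
      (by omega) (transfers_turnMin b) (transfers_turnMin_symm b)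
  · exact ⟨transfers_of_not (not_marked ⟨vert (i + 1) b, by simp⟩),
      transfers_of_not (not_marked ⟨vert i (!b), by simp⟩)⟩
  · exact ⟨transfers_of_not (not_marked ⟨vert (i + 1) b, by simp⟩),
      transfers_of_not (not_marked ⟨vert i (!b), by simp⟩)⟩
  · have := le_of_strands_cons (Option.isSome_iff_exists.2 ⟨m, hs⟩)
    exact key i 0 [cup 0, cross 0 b] [cup 0] (by simp [shift]) (by simp [shift]) (by omega)
      (transfers_gamma1 b) (transfers_gamma1_symm b)
  · have := le_of_strands_cons (Option.isSome_iff_exists.2 ⟨m, hs⟩)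
    exact key i 2 [cross 0 b, cross 0 (!b)] [] (by simp [shift]) (by simp [shift]) this
      (transfers_gamma2 b) (transfers_gamma2_symm b)
  · have := le_of_strands_cons_cons (Option.isSome_iff_exists.2 ⟨m, hs⟩)
    simp only [Event.inputs, Event.outputs] at this
    exact key i 3 [cross 0 b, cross 1 c, cross 0 d] [cross 1 d, cross 0 c, cross 1 b]
      (by simp [shift]) (by simp [shift]) (by omega) (transfers_gamma3 b c d h)
      (transfers_gamma3_symm b c d h)

/-- The diagram which remains after deleting components. -/
lemma linkEquiv_of_linkEquiv {D D' : Diagram} (h : LinkEquiv D D') :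
    (∀ E : Diagram, Del 0 [] D.word [] E.word →
      ∃ E' : Diagram, Del 0 [] D'.word [] E'.word ∧ LinkEquiv E E') ∧
    (∀ E : Diagram, Del 0 [] D'.word [] E.word →
      ∃ E' : Diagram, Del 0 [] D.word [] E'.word ∧ LinkEquiv E E') := by
  have closed : ∀ {w r}, Del 0 [] w [] r → strands r 0 = some 0 := fun h => by
    simpa using h.strands_eq
  -- The deletion splits along `u ++ s ++ v`. The flags at the two cuts stay fixed while the middle
  -- part is exchanged, so the deletions in `u` and `v` can be reused unchanged.
  have key : ∀ {u s t v : List Piece} {r : List Piece} (hr : strands r 0 = some 0),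
      (∀ n m, strands s n = some m → strands u 0 = some n → Transfers n s t) →
      Del 0 [] (u ++ s ++ v) [] r →
      ∃ E' : Diagram, Del 0 [] (u ++ t ++ v) [] E'.word ∧ LinkEquiv ⟨r, hr⟩ E' := by
    intro u s t v r hr hst h
    obtain ⟨l₁, r₁, r₂, h1, h2, rfl⟩ := h.exists_of_append
    obtain ⟨l₂, r₃, r₄, h3, h4, rfl⟩ := h1.exists_of_append
    obtain ⟨r₅, h5, h6⟩ := hst l₂.length l₁.length h4.length h3.length 0 _ _ _ le_rfl h4
    have h7 := (h3.append h5).append h2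
    refine ⟨⟨_, closed h7⟩, h7, ?_⟩
    rcases h6 with rfl | h6 | h6
    · exact .refl _
    · exact .rel _ _ ⟨r₃, r₂, r₄, r₅, h6, rfl, rfl⟩
    · exact .symm _ _ (.rel _ _ ⟨r₃, r₂, r₅, r₄, h6, rfl, rfl⟩)
  induction h with
  | rel D D' h =>
    obtain ⟨u, v, s, t, hst, h1, h2⟩ := h
    have tr : ∀ n, strands u 0 = some n → Transfers n s t ∧ Transfers n t s := by
      intro n hn
      have c1 := D.closed
      have c2 := D'.closed
      rw [h1, List.append_assoc, strands_append, hn, Option.bind_some, strands_append] at c1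
      rw [h2, List.append_assoc, strands_append, hn, Option.bind_some, strands_append] at c2
      obtain ⟨m, hm, -⟩ := Option.bind_eq_some_iff.1 c1
      obtain ⟨m', hm', -⟩ := Option.bind_eq_some_iff.1 c2
      obtain rfl := strands_eq_of_move (link := false) (Or.inl hst) hm hm'
      exact transfers_of_linkMove hst hm hm'
    rw [h1, h2]
    exact ⟨fun E hE => key E.closed (fun n m _ hn => (tr n hn).1) hE,
      fun E hE => key E.closed (fun n m _ hn => (tr n hn).2) hE⟩
  | refl D => exact ⟨fun E h => ⟨E, h, .refl _⟩, fun E h => ⟨E, h, .refl _⟩⟩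
  | symm D D' _ ih => exact ⟨ih.2, ih.1⟩
  | trans D D' D'' _ _ ih ih' =>
    constructor
    · intro E hE
      obtain ⟨E', h1, h2⟩ := ih.1 E hE
      obtain ⟨E'', h3, h4⟩ := ih'.1 E' h1
      exact ⟨E'', h3, .trans _ _ _ h2 h4⟩
    · intro E hE
      obtain ⟨E', h1, h2⟩ := ih'.2 E hE
      obtain ⟨E'', h3, h4⟩ := ih.2 E' h1
      exact ⟨E'', h3, .trans _ _ _ h2 h4⟩

lemma countP_le {c : ℕ} {l l' : List Bool} {w r : List Piece} (h : Del c l w l' r) :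
    r.countP Piece.isNode ≤ w.countP Piece.isNode := by
  induction h with
  | nil => exact le_rfl
  | @cons _ i e w _ _ r r' h1 _ ih =>
    rw [List.countP_append, List.countP_cons]
    have : ∀ j, (Piece.mk j e).isNode = (Piece.mk i e).isNode := fun j => rfl
    rcases h1.shape with ⟨rfl, -⟩ | ⟨k, rfl, -⟩
    · simp
      omega
    · rw [List.countP_singleton, this]
      omega

/-- Deletion never creates crossings, so the deletion carried to a crossingless diagram is again
crossingless. Thus every sublink of a trivial link is trivial. -/
lemma isTrivialLink {D E : Diagram} (h : D.IsTrivialLink) (hE : Del 0 [] D.word [] E.word) :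
    E.IsTrivialLink := by
  obtain ⟨D', h1, h2⟩ := h
  obtain ⟨E', h3, h4⟩ := (linkEquiv_of_linkEquiv h1).1 E hE
  exact ⟨E', h4, Nat.le_zero.1 (h3.countP_le.trans h2.le)⟩

end Del

end MarkedGraph

namespace MarkedGraph

open SymPiece

/-! ### Interchanging words and circles -/

namespace WordEquiv

variable {link : Bool} {n : ℕ}

lemma of_move_of_isSome {s t : List Piece} (h : Move link s t) (hs : (strands s n).isSome)
    (ht : (strands t n).isSome) : WordEquiv link n s t := by
  obtain ⟨m, hm⟩ := Option.isSome_iff_exists.1 hs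
  obtain ⟨m', hm'⟩ := Option.isSome_iff_exists.1 ht
  exact of_move h hm (strands_eq_of_move h hm hm' ▸ hm')

lemma of_eq {s t : List Piece} {m : ℕ} (h : s = t) (hs : strands s n = some m) :
    WordEquiv link n s t := h ▸ refl hs

lemma isSome_iff {s t : List Piece} (h : WordEquiv link n s t) :
    (strands s n).isSome ↔ (strands t n).isSome := by rw [h.strands_eq]

lemma swap {i j : ℕ} {p q : Event} (h : i + p.outputs ≤ j)
    (hs : (strands [⟨i, p⟩, ⟨j, q⟩] n).isSome) :
    WordEquiv link n [⟨i, p⟩, ⟨j, q⟩] [⟨j - p.outputs + p.inputs, q⟩, ⟨i, p⟩] := by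
  refine of_move_of_isSome (Move.swap p q h) hs ?_
  simp only [strands, Piece.strands] at hs ⊢
  split_ifs at hs with h1
  · simp only [Option.bind_some] at hs
    split_ifs at hs with h2
    · rw [if_pos (by omega), Option.bind_some, if_pos (by omega)]
      rfl
    · simp at hs
  · simp at hs

lemma interchange_piece {P : List Piece} {i o j : ℕ} {q : Event} (hP : strands P i = some o)
    (hj : o ≤ j) (h : (strands (P ++ [⟨j, q⟩]) n).isSome) :
    WordEquiv link n (P ++ [⟨j, q⟩]) (⟨j - o + i, q⟩ :: P) := by
  induction P generalizing i n with
  | nil =>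
    obtain rfl : i = o := by simpa [strands] using hP
    obtain ⟨m, hm⟩ := Option.isSome_iff_exists.1 h
    rw [Nat.sub_add_cancel hj]
    exact refl hm
  | cons p P ih =>
    obtain ⟨i₁, h1, h2⟩ := Option.bind_eq_some_iff.1 hP
    obtain ⟨m, hm⟩ := Option.isSome_iff_exists.1 h
    obtain ⟨n₁, h3, h4⟩ := Option.bind_eq_some_iff.1 hm
    have e1 := (ih h2 (n := n₁) (Option.isSome_iff_exists.2 ⟨m, h4⟩)).append_left (a := [p]) (n := n)
      (by simp [strands, h3])
    simp only [Piece.strands] at h1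
    split_ifs at h1 with h5
    simp only [Option.some.injEq] at h1
    have h6 : (strands ([p, ⟨j - o + i₁, q⟩] ++ P) n).isSome := by
      have := e1.strands_eq
      simp only [List.cons_append, List.nil_append] at this ⊢
      rw [← this]
      exact h
    have e2 : WordEquiv link n [p, ⟨j - o + i₁, q⟩] [⟨j - o + i₁ - p.event.outputs +
        p.event.inputs, q⟩, p] := by
      obtain ⟨k, hk⟩ := Option.isSome_iff_exists.1 h6
      rw [strands_append] at hk
      obtain ⟨k', hk', -⟩ := Option.bind_eq_some_iff.1 hk
      exact swap (by omega) (by rw [hk']; rfl)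
    have e3 := e1.trans (e2.append_right (b := P) h6)
    rwa [show j - o + i₁ - p.event.outputs + p.event.inputs = j - o + i by omega] at e3

/-- Needed because splicing replaces one event by up to two: interchanging two events of a marked
graph diagram becomes interchanging two words in its resolution. -/
lemma interchange_words {P : List Piece} {i o : ℕ} (hP : strands P i = some o) (k : ℕ)
    (Q : List Piece) (h : (strands (P ++ shift (o + k) Q) n).isSome) :
    WordEquiv link n (P ++ shift (o + k) Q) (shift (i + k) Q ++ P) := by
  induction Q generalizing n with
  | nil =>
    obtain ⟨m, hm⟩ := Option.isSome_iff_exists.1 h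
    simp only [shift, List.map_nil, List.append_nil, List.nil_append] at hm ⊢
    exact refl hm
  | cons q Q ih =>
    have e : P ++ shift (o + k) (q :: Q) = (P ++ [⟨o + k + q.pos, q.event⟩]) ++ shift (o + k) Q := by
      simp [shift]
    rw [e] at h ⊢
    have h1 : (strands (P ++ [⟨o + k + q.pos, q.event⟩]) n).isSome := by
      rw [strands_append] at h
      obtain ⟨m, hm⟩ := Option.isSome_iff_exists.1 h
      obtain ⟨k', hk', -⟩ := Option.bind_eq_some_iff.1 hm
      rw [hk']
      rfl
    have e1 := (interchange_piece (link := link) hP (by omega) h1).append_right h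
    rw [show o + k + q.pos - o + i = i + k + q.pos by omega] at e1
    refine e1.trans ?_
    have h2 := e1.isSome_iff.1 h
    obtain ⟨m, hm⟩ := Option.isSome_iff_exists.1 h2
    obtain ⟨n₁, h3, h4⟩ := Option.bind_eq_some_iff.1 hm
    exact (ih (n := n₁) (Option.isSome_iff_exists.2 ⟨m, h4⟩)).append_left (a := [⟨i + k + q.pos, q.event⟩])
      (by simp [strands, h3])

end WordEquiv

/-- The diagram of `k` circles beside each other. -/
def circles : ℕ → List Piece
  | 0 => []
  | k + 1 => cup 0 :: cap 0 :: circles k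

lemma circles_add (k l : ℕ) : circles (k + l) = circles k ++ circles l := by
  induction k with
  | zero => simp [circles]
  | succ k ih => rw [Nat.succ_add]; simp [circles, ih]

lemma strands_circles (k n : ℕ) : strands (circles k) n = some n := by
  induction k with
  | zero => rfl
  | succ k ih => simpa [circles, strands, Piece.strands, Event.inputs, Event.outputs] using ih

lemma shift_zero (w : List Piece) : shift 0 w = w := by simp [shift]

lemma circles_comm {link : Bool} {n : ℕ} (k : ℕ) (w : List Piece) (h : (strands w n).isSome) :
    WordEquiv link n (circles k ++ w) (w ++ circles k) := by
  have := WordEquiv.interchange_words (link := link) (n := n) (strands_circles k 0) 0 w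
    (by simpa [strands_append, strands_circles, shift_zero] using h)
  simpa [shift_zero] using this

/-- The circle passes the strand on its left: `Γ₂` creates two crossings, turning them at the
maximum and at the minimum puts the circle on the other side, and `Γ₂` removes them. -/
lemma circle_left {link : Bool} {i n : ℕ} (h : i ≤ n) :
    WordEquiv link n [cup i, cap i] (circles 1) := by
  induction i with
  | zero => exact WordEquiv.refl (strands_circles 1 n)
  | succ i ih =>
    refine WordEquiv.trans ?_ (ih (by omega))
    have h1 : Connects true 1 [.mx 1, .mn 1] [.mx 0, .mn 0]
      [(1, .r2Ins 0 0 false), (0, .turn), (2, .turn), (1, .r2)] [] = true := by decide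
    have := (Connects.wordEquiv h1 i (n - i - 1) (fun _ => false) fun _ => (false, false)).mono
      (link := link)
    rwa [show i + 1 + (n - i - 1) = n by omega] at this

/-! ### Resolutions of equivalent diagrams -/

/-- The resolution of a word. -/
def resolve (s : Bool) (w : List Piece) : List Piece := w.flatMap (Piece.splice s)

lemma resolve_append (s : Bool) (u v : List Piece) :
    resolve s (u ++ v) = resolve s u ++ resolve s v := List.flatMap_append

lemma strands_resolve {s : Bool} {w : List Piece} {n m : ℕ} (h : strands w n = some m) :
    strands (resolve s w) n = some m := strands_flatMap_splice s w n m h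

lemma Connects.wordEquiv_of_le {link : Bool} {k : ℕ} {s t : List SymPiece} {a b : List (ℕ × Rule)}
    (h : Connects link k s t a b = true) (β : ℕ → Bool) {i n : ℕ} (hn : i + k ≤ n) :
    WordEquiv link n (evalWord i β (fun _ => (false, false)) s)
      (evalWord i β (fun _ => (false, false)) t) := by
  have := Connects.wordEquiv h i (n - i - k) β (fun _ => (false, false))
  rwa [show i + k + (n - i - k) = n by omega] at this

lemma resolve_splice_shift (s : Bool) (k : ℕ) (q : Event) :
    Piece.splice s ⟨k, q⟩ = shift k (Piece.splice s ⟨0, q⟩) := by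
  rcases q with _ | _ | _ | b
  · simp [Piece.splice, shift]
  · simp [Piece.splice, shift]
  · simp [Piece.splice, shift]
  · by_cases h : b = s <;> simp [Piece.splice, shift, h]

/-- Turning a vertex becomes a zigzag after splicing. An interchange becomes an interchange of
words, and the remaining moves involve no vertex. -/
lemma resolve_of_planarMove {s t : List Piece} (h : PlanarMove s t) (b : Bool) {n m : ℕ}
    (hs : strands s n = some m) (ht : strands t n = some m) :
    WordEquiv true n (resolve b s) (resolve b t) := by
  have hs' := strands_resolve (s := b) hs
  have ht' := strands_resolve (s := b) ht
  rcases h with ⟨i, k, p, q⟩ | ⟨i⟩ | ⟨i⟩ | ⟨i, c⟩ | ⟨i, c⟩ | ⟨i, c⟩ | ⟨i, c⟩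
  · have hP : strands (Piece.splice b ⟨i, p⟩) (i + p.inputs) = some (i + p.outputs) :=
      strands_splice b _ _ _ (by simp [Piece.strands])
    simp only [resolve, List.flatMap_cons, List.flatMap_nil, List.append_nil] at hs' ⊢
    rw [resolve_splice_shift b (i + p.outputs + k)] at hs' ⊢
    rw [resolve_splice_shift b (i + p.inputs + k)]
    exact WordEquiv.interchange_words hP k _ (by rw [hs']; rfl)
  · exact WordEquiv.of_move (Or.inl (Or.inl (.zigzag i))) hs' ht'
  · exact WordEquiv.of_move (Or.inl (Or.inl (.zigzag' i))) hs' ht'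
  · exact WordEquiv.of_move (Or.inl (Or.inl (.turnCrossMax i c))) hs' ht'
  · exact WordEquiv.of_move (Or.inl (Or.inl (.turnCrossMin i c))) hs' ht'
  · have h := le_of_strands_cons_cons (Option.isSome_iff_exists.2 ⟨m, hs⟩)
    simp only [Event.inputs, Event.outputs] at h
    have h1 : Connects true 1 [.mx 0] [.mx 1, .mn 0, .mx 0] [] [(0, .zig)] = true := by decide
    have h2 : Connects true 1 [.mx 0, .mn 1, .mx 1] [.mx 1] [(0, .zig)] [] = true := by decide
    by_cases hc : c = b
    · simpa [resolve, Piece.splice, hc, evalWord, SymEvent.eval_mx, SymEvent.eval_mn] using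
        Connects.wordEquiv_of_le h1 (fun _ => false) (i := i) (n := n) (by omega)
    · obtain rfl := Bool.eq_not_of_ne (Ne.symm hc)
      simpa [resolve, Piece.splice, evalWord, SymEvent.eval_mx, SymEvent.eval_mn] using
        Connects.wordEquiv_of_le h2 (fun _ => false) (i := i) (n := n) (by omega)
  · have h := le_of_strands_cons_cons (Option.isSome_iff_exists.2 ⟨m, hs⟩)
    simp only [Event.inputs, Event.outputs] at h
    have h1 : Connects true 3 [.mn 0] [.mn 0, .mx 0, .mn 1] [] [(1, .zig)] = true := by decide
    have h2 : Connects true 3 [.mn 1, .mx 1, .mn 0] [.mn 1] [(1, .zig)] [] = true := by decide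
    by_cases hc : c = b
    · simpa [resolve, Piece.splice, hc, evalWord, SymEvent.eval_mx, SymEvent.eval_mn] using
        Connects.wordEquiv_of_le h1 (fun _ => false) (i := i) (n := n) (by omega)
    · obtain rfl := Bool.eq_not_of_ne (Ne.symm hc)
      simpa [resolve, Piece.splice, evalWord, SymEvent.eval_mx, SymEvent.eval_mn] using
        Connects.wordEquiv_of_le h2 (fun _ => false) (i := i) (n := n) (by omega)

/-- Splicing turns `Γ₄` and `Γ₈` into moves generated by `Γ₂` and turns, and `Γ₅` into kink
removals. In `Γ₇` exactly one of the two vertices leaves a trace, so both sides become equal. Only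
`Γ₆` can change the link, by a separate circle; this is the second alternative. -/
lemma resolve_of_markedVertexMove {s t : List Piece} (h : MarkedVertexMove s t) (b : Bool)
    {n m : ℕ} (hs : strands s n = some m) (ht : strands t n = some m) :
    WordEquiv true n (resolve b s) (resolve b t) ∨ ∃ i, i ≤ n ∧
      resolve b s = [cup i, cap i, cup i] ∧ resolve b t = [cup i] := by
  have hs' := strands_resolve (s := b) hs
  rcases h with ⟨i, d, c⟩ | ⟨i, d, c⟩ | ⟨i, c⟩ | ⟨i, c⟩ | ⟨i, d, c⟩
  · left
    have h := le_of_strands_cons (Option.isSome_iff_exists.2 ⟨m, ht⟩)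
    simp only [Event.inputs] at h
    have h1 : Connects true 3 [.cr 0 0 false, .cr 1 0 false, .mn 0, .mx 0]
      [.mn 1, .mx 1, .cr 0 0 false, .cr 1 0 false] [(1, .turn), (0, .r2)]
      [(1, .turn), (2, .r2)] = true := by decide
    by_cases hc : c = b
    · exact WordEquiv.of_eq (by simp [resolve, Piece.splice, hc]) hs'
    · simpa [resolve, Piece.splice, hc, evalWord, SymEvent.eval] using
        Connects.wordEquiv_of_le h1 (fun _ => d) (i := i) (n := n) (by omega)
  · left
    have h := le_of_strands_cons (Option.isSome_iff_exists.2 ⟨m, hs⟩)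
    simp only [Event.inputs] at h
    have h1 : Connects true 2 [.cr 0 0 false, .mn 0, .mx 0] [.mn 0, .mx 0, .cr 0 0 false]
      [(0, .zigIns 0 false), (1, .swapR), (0, .turn), (2, .swapR), (1, .turn), (0, .r1), (0, .zig)]
      [(1, .r1)] = true := by decide
    by_cases hc : c = b
    · exact WordEquiv.of_eq (by simp [resolve, Piece.splice, hc]) hs'
    · simpa [resolve, Piece.splice, hc, evalWord, SymEvent.eval] using
        Connects.wordEquiv_of_le h1 (fun _ => d) (i := i) (n := n) (by omega)
  · by_cases hc : c = b
    · left
      exact WordEquiv.of_eq (by simp [resolve, Piece.splice, hc]) hs'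
    · have h := le_of_strands_cons (Option.isSome_iff_exists.2 ⟨m, hs⟩)
      exact Or.inr ⟨i, by simpa [Event.inputs] using h, by simp [resolve, Piece.splice, hc],
        by simp [resolve, Piece.splice]⟩
  · left
    by_cases hc : c = b
    · exact WordEquiv.of_eq (by simp [resolve, Piece.splice, hc]) hs'
    · obtain rfl := Bool.eq_not_of_ne (Ne.symm hc)
      exact WordEquiv.of_eq (by cases c <;> simp [resolve, Piece.splice]) hs'
  · left
    have h : i + 2 + 2 ≤ n := by
      have := (le_of_strands_cons_cons (Option.isSome_iff_exists.2 ⟨m, hs⟩)).2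
      simp only [Event.inputs, Event.outputs] at this
      have := (le_of_strands_cons_cons (Option.isSome_iff_exists.2 ⟨m, hs⟩)).1
      simp only [Event.inputs] at this
      omega
    have h1 : Connects true 4 [.mn 2, .mx 2, .cr 1 0 true, .cr 0 0 true, .cr 2 0 true, .cr 1 0 true]
      [.cr 1 0 false, .cr 0 0 false, .cr 2 0 false, .cr 1 0 false, .mn 0, .mx 0]
      [(1, .turn), (2, .swapL), (3, .r2), (1, .turn), (2, .r2)]
      [(3, .turn), (2, .swapL), (1, .r2), (1, .turn), (0, .r2)] = true := by decide
    have h2 : Connects true 4 [.mn 0, .mx 0, .cr 1 0 true, .cr 0 0 true, .cr 2 0 true, .cr 1 0 true]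
      [.cr 1 0 false, .cr 0 0 false, .cr 2 0 false, .cr 1 0 false, .mn 2, .mx 2]
      [(1, .turn), (2, .r2), (1, .turn), (2, .r2)]
      [(3, .turn), (2, .r2), (1, .turn), (0, .r2)] = true := by decide
    by_cases hc : c = b
    · simpa [resolve, Piece.splice, hc, evalWord, SymEvent.eval, doubleCross] using
        Connects.wordEquiv_of_le h1 (fun _ => d) (i := i) (n := n) (by omega)
    · obtain rfl := Bool.eq_not_of_ne (Ne.symm hc)
      simpa [resolve, Piece.splice, evalWord, SymEvent.eval, doubleCross] using
        Connects.wordEquiv_of_le h2 (fun _ => d) (i := i) (n := n) (by omega)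

lemma isTrivialLink_congr {D D' : Diagram} (h : LinkEquiv D D') :
    D.IsTrivialLink ↔ D'.IsTrivialLink :=
  ⟨fun ⟨E, h1, h2⟩ => ⟨E, .trans _ _ _ (.symm _ _ h) h1, h2⟩,
    fun ⟨E, h1, h2⟩ => ⟨E, .trans _ _ _ h h1, h2⟩⟩

lemma linkEquiv_circle {D D' : Diagram} (h : LinkEquiv D D') :
    ∀ (hD : strands (cup 0 :: cap 0 :: D.word) 0 = some 0)
      (hD' : strands (cup 0 :: cap 0 :: D'.word) 0 = some 0),
      LinkEquiv ⟨_, hD⟩ ⟨_, hD'⟩ := by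
  have closed : ∀ D : Diagram, strands (cup 0 :: cap 0 :: D.word) 0 = some 0 := fun D => by
    simpa [strands, Piece.strands, Event.inputs, Event.outputs] using D.closed
  induction h with
  | rel D D' h =>
    obtain ⟨u, v, s, t, hst, h1, h2⟩ := h
    exact fun _ _ => .rel _ _ ⟨cup 0 :: cap 0 :: u, v, s, t, hst, by simp [h1], by simp [h2]⟩
  | refl D => exact fun _ _ => .refl _
  | symm D D' _ ih => exact fun h h' => .symm _ _ (ih h' h)
  | trans D D' D'' _ _ ih ih' =>
    exact fun h h' => .trans _ _ _ (ih h (closed D')) (ih' (closed D') h')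

lemma isTrivialLink_circle {D : Diagram} (h : D.IsTrivialLink)
    (hD : strands (cup 0 :: cap 0 :: D.word) 0 = some 0) :
    (Diagram.mk _ hD).IsTrivialLink := by
  obtain ⟨E, h1, h2⟩ := h
  have hE : strands (cup 0 :: cap 0 :: E.word) 0 = some 0 := by
    simpa [strands, Piece.strands, Event.inputs, Event.outputs] using E.closed
  refine ⟨⟨_, hE⟩, linkEquiv_circle h1 hD hE, ?_⟩
  simpa [Diagram.chIndex, Piece.isNode] using h2

/-! ### Removing circles and invariance of admissibility -/

lemma DelStep.self {n m i : ℕ} {e : Event} (he : ∀ b, e ≠ .marked b)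
    (h : (Piece.mk i e).strands n = some m) (c : ℕ) :
    DelStep c (List.replicate n true) i e (List.replicate m true) [⟨c + i, e⟩] := by
  simp only [Piece.strands] at h
  split_ifs at h with h1
  simp only [Option.some.injEq] at h
  obtain ⟨k, rfl⟩ := Nat.exists_eq_add_of_le h1
  obtain rfl : m = i + (e.outputs + k) := by omega
  clear h h1
  induction i generalizing c with
  | zero =>
    rcases e with _ | _ | b | b
    · simpa [Event.inputs, Event.outputs, Nat.add_comm _ k, List.replicate_succ] using
        DelStep.localMax c true (List.replicate k true)
    · simpa [Event.inputs, Event.outputs, Nat.add_comm _ k, List.replicate_succ] using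
        DelStep.localMin c true (List.replicate k true)
    · simpa [Event.inputs, Event.outputs, Nat.add_comm _ k, List.replicate_succ] using
        DelStep.crossing c b true true (List.replicate k true)
    · exact absurd rfl (he b)
  | succ i ih =>
    have := DelStep.succ true (ih (c + 1))
    simp only [← List.replicate_succ] at this
    convert this using 2 <;> first | omega | (congr 1; omega)

lemma Del.self {n m : ℕ} {w : List Piece} (hw : ∀ p ∈ w, ∀ b, p.event ≠ .marked b)
    (h : strands w n = some m) :
    Del 0 (List.replicate n true) w (List.replicate m true) w := by
  induction w generalizing n with
  | nil =>
    obtain rfl : n = m := by simpa [strands] using h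
    exact .nil _ _
  | cons p w ih =>
    obtain ⟨k, h1, h2⟩ := Option.bind_eq_some_iff.1 h
    obtain ⟨h3, h4⟩ := List.forall_mem_cons.1 hw
    have := Del.cons (DelStep.self h3 h1 0) (ih h4 h2)
    simpa using this

/-- All strands are kept except the two of the circle, which close up with each other at once. -/
lemma Del.circle {i n : ℕ} (h : i ≤ n) (c : ℕ) :
    ∃ l, DelStep c (List.replicate n true) i .localMax l [] ∧
      DelStep c l i .localMin (List.replicate n true) [] := by
  induction i generalizing n c with
  | zero => exact ⟨_, DelStep.localMax c false _, DelStep.localMin c false _⟩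
  | succ i ih =>
    obtain ⟨n, rfl⟩ := Nat.exists_eq_add_of_le' (Nat.lt_of_lt_of_le i.succ_pos h)
    obtain ⟨l, h1, h2⟩ := ih (n := n) (by omega) (c + 1)
    exact ⟨true :: l, .succ true h1, .succ true h2⟩

lemma not_marked_of_mem_resolve {s : Bool} {w : List Piece} :
    ∀ p ∈ resolve s w, ∀ b, p.event ≠ .marked b := by
  intro p hp b
  obtain ⟨q, -, hq⟩ := List.mem_flatMap.1 hp
  rcases q with ⟨i, _ | _ | _ | c⟩
  any_goals
    simp only [Piece.splice, List.mem_singleton] at hq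
    subst hq
    simp
  by_cases h : c = s
  · simp [Piece.splice, h] at hq
  · simp only [Piece.splice, h, if_false, List.mem_cons, List.not_mem_nil, or_false] at hq
    rcases hq with rfl | rfl <;> simp

/-- Removing a circle from a link does not change whether it is trivial. -/
lemma isTrivialLink_circle_iff {u v : List Piece} {i n : ℕ} (hu : strands u 0 = some n) (hi : i ≤ n)
    (hu' : ∀ p ∈ u, ∀ b, p.event ≠ .marked b) (hv' : ∀ p ∈ v, ∀ b, p.event ≠ .marked b)
    (h : strands (u ++ [cup i, cap i, cup i] ++ v) 0 = some 0)
    (h' : strands (u ++ [cup i] ++ v) 0 = some 0) :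
    (Diagram.mk _ h).IsTrivialLink ↔ (Diagram.mk _ h').IsTrivialLink := by
  constructor
  · intro ht
    -- Deleting exactly the circle and keeping everything else leaves the diagram on the right.
    refine Del.isTrivialLink ht ?_
    obtain ⟨l, h1, h2⟩ := Del.circle hi 0
    have h3 := h'
    rw [List.append_assoc, strands_append, hu, Option.bind_some] at h3
    have e1 := Del.self hu' hu
    have e2 := Del.self (w := [cup i] ++ v) (n := n) (m := 0) (by
      intro p hp
      rcases List.mem_append.1 hp with hp | hp
      · simp only [List.mem_singleton] at hp
        subst hp
        simp
      · exact hv' p hp) h3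
    have := e1.append (Del.cons h1 (Del.cons h2 e2))
    simpa using this
  · intro ht
    have hc : strands (cup 0 :: cap 0 :: (u ++ [cup i] ++ v)) 0 = some 0 := by
      simpa [strands, Piece.strands, Event.inputs, Event.outputs] using h'
    -- Conversely, a circle is added at the top, where it does not disturb triviality, and moved
    -- down and then to the right to position `i`.
    refine (isTrivialLink_congr ?_).2 (isTrivialLink_circle ht hc)
    rw [← diagramEquiv_true]
    refine WordEquiv.diagramEquiv ?_
    have e1 := (circle_left (link := true) hi).context (a := u) (b := [cup i] ++ v) (n := 0) hu (by
      have : u ++ [cup i, cap i] ++ ([cup i] ++ v) = u ++ [cup i, cap i, cup i] ++ v := by simp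
      rw [this, h]
      rfl)
    have h2 : (strands (u ++ circles 1 ++ ([cup i] ++ v)) 0).isSome := by
      rw [← e1.isSome_iff]
      have : u ++ [cup i, cap i] ++ ([cup i] ++ v) = u ++ [cup i, cap i, cup i] ++ v := by simp
      rw [this, h]
      rfl
    have e2 := (circles_comm (link := true) (n := 0) 1 u (by rw [hu]; rfl)).symm.append_right h2
    have := e1.trans e2
    simpa [circles] using this

lemma resolution_isTrivialLink_iff {D D' : Diagram} (h : LocalStep YoshikawaMove D D') (b : Bool) :
    (D.resolution b).IsTrivialLink ↔ (D'.resolution b).IsTrivialLink := by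
  obtain ⟨w, hw⟩ := D
  obtain ⟨w', hw'⟩ := D'
  obtain ⟨u, v, s, t, hst, h1, h2⟩ := h
  obtain rfl : w = u ++ s ++ v := h1
  obtain rfl : w' = u ++ t ++ v := h2
  have c1 := hw
  have c2 := hw'
  rw [List.append_assoc, strands_append] at c1 c2
  obtain ⟨n, hn, c1⟩ := Option.bind_eq_some_iff.1 c1
  obtain ⟨n', hn', c2⟩ := Option.bind_eq_some_iff.1 c2
  obtain rfl : n = n' := by simpa [hn] using hn'
  rw [strands_append] at c1 c2
  obtain ⟨m, hm, -⟩ := Option.bind_eq_some_iff.1 c1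
  obtain ⟨m', hm', -⟩ := Option.bind_eq_some_iff.1 c2
  rw [← move_false] at hst
  obtain rfl := strands_eq_of_move hst hm hm'
  have e : ∀ x, resolve b (u ++ x ++ v) = resolve b u ++ resolve b x ++ resolve b v := fun x => by
    rw [resolve_append, resolve_append]
  have main : WordEquiv true n (resolve b s) (resolve b t) →
      LinkEquiv (Diagram.resolution b ⟨_, hw⟩) (Diagram.resolution b ⟨_, hw'⟩) := by
    intro h
    rw [← diagramEquiv_true]
    refine WordEquiv.diagramEquiv ?_
    change WordEquiv true 0 (resolve b (u ++ s ++ v)) (resolve b (u ++ t ++ v))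
    rw [e, e]
    refine h.context (strands_resolve hn) ?_
    rw [← e, strands_resolve hw]
    rfl
  rcases hst with (h | h) | ⟨-, h⟩
  · exact isTrivialLink_congr (main (resolve_of_planarMove h b hm hm'))
  · refine isTrivialLink_congr (main ?_)
    have h3 := strands_resolve (s := b) hm
    have h4 := strands_resolve (s := b) hm'
    cases h with
    | gamma1 i c => exact WordEquiv.of_move (Or.inl (Or.inr (.gamma1 i c))) h3 h4
    | gamma2 i c => exact WordEquiv.of_move (Or.inl (Or.inr (.gamma2 i c))) h3 h4
    | gamma3 i c d f h => exact WordEquiv.of_move (Or.inl (Or.inr (.gamma3 i c d f h))) h3 h4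
  · rcases resolve_of_markedVertexMove h b hm hm' with h | ⟨i, hi, h3, h4⟩
    · exact isTrivialLink_congr (main h)
    · have h5 := strands_resolve (s := b) hw
      have h6 := strands_resolve (s := b) hw'
      rw [e, h3] at h5
      rw [e, h4] at h6
      have := isTrivialLink_circle_iff (strands_resolve (s := b) hn) hi not_marked_of_mem_resolve
        not_marked_of_mem_resolve h5 h6
      convert this using 2
      · exact Diagram.ext (by change resolve b _ = _; rw [e, h3])
      · exact Diagram.ext (by change resolve b _ = _; rw [e, h4])

/-- A diagram produced by a reduction has to be admissible itself before it can present the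
surface-link; this supplies that fact. -/
lemma isAdmissible_iff {D D' : Diagram} (h : YoshikawaEquiv D D') :
    D.IsAdmissible ↔ D'.IsAdmissible := by
  induction h with
  | rel D D' h =>
    exact and_congr (resolution_isTrivialLink_iff h true) (resolution_isTrivialLink_iff h false)
  | refl D => rfl
  | symm D D' _ ih => exact ih.symm
  | trans D D' D'' _ _ ih ih' => exact ih.trans ih'

end MarkedGraph

namespace MarkedGraph

open SymPiece

/-! ### Reductions of words -/

/-- Up to circles, the word `s` is equivalent to the word `t`. -/
def Reduces (n : ℕ) (s t : List Piece) : Prop :=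
  ∃ k, WordEquiv false n s (circles k ++ t)

namespace Reduces

variable {n m : ℕ} {s t r a b : List Piece}

lemma of_equiv (h : WordEquiv false n s t) : Reduces n s t := ⟨0, h⟩

lemma refl (h : (strands s n).isSome) : Reduces n s s := by
  obtain ⟨m, hm⟩ := Option.isSome_iff_exists.1 h
  exact of_equiv (WordEquiv.refl hm)

lemma strands_eq (h : Reduces n s t) : strands s n = strands t n := by
  obtain ⟨k, h⟩ := h
  rw [h.strands_eq, strands_append, strands_circles, Option.bind_some]

lemma trans (h : Reduces n s t) (h' : Reduces n t r) : Reduces n s r := by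
  obtain ⟨k, h⟩ := h
  obtain ⟨l, h'⟩ := h'
  refine ⟨k + l, h.trans ?_⟩
  rw [circles_add, List.append_assoc]
  exact h'.append_left (strands_circles k n)

/-- Circles split off inside a word commute with everything above them and are collected at the very
top. -/
lemma context (h : Reduces m s t) (ha : strands a n = some m)
    (hd : (strands (a ++ s ++ b) n).isSome) : Reduces n (a ++ s ++ b) (a ++ t ++ b) := by
  obtain ⟨k, h⟩ := h
  have e1 := h.context ha hd
  refine ⟨k, e1.trans ?_⟩
  have h2 := e1.isSome_iff.1 hd
  have e2 : a ++ (circles k ++ t) ++ b = (a ++ circles k) ++ (t ++ b) := by simp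
  rw [e2] at h2 ⊢
  have e3 := (circles_comm (link := false) k a (by rw [ha]; rfl)).symm.append_right h2
  simpa using e3

lemma append_right (h : Reduces n s t) (hd : (strands (s ++ b) n).isSome) :
    Reduces n (s ++ b) (t ++ b) := by
  simpa using h.context (a := []) rfl (by simpa using hd)

lemma append_left (h : Reduces m s t) (ha : strands a n = some m) (hs : (strands s m).isSome) :
    Reduces n (a ++ s) (a ++ t) := by
  simpa using h.context (b := []) ha (by simpa [strands_append, ha] using hs)

lemma swapL {i j : ℕ} {p q : Event} (h : j + q.inputs ≤ i)
    (hs : (strands [⟨i, p⟩, ⟨j, q⟩] n).isSome) :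
    Reduces n [⟨i, p⟩, ⟨j, q⟩] [⟨j, q⟩, ⟨i - q.inputs + q.outputs, p⟩] := by
  have h1 := le_of_strands_cons_cons hs
  have h2 : (strands [⟨j, q⟩, ⟨i - q.inputs + q.outputs, p⟩] n).isSome := by
    simp only [strands, Piece.strands]
    rw [if_pos (by omega), Option.bind_some, if_pos (by omega)]
    rfl
  have := WordEquiv.swap (link := false) (i := j) (j := i - q.inputs + q.outputs) (by omega) h2
  rw [show i - q.inputs + q.outputs - q.outputs + q.inputs = i by omega] at this
  exact of_equiv this.symm

lemma of_connects {k i : ℕ} {s t : List SymPiece} {a b : List (ℕ × Rule)}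
    (h : Connects false k s t a b = true) (ν : ℕ → Node) (hn : i + k ≤ n) :
    Reduces n (evalWord i (fun _ => false) ν s) (evalWord i (fun _ => false) ν t) := by
  have := Connects.wordEquiv h i (n - i - k) (fun _ => false) ν
  rw [show i + k + (n - i - k) = n by omega] at this
  exact of_equiv this

lemma zigzag {i j : ℕ} (h : j = i + 1 ∨ i = j + 1) (hs : (strands [cup i, cap j] n).isSome) :
    Reduces n [cup i, cap j] [] := by
  have h1 := le_of_strands_cons_cons hs
  simp only [Event.inputs, Event.outputs] at h1
  have h2 : Connects false 1 [.mx 0, .mn 1] [] [(0, .zig)] [] = true := by decide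
  have h3 : Connects false 1 [.mx 1, .mn 0] [] [(0, .zig)] [] = true := by decide
  rcases h with rfl | rfl
  · exact of_connects h2 (fun _ => (false, false)) (by omega)
  · exact of_connects h3 (fun _ => (false, false)) (by omega)

lemma circle {i : ℕ} (hs : (strands [cup i, cap i] n).isSome) : Reduces n [cup i, cap i] [] := by
  have h1 := le_of_strands_cons hs
  exact ⟨1, by simpa using circle_left (by simpa [Event.inputs] using h1)⟩

lemma node_max {i : ℕ} (x : Node) (hs : (strands [cup i, ⟨i, x.event⟩] n).isSome) :
    Reduces n [cup i, ⟨i, x.event⟩] [cup i] := by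
  have h1 := le_of_strands_cons hs
  have h2 : Connects false 0 [.mx 0, .nd 0 0 false] [.mx 0] [(0, .r1)] [] = true := by decide
  simpa [evalWord, SymEvent.eval_mx, SymEvent.eval_nd] using
    of_connects (i := i) h2 (fun _ => x) h1

lemma node_min {i : ℕ} (x : Node) (hs : (strands [⟨i, x.event⟩, cap i] n).isSome) :
    Reduces n [⟨i, x.event⟩, cap i] [cap i] := by
  have h1 := le_of_strands_cons hs
  rw [Node.inputs_event] at h1
  have h2 : Connects false 2 [.nd 0 0 false, .mn 0] [.mn 0]
    [(0, .zigIns 0 false), (1, .swapR), (0, .turn), (2, .swapR), (1, .turn), (0, .r1), (0, .zig)]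
    [] = true := by decide
  simpa [evalWord, SymEvent.eval_mn, SymEvent.eval_nd] using
    of_connects (i := i) h2 (fun _ => x) h1

lemma kink {i j : ℕ} (h : j = i + 1 ∨ i = j + 1) (x : Node)
    (hs : (strands [cup i, ⟨j, x.event⟩, cap i] n).isSome) :
    Reduces n [cup i, ⟨j, x.event⟩, cap i] [] := by
  have h1 := le_of_strands_cons_cons hs
  rw [Node.inputs_event] at h1
  simp only [Event.inputs, Event.outputs] at h1
  have h2 : Connects false 1 [.mx 0, .nd 1 0 false, .mn 0] []
    [(0, .turn), (1, .zigIns 0 false), (2, .swapR), (1, .turn), (3, .swapR), (2, .turn), (1, .r1),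
      (1, .zig), (0, .zig)] [] = true := by decide
  have h3 : Connects false 1 [.mx 1, .nd 0 0 false, .mn 1] []
    [(0, .turn), (1, .zigIns 1 false), (2, .swapR), (1, .turn), (3, .swapR), (2, .turn), (1, .r1),
      (1, .zig), (0, .zig)] [] = true := by decide
  rcases h with rfl | rfl
  · simpa [evalWord, SymEvent.eval_mx, SymEvent.eval_mn, SymEvent.eval_nd] using
      of_connects (i := i) h2 (fun _ => x) (by omega)
  · simpa [evalWord, SymEvent.eval_mx, SymEvent.eval_mn, SymEvent.eval_nd] using
      of_connects (i := j) h3 (fun _ => x) (by omega)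

end Reduces

/-! ### A normalization procedure -/

/-- Push a local maximum at position `i` down into the word. -/
def push : ℕ → List SymPiece → List SymPiece
  | i, [] => [mx i]
  | i, ⟨j, q⟩ :: w =>
    if j + q.inputs ≤ i then ⟨j, q⟩ :: push (i - q.inputs + q.outputs) w
    else if i + 2 ≤ j then ⟨j - 2, q⟩ :: push i w
    else if q = .mn then w
    else if q.isNode then
      if j = i then push i w
      else
        match w with
        | ⟨k, .mn⟩ :: w' => if k = i then w' else mx i :: ⟨j, q⟩ :: w
        | _ => mx i :: ⟨j, q⟩ :: w
    else mx i :: ⟨j, q⟩ :: w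

/-- Pull a local minimum at position `i` up into the reversed word. -/
def pull : ℕ → List SymPiece → List SymPiece
  | i, [] => [mn i]
  | i, ⟨j, q⟩ :: w =>
    if j + q.outputs ≤ i then ⟨j, q⟩ :: pull (i - q.outputs + q.inputs) w
    else if i + 2 ≤ j then ⟨j - 2, q⟩ :: pull i w
    else if q = .mx then w
    else if q.isNode then
      if j = i then pull i w
      else
        match w with
        | ⟨k, .mx⟩ :: w' => if k = i then w' else mn i :: ⟨j, q⟩ :: w
        | _ => mn i :: ⟨j, q⟩ :: w
    else mn i :: ⟨j, q⟩ :: w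

/-- Push all local maxima down, the lowest first. -/
def pushAll : List SymPiece → List SymPiece
  | [] => []
  | ⟨i, e⟩ :: w => if e = .mx then push i (pushAll w) else ⟨i, e⟩ :: pushAll w

/-- Pull all local minima of a reversed word up, the highest first. -/
def pullAll : List SymPiece → List SymPiece
  | [] => []
  | ⟨i, e⟩ :: w => if e = .mn then pull i (pullAll w) else ⟨i, e⟩ :: pullAll w

/-- Move the local maxima and minima of a word towards each other. -/
def normalize (w : List SymPiece) : List SymPiece := (pullAll (pushAll w).reverse).reverse

/-- The value of a word without boolean variables. -/
def nodeWord (ν : ℕ → Node) (w : List SymPiece) : List Piece := evalWord 0 (fun _ => false) ν w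

lemma nodeWord_cons (ν : ℕ → Node) (p : SymPiece) (w : List SymPiece) :
    nodeWord ν (p :: w) = ⟨p.pos, p.event.eval (fun _ => false) ν⟩ :: nodeWord ν w := by
  simp [nodeWord, evalWord]

lemma nodeWord_append (ν : ℕ → Node) (w w' : List SymPiece) :
    nodeWord ν (w ++ w') = nodeWord ν w ++ nodeWord ν w' := evalWord_append _ _ _ _ _

lemma SymEvent.exists_node {e : SymEvent} (h : e.isNode) (β : ℕ → Bool) (ν : ℕ → Node) :
    ∃ x : Node, e.eval β ν = x.event := by
  rcases SymEvent.eval_of_isNode β ν h with ⟨b, hb, -⟩ | ⟨b, hb, -⟩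
  · exact ⟨(false, b), by simpa [Node.event] using hb⟩
  · exact ⟨(true, b), by simpa [Node.event] using hb⟩

lemma exists_strands_of_append {u v : List Piece} {n : ℕ} (h : (strands (u ++ v) n).isSome) :
    ∃ m, strands u n = some m ∧ (strands v m).isSome := by
  obtain ⟨k, hk⟩ := Option.isSome_iff_exists.1 h
  rw [strands_append] at hk
  obtain ⟨m, h1, h2⟩ := Option.bind_eq_some_iff.1 hk
  exact ⟨m, h1, Option.isSome_iff_exists.2 ⟨k, h2⟩⟩

/-- Every branch of `push` either exchanges the maximum with a distant event, removes something by
one of the reductions above, or stops. When it stops nothing has to be shown, so `push` need not be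
optimal. -/
lemma push_reduces (ν : ℕ → Node) (w : List SymPiece) : ∀ (i n : ℕ),
    (strands (nodeWord ν (mx i :: w)) n).isSome →
      Reduces n (nodeWord ν (mx i :: w)) (nodeWord ν (push i w)) := by
  induction w with
  | nil => exact fun i n h => Reduces.refl h
  | cons p w ih =>
    obtain ⟨j, q⟩ := p
    intro i n h
    have e : nodeWord ν (mx i :: ⟨j, q⟩ :: w) =
        [cup i, ⟨j, q.eval (fun _ => false) ν⟩] ++ nodeWord ν w := by
      simp [nodeWord_cons, SymEvent.eval_mx]
    have hin := SymEvent.inputs_eval (fun _ => false) ν q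
    have hout := SymEvent.outputs_eval (fun _ => false) ν q
    obtain ⟨m, hm, hw⟩ := exists_strands_of_append (e ▸ h)
    have hs : (strands [cup i, ⟨j, q.eval (fun _ => false) ν⟩] n).isSome := by rw [hm]; rfl
    have hc := le_of_strands_cons_cons hs
    -- continue with a local maximum at position `k` below the event at position `l`
    have go : ∀ k l, Reduces n [cup i, ⟨j, q.eval (fun _ => false) ν⟩]
        [⟨l, q.eval (fun _ => false) ν⟩, cup k] →
        Reduces n (nodeWord ν (mx i :: ⟨j, q⟩ :: w)) (nodeWord ν (⟨l, q⟩ :: push k w)) := by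
      intro k l h1
      have h2 := h1.append_right (b := nodeWord ν w) (e ▸ h)
      have h3 : (strands (nodeWord ν (⟨l, q⟩ :: mx k :: w)) n).isSome := by
        have := h2.strands_eq
        rw [← e] at this
        rw [this] at h
        simpa [nodeWord_cons, SymEvent.eval_mx] using h
      have e4 : nodeWord ν (⟨l, q⟩ :: mx k :: w) =
          [⟨l, q.eval (fun _ => false) ν⟩] ++ nodeWord ν (mx k :: w) := by
        simp [nodeWord_cons]
      obtain ⟨m', h5, h6⟩ := exists_strands_of_append (e4 ▸ h3)
      have h7 := (ih k m' h6).append_left h5 h6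
      rw [e]
      refine h2.trans ?_
      simpa [nodeWord_cons, SymEvent.eval_mx] using h7
    have noStep : Reduces n (nodeWord ν (mx i :: ⟨j, q⟩ :: w)) (nodeWord ν (mx i :: ⟨j, q⟩ :: w)) :=
      Reduces.refl h
    unfold push
    split_ifs with h1 h2 h3 h4 h5
    · refine go _ _ ?_
      have := Reduces.swapL (by rw [hin]; exact h1) hs
      rwa [hin, hout] at this
    · refine go _ _ ?_
      exact Reduces.of_equiv (WordEquiv.swap (p := .localMax) h2 hs)
    · subst h3
      rw [e] at h ⊢
      simp only [SymEvent.inputs] at h1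
      -- A minimum meeting the maximum closes a circle if the positions agree, and forms a zigzag if
      -- they differ by one. `push` drops both; the circle is remembered in the count of `Reduces`.
      by_cases hij : j = i
      · subst hij
        exact (Reduces.circle hs).append_right h
      · exact (Reduces.zigzag (by omega) hs).append_right h
    · subst h5
      obtain ⟨x, hx⟩ := SymEvent.exists_node h4 (fun _ => false) ν
      rw [hx] at hs e
      have h6 := (Reduces.node_max x hs).append_right (b := nodeWord ν w) (e ▸ h)
      have h7 : (strands (nodeWord ν (mx j :: w)) n).isSome := by
        have := h6.strands_eq
        rw [← e] at this
        rw [this] at h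
        simpa [nodeWord_cons, SymEvent.eval_mx] using h
      rw [e]
      refine h6.trans ?_
      simpa [nodeWord_cons, SymEvent.eval_mx] using ih j n h7
    · split
      · rename_i k w'
        split_ifs with h6
        · subst h6
          obtain ⟨x, hx⟩ := SymEvent.exists_node h4 (fun _ => false) ν
          have e2 : nodeWord ν (mx k :: ⟨j, q⟩ :: ⟨k, .mn⟩ :: w') =
              [cup k, ⟨j, x.event⟩, cap k] ++ nodeWord ν w' := by
            simp [nodeWord_cons, SymEvent.eval_mx, SymEvent.eval_mn, hx]
          rw [e2] at h ⊢
          obtain ⟨m', h7, -⟩ := exists_strands_of_append h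
          have : q.inputs = 2 := by cases q <;> simp_all [SymEvent.isNode, SymEvent.inputs]
          exact (Reduces.kink (by omega) x (by rw [h7]; rfl)).append_right h
        · exact noStep
      · exact noStep
    · exact noStep

/-- The upside-down version of `push_reduces`. The word is stored in reverse so that the recursion
can again start at the extremum. -/
lemma pull_reduces (ν : ℕ → Node) (w : List SymPiece) : ∀ (i n : ℕ),
    (strands (nodeWord ν (mn i :: w).reverse) n).isSome →
      Reduces n (nodeWord ν (mn i :: w).reverse) (nodeWord ν (pull i w).reverse) := by
  induction w with
  | nil => exact fun i n h => Reduces.refl h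
  | cons p w ih =>
    obtain ⟨j, q⟩ := p
    intro i n h
    have e : nodeWord ν (mn i :: ⟨j, q⟩ :: w).reverse =
        nodeWord ν w.reverse ++ [⟨j, q.eval (fun _ => false) ν⟩, cap i] := by
      simp [SymEvent.eval_mn, nodeWord, evalWord]
    have hin := SymEvent.inputs_eval (fun _ => false) ν q
    have hout := SymEvent.outputs_eval (fun _ => false) ν q
    obtain ⟨m, hm, hs⟩ := exists_strands_of_append (e ▸ h)
    have hc := le_of_strands_cons_cons hs
    -- continue with a local minimum at position `k` above the event at position `l`
    have go : ∀ k l, Reduces m [⟨j, q.eval (fun _ => false) ν⟩, cap i]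
        [cap k, ⟨l, q.eval (fun _ => false) ν⟩] →
        Reduces n (nodeWord ν (mn i :: ⟨j, q⟩ :: w).reverse)
          (nodeWord ν (⟨l, q⟩ :: pull k w).reverse) := by
      intro k l h1
      have h2 := h1.append_left hm hs
      have e3 : nodeWord ν w.reverse ++ [cap k, ⟨l, q.eval (fun _ => false) ν⟩] =
          nodeWord ν (mn k :: w).reverse ++ [⟨l, q.eval (fun _ => false) ν⟩] := by
        simp [SymEvent.eval_mn, nodeWord, evalWord]
      have h3 : (strands (nodeWord ν (mn k :: w).reverse ++
          [⟨l, q.eval (fun _ => false) ν⟩]) n).isSome := by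
        rw [← e3, ← h2.strands_eq, ← e]
        exact h
      obtain ⟨m', h5, -⟩ := exists_strands_of_append h3
      have h7 := (ih k n (by rw [h5]; rfl)).append_right h3
      rw [e3, ← e] at h2
      refine h2.trans ?_
      simpa [nodeWord, evalWord] using h7
    have noStep : Reduces n (nodeWord ν (mn i :: ⟨j, q⟩ :: w).reverse)
        (nodeWord ν (mn i :: ⟨j, q⟩ :: w).reverse) := Reduces.refl h
    unfold pull
    split_ifs with h1 h2 h3 h4 h5
    · refine go _ _ ?_
      have := WordEquiv.swap (link := false) (by rw [hout]; exact h1) hs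
      rw [hin, hout] at this
      exact Reduces.of_equiv this
    · exact go _ _ (Reduces.swapL (q := .localMin) h2 hs)
    · subst h3
      rw [e, SymEvent.eval_mx]
      simp only [SymEvent.outputs] at h1
      by_cases hij : j = i
      · subst hij
        simpa using (Reduces.circle hs).append_left hm hs
      · simpa using (Reduces.zigzag (by omega) hs).append_left hm hs
    · subst h5
      obtain ⟨x, hx⟩ := SymEvent.exists_node h4 (fun _ => false) ν
      rw [hx] at hs e
      have h6 := (Reduces.node_min x hs).append_left hm hs
      have e3 : nodeWord ν w.reverse ++ [cap j] = nodeWord ν (mn j :: w).reverse := by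
        simp [SymEvent.eval_mn, nodeWord, evalWord]
      rw [← e, e3] at h6
      exact h6.trans (ih j n (by rw [← h6.strands_eq]; exact h))
    · split
      · rename_i k w'
        split_ifs with h6
        · subst h6
          obtain ⟨x, hx⟩ := SymEvent.exists_node h4 (fun _ => false) ν
          have e2 : nodeWord ν (mn k :: ⟨j, q⟩ :: ⟨k, .mx⟩ :: w').reverse =
              nodeWord ν w'.reverse ++ [cup k, ⟨j, x.event⟩, cap k] := by
            simp [SymEvent.eval_mx, SymEvent.eval_mn, nodeWord, evalWord]
            simpa using hx
          rw [e2] at h ⊢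
          obtain ⟨m', h7, h8⟩ := exists_strands_of_append h
          have : q.outputs = 2 := by cases q <;> simp_all [SymEvent.isNode, SymEvent.outputs]
          simpa using (Reduces.kink (by omega) x h8).append_left h7 h8
        · exact noStep
      · exact noStep
    · exact noStep

lemma pushAll_reduces (ν : ℕ → Node) (w : List SymPiece) : ∀ n : ℕ,
    (strands (nodeWord ν w) n).isSome → Reduces n (nodeWord ν w) (nodeWord ν (pushAll w)) := by
  induction w with
  | nil => exact fun n h => Reduces.refl h
  | cons p w ih =>
    obtain ⟨i, q⟩ := p
    intro n h
    have e : ∀ w, nodeWord ν (⟨i, q⟩ :: w) =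
        [⟨i, q.eval (fun _ => false) ν⟩] ++ nodeWord ν w := fun w => by simp [nodeWord_cons]
    have h1 : Reduces n (nodeWord ν (⟨i, q⟩ :: w)) (nodeWord ν (⟨i, q⟩ :: pushAll w)) := by
      rw [e] at h
      rw [e, e]
      obtain ⟨m, h1, h2⟩ := exists_strands_of_append h
      exact (ih m h2).append_left h1 h2
    unfold pushAll
    split_ifs with hq
    · subst hq
      exact h1.trans (push_reduces ν _ i n (by rw [← h1.strands_eq]; exact h))
    · exact h1

lemma pullAll_reduces (ν : ℕ → Node) (w : List SymPiece) : ∀ n : ℕ,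
    (strands (nodeWord ν w.reverse) n).isSome →
      Reduces n (nodeWord ν w.reverse) (nodeWord ν (pullAll w).reverse) := by
  induction w with
  | nil => exact fun n h => Reduces.refl h
  | cons p w ih =>
    obtain ⟨i, q⟩ := p
    intro n h
    have e : ∀ w : List SymPiece, nodeWord ν (⟨i, q⟩ :: w).reverse =
        nodeWord ν w.reverse ++ [⟨i, q.eval (fun _ => false) ν⟩] := fun w => by
      simp [nodeWord, evalWord]
    have h1 : Reduces n (nodeWord ν (⟨i, q⟩ :: w).reverse)
        (nodeWord ν (⟨i, q⟩ :: pullAll w).reverse) := by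
      rw [e] at h
      rw [e, e]
      obtain ⟨m, h1, h2⟩ := exists_strands_of_append h
      exact (ih n (by rw [h1]; rfl)).append_right h
    unfold pullAll
    split_ifs with hq
    · subst hq
      exact h1.trans (pull_reduces ν _ i n (by rw [← h1.strands_eq]; exact h))
    · exact h1

lemma normalize_reduces (ν : ℕ → Node) (w : List SymPiece) (n : ℕ)
    (h : (strands (nodeWord ν w) n).isSome) :
    Reduces n (nodeWord ν w) (nodeWord ν (normalize w)) := by
  have h1 := pushAll_reduces ν w n h
  refine h1.trans ?_
  have := pullAll_reduces ν (pushAll w).reverse n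
    (by rw [List.reverse_reverse, ← h1.strands_eq]; exact h)
  rwa [List.reverse_reverse] at this

end MarkedGraph

namespace MarkedGraph

open SymPiece

/-! ### Mosaics with nodes of unknown type -/

/-- The node drawn by a tile. -/
def Tile.nodes : Tile → List Node
  | .crossing b => [(false, b)]
  | .marked b => [(true, b)]
  | _ => []

/-- Forget the type of the node of a tile. -/
def Tile.shape : Tile → Tile
  | .marked _ => .crossing false
  | .crossing _ => .crossing false
  | t => t

/-- The pieces drawn by a tile; its node gets the number `k`. -/
def Tile.symPieces (i k : ℕ) : Tile → List SymPiece
  | .arcSE => [mx i]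
  | .arcNW => [mn i]
  | .twoArcsNWSE => [mn i, mx i]
  | .crossing _ => [nd i k false]
  | .marked _ => [nd i k false]
  | _ => []

/-- The word of a row with numbered nodes. -/
def symRow : ℕ → ℕ → List Tile → List SymPiece
  | _, _, [] => []
  | i, k, t :: ts => t.symPieces i k ++
      symRow (i + (t.connects .south).toNat) (k + t.nodes.length) ts

/-- The word of a list of rows with numbered nodes. -/
def symRows : ℕ → List (List Tile) → List SymPiece
  | _, [] => []
  | k, r :: rs => symRow 0 k r ++ symRows (k + (r.flatMap Tile.nodes).length) rs

/-- The list `l` holds the nodes of the mosaic in reading order. The hypothesis says that the nodes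
of the present row start at index `k`, so the numbers given by `symRow` retrieve the right values;
the default of `getD` is not used for them. -/
lemma nodeWord_symRow (l : List Node) (ts : List Tile) : ∀ (i k : ℕ) (l' : List Node),
    l.drop k = ts.flatMap Tile.nodes ++ l' →
      nodeWord (fun v => l.getD v (false, false)) (symRow i k ts) = rowWord i ts := by
  induction ts with
  | nil => exact fun i k l' _ => rfl
  | cons t ts ih =>
    intro i k l' h
    rw [List.flatMap_cons, List.append_assoc] at h
    have h1 : l.drop (k + t.nodes.length) = ts.flatMap Tile.nodes ++ l' := by
      rw [← List.drop_drop, h, List.drop_left]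
    rw [symRow, nodeWord_append, ih _ _ _ h1, rowWord]
    congr 1
    have h2 : ∀ x, t.nodes = [x] → l.getD k (false, false) = x := by
      intro x hx
      rw [hx] at h
      have : (l.drop k)[0]? = some x := by rw [h]; rfl
      rw [List.getElem?_drop, add_zero] at this
      rw [List.getD_eq_getElem?_getD, this]
      rfl
    cases t <;>
      simp [Tile.symPieces, Tile.pieces, nodeWord, evalWord, SymEvent.eval_nd, SymEvent.eval_mx,
        SymEvent.eval_mn]
    · have := h2 _ rfl
      rw [List.getD_eq_getElem?_getD] at this
      rw [this]
      rfl
    · have := h2 _ rfl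
      rw [List.getD_eq_getElem?_getD] at this
      rw [this]
      rfl

lemma nodeWord_symRows (l : List Node) (rs : List (List Tile)) : ∀ (k : ℕ) (l' : List Node),
    l.drop k = rs.flatMap (fun r => r.flatMap Tile.nodes) ++ l' →
      nodeWord (fun v => l.getD v (false, false)) (symRows k rs) = rs.flatMap (rowWord 0) := by
  induction rs with
  | nil => exact fun k l' _ => rfl
  | cons r rs ih =>
    intro k l' h
    rw [List.flatMap_cons, List.append_assoc] at h
    rw [symRows, nodeWord_append, nodeWord_symRow l r 0 k _ h, List.flatMap_cons,
      ih _ l' (by rw [← List.drop_drop, h, List.drop_left])]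

lemma symRow_shape (ts : List Tile) : ∀ i k, symRow i k (ts.map Tile.shape) = symRow i k ts := by
  induction ts with
  | nil => exact fun _ _ => rfl
  | cons t ts ih =>
    intro i k
    simp only [List.map_cons, symRow, ih]
    cases t <;> rfl

lemma length_nodes_shape (ts : List Tile) :
    ((ts.map Tile.shape).flatMap Tile.nodes).length = (ts.flatMap Tile.nodes).length := by
  induction ts with
  | nil => rfl
  | cons t ts ih =>
    simp only [List.map_cons, List.flatMap_cons, List.length_append, ih]
    cases t <;> rfl

lemma connects_shape (t : Tile) (s : Side) : t.shape.connects s = t.connects s := by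
  cases t <;> rfl

/-- The tiles with at most one type of node. -/
def shapes : List Tile :=
  [.blank, .arcWS, .arcSE, .arcNE, .arcNW, .arcWE, .arcNS, .twoArcsWSNE, .twoArcsNWSE,
    .crossing false]

/-- All rows with the given connection points on the north sides, where `w` says whether a strand
enters from the left. -/
def rowsFrom : Bool → List Bool → List (List Tile)
  | w, [] => if w then [] else [[]]
  | w, b :: bs => (shapes.filter fun t => t.connects .west == w && t.connects .north == b).flatMap
      fun t => (rowsFrom (t.connects .east) bs).map (t :: ·)

/-- The enumeration is complete after forgetting node types. With a single node tile in place of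
four it stays small enough to be run. -/
lemma mem_rowsFrom (ts : List Tile) : ∀ w, RowMatched w ts →
    ts.map Tile.shape ∈ rowsFrom w (ts.map fun t => t.connects .north) := by
  induction ts with
  | nil => exact fun w h => by simp [show w = false from h, rowsFrom]
  | cons t ts ih =>
    rintro w ⟨h1, h2⟩
    simp only [List.map_cons, rowsFrom, List.mem_flatMap, List.mem_filter, List.mem_map]
    refine ⟨t.shape, ⟨by cases t <;> simp [Tile.shape, shapes], by simp [connects_shape, h1]⟩, ts.map Tile.shape, ?_,
      rfl⟩
    rw [connects_shape]
    exact ih _ h2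

/-- The rows fit below each other, with the given connection points at the top and none at the
bottom. -/
def Stacked : List Bool → List (List Tile) → Prop
  | bs, [] => ∀ b ∈ bs, b = false
  | bs, r :: rs => RowMatched false r ∧ (r.map fun t => t.connects .north) = bs ∧
      Stacked (r.map fun t => t.connects .south) rs

lemma length_nodes_le {ts : List Tile} (h : RowMatched false ts) :
    (ts.flatMap Tile.nodes).length ≤ ts.length - 2 := by
  -- A node needs a strand on its west and its east side, so neither the first nor the last tile of
  -- a row is one. The induction over suffixes separates rows entered from the left, which lose one
  -- tile, from rows which are not, which lose two.
  have key : ∀ (ts : List Tile), (ts.flatMap Tile.nodes).length ≤ ts.length ∧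
      (RowMatched true ts → (ts.flatMap Tile.nodes).length + 1 ≤ ts.length) ∧
      (RowMatched false ts → (ts.flatMap Tile.nodes).length ≤ ts.length - 2) := by
    intro ts
    induction ts with
    | nil => exact ⟨le_rfl, fun h => by simp [RowMatched] at h, fun _ => le_rfl⟩
    | cons t ts ih =>
      obtain ⟨h1, h2, h3⟩ := ih
      rw [List.flatMap_cons, List.length_append, List.length_cons]
      refine ⟨?_, ?_, ?_⟩
      · cases t <;> simp only [Tile.nodes, List.length_nil, List.length_singleton] <;> omega
      · rintro ⟨h4, h5⟩
        cases t <;> simp only [Tile.nodes, List.length_nil, List.length_singleton] <;>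
          first
          | omega
          | (have := h2 h5; omega)
      · rintro ⟨h4, h5⟩
        cases t <;> simp only [Tile.connects, Bool.true_eq_false] at h4 <;>
          simp only [Tile.nodes, List.length_nil] <;>
          first
          | (have := h2 h5; omega)
          | (have := h3 h5; omega)
  exact (key ts).2.2 h

/-- The first row is not excluded, since the statement allows strands at the top. The weaker factor
`rs.length - 1` suffices: it gives six for size four, and it bounds the unfinished rows in
`checkRows`. -/
lemma Stacked.length_nodes_le {n : ℕ} (rs : List (List Tile)) : ∀ {bs : List Bool},
    Stacked bs rs → bs.length = n →
      (rs.flatMap fun r => r.flatMap Tile.nodes).length ≤ (rs.length - 1) * (n - 2) := by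
  induction rs with
  | nil => exact fun _ _ => by simp
  | cons r rs ih =>
    rintro bs ⟨h1, rfl, h3⟩ hn
    have h4 := MarkedGraph.length_nodes_le h1
    rw [List.length_map] at hn
    rw [hn] at h4
    have h5 := ih h3 (by rw [List.length_map, hn])
    rw [List.flatMap_cons, List.length_append]
    rcases rs with _ | ⟨r', rs⟩
    -- The last row has no connection points on its south sides, whereas a node tile would have one.
    · have : r.flatMap Tile.nodes = [] := by
        rw [List.flatMap_eq_nil_iff]
        intro t ht
        have := h3 _ (List.mem_map.2 ⟨t, ht, rfl⟩)
        cases t <;> simp_all [Tile.connects, Tile.nodes]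
      simp [this]
    · simp only [List.length_cons, Nat.add_sub_cancel] at h5 ⊢
      rw [Nat.add_mul]
      omega

lemma Mosaic.stacked {n : ℕ} (M : Mosaic n) : Stacked (List.replicate n false) (rows M.tile) := by
  have h := M.connected
  have key : ∀ k i, i + k = n → Stacked (if hi : i < n then (List.ofFn (M.tile ⟨i, hi⟩)).map
      fun t => t.connects .north else List.replicate n false) ((rows M.tile).drop i) := by
    intro k
    induction k with
    | zero =>
      intro i hi
      have h1 : ¬ i < n := by omega
      rw [List.drop_eq_nil_of_le (by simp [rows]; omega)]
      simp only [h1, dif_neg, not_false_eq_true, Stacked]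
      intro b hb
      exact List.eq_of_mem_replicate hb
    | succ k ih =>
      intro i hi
      have h1 : i < n := by omega
      rw [List.drop_eq_getElem_cons (by simpa [rows] using h1)]
      simp only [h1, dif_pos, rows, List.getElem_ofFn]
      refine ⟨rowMatched_row h ⟨i, h1⟩, rfl, ?_⟩
      have e : (List.ofFn (M.tile ⟨i, h1⟩)).map (fun t => t.connects .south) =
          if hi : i + 1 < n then (List.ofFn (M.tile ⟨i + 1, hi⟩)).map fun t => t.connects .north
          else List.replicate n false := ?_
      · rw [e]
        exact ih (i + 1) (by omega)
      split_ifs with h4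
      · rw [List.map_ofFn, List.map_ofFn]
        congr 1
        funext j
        rw [Function.comp, Function.comp, Bool.eq_iff_iff]
        constructor
        · intro he
          obtain ⟨i', h2, h3⟩ := (h ⟨i, h1⟩ j).2.1 he
          obtain rfl : i' = ⟨i + 1, h4⟩ := Fin.ext h2
          exact h3
        · intro he
          obtain ⟨i', h2, h3⟩ := (h ⟨i + 1, h4⟩ j).1 he
          obtain rfl : i' = ⟨i, h1⟩ := Fin.ext (by simpa using h2)
          exact h3
      · rw [List.eq_replicate_iff]
        refine ⟨by simp, fun b hb => ?_⟩
        obtain ⟨t, ht, rfl⟩ := List.mem_map.1 hb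
        obtain ⟨j, rfl⟩ := (List.mem_ofFn' _ _).1 ht
        rw [← Bool.not_eq_true]
        intro he
        obtain ⟨i', h2, -⟩ := (h ⟨i, h1⟩ j).2.1 he
        have := i'.2
        simp at h2
        omega
  have e := key n 0 (by omega)
  rw [List.drop_zero] at e
  convert e
  split_ifs with h0
  · rw [eq_comm, List.eq_replicate_iff]
    refine ⟨by simp, fun b hb => ?_⟩
    obtain ⟨t, ht, rfl⟩ := List.mem_map.1 hb
    obtain ⟨j, rfl⟩ := (List.mem_ofFn' _ _).1 ht
    rw [← Bool.not_eq_true]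
    intro he
    obtain ⟨i', h2, -⟩ := (h ⟨0, h0⟩ j).1 he
    simp at h2
  · rfl

/-! ### The finite check of mosaics of size five -/

/-- Number the nodes of a word, starting with `k`. -/
def relabel : ℕ → List SymPiece → List SymPiece
  | _, [] => []
  | k, ⟨i, .nd _ _⟩ :: w => nd i k false :: relabel (k + 1) w
  | k, p :: w => p :: relabel k w

/-- The values of the nodes of a word. -/
def nodeValues (ν : ℕ → Node) : List SymPiece → List Node
  | [] => []
  | ⟨_, .nd v f⟩ :: w => (if f then Node.flip (ν v) else ν v) :: nodeValues ν w
  | _ :: w => nodeValues ν w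

/-- Normalization drops nodes, so the surviving numbers have gaps. Since node values are arbitrary,
the nodes may be renumbered in order of appearance, and only then can the result be compared with a
fixed list. -/
lemma nodeWord_relabel (ν : ℕ → Node) (l : List Node) (w : List SymPiece) :
    ∀ k, l.drop k = nodeValues ν w →
      nodeWord (fun v => l.getD v (false, false)) (relabel k w) = nodeWord ν w := by
  induction w with
  | nil => exact fun _ _ => rfl
  | cons p w ih =>
    obtain ⟨i, e⟩ := p
    intro k h
    cases e with
    | nd v f =>
      simp only [nodeValues] at h
      have h1 : l.getD k (false, false) = if f then Node.flip (ν v) else ν v := by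
        have : (l.drop k)[0]? = some (if f then Node.flip (ν v) else ν v) := by rw [h]; rfl
        rw [List.getElem?_drop, add_zero] at this
        rw [List.getD_eq_getElem?_getD, this]
        rfl
      simp only [relabel, nodeWord_cons, SymEvent.eval_nd, h1]
      rw [ih (k + 1) (by rw [← List.drop_drop, h]; rfl)]
      rfl
    | _ =>
      simp only [relabel, nodeWord_cons]
      rw [ih k h]
      rfl

/-- The words with seven nodes to which mosaics of size five are reduced. -/
def coreWords : List (List SymPiece) :=
  [[mx 0, mx 2, nd 1 0 false, nd 2 1 false, mx 0, nd 1 2 false, nd 2 3 false, nd 3 4 false, mn 4,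
      nd 0 5 false, nd 1 6 false, mn 0, mn 0],
    [mx 0, mx 2, nd 1 0 false, nd 2 1 false, mx 0, nd 1 2 false, nd 2 3 false, nd 3 4 false, mn 4,
      nd 0 5 false, nd 1 6 false, mn 2, mn 0],
    [mx 0, mx 0, nd 1 0 false, nd 2 1 false, mx 0, nd 1 2 false, nd 2 3 false, nd 3 4 false, mn 4,
      nd 0 5 false, nd 1 6 false, mn 0, mn 0],
    [mx 0, mx 0, nd 1 0 false, nd 2 1 false, mx 0, nd 1 2 false, nd 2 3 false, nd 3 4 false, mn 4,
      nd 0 5 false, nd 1 6 false, mn 2, mn 0],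
    [mx 0, mx 2, nd 1 0 false, nd 2 1 false, nd 0 2 false, nd 1 3 false, nd 2 4 false,
      nd 0 5 false, nd 1 6 false, mn 0, mn 0]]

/-- The word is reduced to at most six nodes or to a core word. -/
def reducesToCore (w : List SymPiece) : Bool :=
  let w' := relabel 0 (normalize w)
  (w'.countP fun p => p.event.isNode) ≤ 6 || coreWords.contains w'

/-- Check all ways to continue a mosaic of width five with `r` rows, if `w` is the word of the
previous rows and `c` is the number of its nodes. -/
def checkRows : ℕ → List Bool → List SymPiece → ℕ → Bool
  -- A strand left open at the bottom means that the rows do not form a mosaic.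
  | 0, bs, w, c => bs.any id || decide (c ≤ 6) || reducesToCore w
  -- Pruning: of the `r + 1` rows to come, the last has no node and the others have at most three
  -- nodes each.
  | r + 1, bs, w, c => decide (c + r * 3 ≤ 6) || (rowsFrom false bs).all fun ts =>
      checkRows r (ts.map fun t => t.connects .south) (w ++ symRow 0 c ts)
        (c + (ts.flatMap Tile.nodes).length)

-- The exhaustive computation on which the case of size five rests; node types play no role in it.
set_option maxRecDepth 100000 in
lemma checkRows_five : checkRows 5 (List.replicate 5 false) [] 0 = true := by
  decide +kernel

/-- The accumulator `w` is the word of the rows above. A branch pruned by the node count ends in the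
first alternative, by `Stacked.length_nodes_le`. -/
lemma reducesToCore_of_checkRows (rs : List (List Tile)) : ∀ (bs : List Bool) (w : List SymPiece)
    (c : ℕ), bs.length = 5 → checkRows rs.length bs w c = true → Stacked bs rs →
      c + (rs.flatMap fun r => r.flatMap Tile.nodes).length ≤ 6 ∨
        reducesToCore (w ++ symRows c rs) = true := by
  induction rs with
  | nil =>
    intro bs w c _ h hs
    simp only [List.length_nil, checkRows, Bool.or_eq_true, decide_eq_true_eq] at h
    rcases h with (h | h) | h
    · obtain ⟨b, hb, hb'⟩ := List.any_eq_true.1 h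
      have := hs b hb
      simp_all
    · exact Or.inl (by simpa using h)
    · exact Or.inr (by simpa [symRows] using h)
  | cons r rs ih =>
    intro bs w c hbs h hs
    have hle := Stacked.length_nodes_le (r :: rs) hs hbs
    obtain ⟨h1, rfl, h3⟩ := hs
    simp only [List.length_cons, checkRows, Bool.or_eq_true, decide_eq_true_eq,
      List.all_eq_true, Nat.add_sub_cancel] at h hle
    rcases h with h | h
    · left
      omega
    · have h4 := h _ (mem_rowsFrom r false h1)
      rw [symRow_shape, length_nodes_shape, List.map_map] at h4
      have e : (Tile.connects · .south) ∘ Tile.shape = (Tile.connects · .south) :=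
        funext fun t => connects_shape t .south
      rw [show (fun t : Tile => t.connects .south) ∘ Tile.shape = fun t => t.connects .south from e]
        at h4
      rcases ih _ _ _ (by simpa using hbs) h4 h3 with h5 | h5
      · left
        rw [List.flatMap_cons, List.length_append]
        omega
      · right
        simpa [symRows] using h5

end MarkedGraph

namespace MarkedGraph

open SymPiece

/-! ### Mosaics of size at most five -/

/-- The pretzel diagram to which the first four core words are equivalent. -/
def firstPretzel : List SymPiece :=
  [mx 0, mx 1, mx 3, nd 0 2 true, nd 0 5 false, nd 0 6 true, nd 2 3 false, nd 4 0 true,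
    nd 4 1 false, nd 4 4 true, mn 3, mn 1, mn 0]

/-- The pretzel diagram to which the last core word is equivalent. -/
def secondPretzel : List SymPiece :=
  [mx 0, mx 1, mx 3, nd 0 1 false, nd 0 0 true, nd 0 2 false, nd 2 3 true, nd 4 4 false,
    nd 4 6 true, nd 4 5 false, mn 3, mn 1, mn 0]

/-- The steps from the first core word to the pretzel diagram. -/
def firstScript : List (ℕ × Rule) :=
  [(1, .turn), (3, .swapL), (2, .swapL), (4, .swapL), (3, .swapL), (2, .turn), (1, .swapL),
    (5, .swapL), (4, .swapL), (10, .turn), (7, .turn), (8, .swapL), (9, .swapL), (7, .swapL),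
    (8, .swapL), (6, .swapL), (7, .swapL), (5, .swapL), (6, .swapL), (4, .swapL), (5, .swapL)]

/-- The steps from the last core word to the pretzel diagram. -/
def secondScript : List (ℕ × Rule) :=
  [(9, .swapR), (8, .turn), (7, .swapR), (8, .turn), (9, .swapR), (8, .turn), (3, .swapL),
    (1, .turn), (2, .swapL), (1, .turn), (0, .swapL), (1, .turn), (1, .turn), (0, .swapR),
    (1, .turn), (2, .swapR), (1, .turn), (3, .swapR), (0, .swapR), (1, .turn), (2, .swapR),
    (1, .turn), (0, .swapR), (1, .turn), (5, .zigIns 1 false), (6, .swapR), (5, .turn),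
    (4, .swapR), (7, .swapR), (8, .swapR), (9, .swapR), (10, .swapR), (3, .swapR), (2, .swapR)]

/-- The first four core words differ only in the order of two maxima at the top or of two minima at
the bottom, which explains the extra interchanges in front of the common script. -/
lemma coreWords_connects : ∀ w ∈ coreWords,
    Connects false 0 w firstPretzel firstScript [] = true ∨
    Connects false 0 w firstPretzel ((0, .swapL) :: firstScript) [] = true ∨
    Connects false 0 w firstPretzel ((11, .swapL) :: firstScript) [] = true ∨
    Connects false 0 w firstPretzel ((0, .swapL) :: (11, .swapL) :: firstScript) [] = true ∨
    Connects false 0 w secondPretzel secondScript [] = true := by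
  decide

lemma exists_pretzel_of_mem_coreWords {w : List SymPiece} (hw : w ∈ coreWords) (ν : ℕ → Node) :
    ∃ A x B, A.length = 3 ∧ B.length = 3 ∧ WordEquiv false 0 (nodeWord ν w) (pretzel A x B) := by
  have h1 : ∃ A x B, A.length = 3 ∧ B.length = 3 ∧ nodeWord ν firstPretzel = pretzel A x B :=
    ⟨[(ν 2).flip, ν 5, (ν 6).flip], ν 3, [(ν 0).flip, ν 1, (ν 4).flip], rfl, rfl, by
      simp [nodeWord, evalWord, firstPretzel, pretzel, column, SymEvent.eval_nd, SymEvent.eval_mx,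
        SymEvent.eval_mn]⟩
  have h2 : ∃ A x B, A.length = 3 ∧ B.length = 3 ∧ nodeWord ν secondPretzel = pretzel A x B :=
    ⟨[ν 1, (ν 0).flip, ν 2], (ν 3).flip, [ν 4, (ν 6).flip, ν 5], rfl, rfl, by
      simp [nodeWord, evalWord, secondPretzel, pretzel, column, SymEvent.eval_nd,
        SymEvent.eval_mx, SymEvent.eval_mn]⟩
  obtain ⟨A, x, B, hA, hB, e⟩ := h1
  obtain ⟨A', x', B', hA', hB', e'⟩ := h2
  rcases coreWords_connects w hw with h | h | h | h | h
  · exact ⟨A, x, B, hA, hB, e ▸ Connects.equiv h _ ν⟩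
  · exact ⟨A, x, B, hA, hB, e ▸ Connects.equiv h _ ν⟩
  · exact ⟨A, x, B, hA, hB, e ▸ Connects.equiv h _ ν⟩
  · exact ⟨A, x, B, hA, hB, e ▸ Connects.equiv h _ ν⟩
  · exact ⟨A', x', B', hA', hB', e' ▸ Connects.equiv h _ ν⟩

lemma countP_rowWord (ts : List Tile) : ∀ i,
    (rowWord i ts).countP Piece.isNode = (ts.flatMap Tile.nodes).length := by
  induction ts with
  | nil => exact fun _ => rfl
  | cons t ts ih =>
    intro i
    rw [rowWord, List.countP_append, ih, List.flatMap_cons, List.length_append]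
    congr 1
    cases t <;> rfl

lemma Mosaic.chIndex_diagram {n : ℕ} (M : Mosaic n) : M.diagram.chIndex =
    ((rows M.tile).flatMap fun r => r.flatMap Tile.nodes).length := by
  change ((rows M.tile).flatMap (rowWord 0)).countP Piece.isNode = _
  rw [List.countP_flatMap, List.length_flatMap]
  congr 2
  funext r
  exact countP_rowWord r 0

/-- The diagram of a mosaic of size five has at most six nodes, or it is equivalent to a word with
at most six nodes or to a pretzel diagram, up to circles. -/
lemma Mosaic.reduces_five (M : Mosaic 5) : M.diagram.chIndex ≤ 6 ∨
    ∃ w, Reduces 0 M.diagram.word w ∧ (w.countP Piece.isNode ≤ 6 ∨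
      ∃ A x B, A.length = 3 ∧ B.length = 3 ∧ WordEquiv false 0 w (pretzel A x B)) := by
  have hlen : (rows M.tile).length = 5 := by simp [rows]
  rcases reducesToCore_of_checkRows (rows M.tile) (List.replicate 5 false) [] 0 (by simp)
    (by rw [hlen]; exact checkRows_five) M.stacked with h | h
  · left
    rw [M.chIndex_diagram]
    omega
  · right
    have e := nodeWord_symRows ((rows M.tile).flatMap fun r => r.flatMap Tile.nodes) (rows M.tile) 0
      [] (by simp)
    generalize (fun v => ((rows M.tile).flatMap fun r => r.flatMap Tile.nodes).getD v
      (false, false)) = ν at e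
    rw [List.nil_append] at h
    have hw : M.diagram.word = nodeWord ν (symRows 0 (rows M.tile)) := e.symm
    have hr := normalize_reduces ν (symRows 0 (rows M.tile)) 0
      (by rw [← hw, M.diagram.closed]; rfl)
    -- The values `nodeValues` absorb the original numbers, so the renumbered word has the same
    -- meaning for the new assignment.
    rw [← hw, ← nodeWord_relabel ν (nodeValues ν (normalize (symRows 0 (rows M.tile)))) _ 0
      (by simp)] at hr
    refine ⟨_, hr, ?_⟩
    simp only [reducesToCore, Bool.or_eq_true, decide_eq_true_eq, List.contains_iff_mem] at h
    rcases h with h | h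
    · left
      rwa [nodeWord, countP_evalWord]
    · exact Or.inr (exists_pretzel_of_mem_coreWords h _)

/-! ### Surface-links with a small diagram -/

lemma countP_circles (k : ℕ) : (circles k).countP Piece.isNode = 0 := by
  induction k with
  | zero => rfl
  | succ k ih => simpa [circles, Piece.isNode] using ih

lemma resolve_circles (s : Bool) (k : ℕ) : resolve s (circles k) = circles k := by
  induction k with
  | zero => rfl
  | succ k ih => simpa [circles, resolve, Piece.splice] using ih

lemma Kei.count_circles {X : Type} [Fintype X] [DecidableEq X] (K : Kei X) (k : ℕ)
    (w : List Piece) : K.count (circles k ++ w) = Fintype.card X ^ k * K.count w := by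
  induction k with
  | zero => simp [circles]
  | succ k ih =>
    rw [circles, List.cons_append, List.cons_append, K.count_circle, ih, pow_succ']
    ring

/-- A circle multiplies every colouring number by the size of the kei. The factor is the same for
the dihedral and the trivial kei and cancels, so the circles split off by a reduction do not affect
the obstruction. -/
lemma not_obstructed {D : Diagram} (h : D.IsAdmissible) {k : ℕ} {w : List Piece}
    (e : D.word = circles k ++ w) : ¬ Obstructed w := by
  rintro ⟨s, hs⟩
  have h1 : (D.resolution s).IsTrivialLink := by
    cases s
    exacts [h.2, h.1]
  have h2 : (D.resolution s).word = circles k ++ resolve s w := by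
    change resolve s D.word = _
    rw [e, resolve_append, resolve_circles]
  have key : ∀ {n : ℕ} (K K' : Kei (Fin (n + 1))),
      K.count (resolve s w) = K'.count (resolve s w) := by
    intro n K K'
    have := K.count_eq_of_isTrivialLink K' h1
    rw [h2, K.count_circles, K'.count_circles] at this
    -- Cancelling needs a nonempty kei, hence the index type `Fin (n + 1)`.
    exact Nat.eq_of_mul_eq_mul_left (pow_pos (by simp) k) this
  rcases hs with hs | hs
  · exact hs (key _ _)
  · exact hs (key _ _)

namespace SurfaceLink

variable {K : SurfaceLink} {D : Diagram}

lemma chIndex_le_of_presents (h : D.Presents K) : K.chIndex ≤ D.chIndex :=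
  Nat.sInf_le ⟨D, h, rfl⟩

/-- The circles are kept in the new diagram, since they are components of it; having no nodes, they
cost nothing in the ch-index. -/
lemma exists_presents_of_reduces (h : D.Presents K) {w : List Piece} (hw : Reduces 0 D.word w) :
    ∃ k, ∃ D' : Diagram, D'.Presents K ∧ D'.word = circles k ++ w := by
  obtain ⟨k, hk⟩ := hw
  obtain ⟨hD, rfl⟩ := h
  have hc : strands (circles k ++ w) 0 = some 0 := by rw [← hk.strands_eq, D.closed]
  have e : YoshikawaEquiv D ⟨circles k ++ w, hc⟩ := by
    rw [← diagramEquiv_false]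
    exact WordEquiv.diagramEquiv hk
  exact ⟨k, ⟨circles k ++ w, hc⟩, ⟨(isAdmissible_iff e).1 hD,
    Quotient.sound (Relation.EqvGen.symm _ _ e)⟩, rfl⟩

lemma chIndex_le_of_reduces (h : D.Presents K) {w : List Piece} (hw : Reduces 0 D.word w) :
    K.chIndex ≤ w.countP Piece.isNode := by
  obtain ⟨k, D', h1, h2⟩ := exists_presents_of_reduces h hw
  refine (chIndex_le_of_presents h1).trans_eq ?_
  rw [Diagram.chIndex, h2, List.countP_append, countP_circles, zero_add]

/-- An obstructed pretzel would be an admissible diagram, up to circles, with a nontrivial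
resolution, so only the small case occurs. -/
lemma chIndex_le_six_of_pretzel (h : D.Presents K) {A B : List Node} {x : Node}
    (hA : A.length = 3) (hB : B.length = 3) (hw : Reduces 0 D.word (pretzel A x B)) :
    K.chIndex ≤ 6 := by
  rcases small_or_obstructed hA x hB with ⟨w', h1, h2⟩ | ⟨A', B', h1, h2⟩
  · exact (chIndex_le_of_reduces h (hw.trans (Reduces.of_equiv h1))).trans h2
  · obtain ⟨k, D', ⟨h3, -⟩, h4⟩ := exists_presents_of_reduces h (hw.trans (Reduces.of_equiv h1))
    exact absurd h2 (not_obstructed h3 h4)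

lemma chIndex_le_six_of_mosaic {n : ℕ} (hn : n ≤ 5) (M : Mosaic n) (h : M.diagram.Presents K) :
    K.chIndex ≤ 6 := by
  rcases hn.lt_or_eq with hn | rfl
  · refine (chIndex_le_of_presents h).trans ?_
    rw [M.chIndex_diagram]
    refine (Stacked.length_nodes_le (n := n) _ M.stacked (by simp)).trans ?_
    rw [show (rows M.tile).length = n by simp [rows]]
    -- The bound is `(n - 1) * (n - 2)` with truncated subtraction, at most `3 * 2` for `n ≤ 4`.
    interval_cases n <;> norm_num
  · rcases M.reduces_five with h1 | ⟨w, h1, h2 | ⟨A, x, B, hA, hB, h2⟩⟩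
    · exact (chIndex_le_of_presents h).trans h1
    · exact (chIndex_le_of_reduces h h1).trans h2
    · exact chIndex_le_six_of_pretzel h hA hB (h1.trans (Reduces.of_equiv h2))

end SurfaceLink

end MarkedGraph

/-! ### The main theorem -/

theorem mainTheorem1 (K : MarkedGraph.SurfaceLink) (hK : 7 ≤ K.chIndex) :
    6 ≤ K.mosaicNumber := by
  refine le_sInf ?_
  rintro _ ⟨n, M, hM, rfl⟩
  by_contra hn
  have h1 : n ≤ 5 := by
    have : n < 6 := by exact_mod_cast not_le.1 hn
    omega
  have := MarkedGraph.SurfaceLink.chIndex_le_six_of_mosaic h1 M hM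
  omega
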